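/- **Lemma (estimate on the time translates of the velocity).** Let $d\in\{2,3\}$, $\Omega=\prod_{j=1}^d(a_j,b_j)$, $T>0$, $\mathbf f\in L^2(0,T;L^2(\Omega)^d)$. *Mesh.* A MAC mesh $\mathcal M$ of $\Omega$ is given by subdivisions $a_j=x^j_0<\dots<x^j_{n_j}=b_j$, $1\le j\le d$; its cells $K$ are the corresponding boxes. Let $\mathcal E^{(i)}$ be the set of faces orthogonal to $\mathbf e_i$ and $\mathcal E^{(i)}_{\rm int}$ the subset of those not on $\partial\Omega$. The mesh regularity is $\eta_{\mathcal M}=\max\{|\sigma|/|\sigma'|:\sigma\in\mathcal E^{(i)},\sigma'\in\mathcal E^{(j)},i\neq j\}$. For an interior face $\sigma=K|L$, the dual cell $D_\sigma$ is the union of the halves $D_{K,\sigma}$, $D_{L,\sigma}$ of $K$, $L$ adjacent to $\sigma$. Write $\epsilon=\sigma|\sigma'$ for the dual face between $D_\sigma$ and $D_{\sigma'}$, and $d_\epsilon$ for the distance of the centers of $\sigma,\sigma'$ (for a face $\epsilon\subset\partial\Omega$ of $D_\sigma$, the distance of the center of $\sigma$ to $\epsilon$). Discrete velocities $\mathbf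 v=(v_\sigma)\in\mathbf H_{\mathcal E,0}$ have one value per face and vanish at the faces on $\partial\Omega$; the $i$-th component of $\mathbf v$ equals $v_\sigma$ on $D_\sigma$, $\sigma\in\mathcal E^{(i)}$. With $v_{\sigma'}=0$ when $\epsilon\subset\partial\Omega$, put $$\|\mathbf v\|_{1,\mathcal E,0}^2=\sum_{i=1}^d\ \sum_{\epsilon=\sigma|\sigma',\ \sigma,\sigma'\in\mathcal E^{(i)}}\frac{|\epsilon|}{d_\epsilon}(v_\sigma-v_{\sigma'})^2 .$$ *Discrete operators.* Let $\rho=(\rho_K)$ be a cell function and $\mathbf v,\mathbf w\in\mathbf H_{\mathcal E,0}$. For $\sigma\in\mathcal E^{(i)}$, $\sigma=K|L$, put $v_{K,\sigma}=v_\sigma\,\mathbf n_{K,\sigma}\cdot\mathbf e_i$ and $F_{K,\sigma}=|\sigma|\,\rho_\sigma v_{K,\sigma}$, where $\rho_\sigma=\rho_K$ if $v_{K,\sigma}\ge0$ and $\rho_\sigma=\rho_L$ otherwise; $F_{K,\sigma}=0$ if $\sigma\subset\partial\Omega$. Then $\mathrm{div}_{\mathcal M}(\rho\mathbf v)_K=\frac1{|K|}\sum_{\sigma\subset\partial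 K}F_{K,\sigma}$ and $\mathrm{div}_{\mathcal M}\mathbf v=\mathrm{div}_{\mathcal M}(1\,\mathbf v)$. For $\sigma=K|L\in\mathcal E^{(i)}_{\rm int}$: * $|D_\sigma|\rho_{D_\sigma}=|D_{K,\sigma}|\rho_K+|D_{L,\sigma}|\rho_L$; * $(\nabla_{\mathcal E}p)_\sigma=\frac{|\sigma|}{|D_\sigma|}(p_L-p_K)\,\mathbf n_{K,\sigma}\cdot\mathbf e_i$; * $(-\Delta_{\mathcal E}\mathbf v)_\sigma=\frac1{|D_\sigma|}\sum_{\epsilon=\sigma|\sigma'\subset\partial D_\sigma}\frac{|\epsilon|}{d_\epsilon}(v_\sigma-v_{\sigma'})$, with $v_{\sigma'}=0$ when $\epsilon\subset\partial\Omega$; * $(\mathbf C_{\mathcal E}(\rho\mathbf v)\mathbf w)_\sigma=\frac1{|D_\sigma|}\sum_{\epsilon=\sigma|\sigma'\subset\partial D_\sigma}F_{\sigma,\epsilon}\frac{w_\sigma+w_{\sigma'}}2$. Here $F_{\sigma,\epsilon}$ is the mass flux through $\epsilon$ outward $D_\sigma$: if $\epsilon\perp\mathbf e_i$, so that $\epsilon$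 lies in one cell, say $K$, of which $\sigma,\sigma'$ are opposite faces, it is the mean of the fluxes through $\sigma$ and $\sigma'$, both taken in the direction of the normal to $\epsilon$ outward $D_\sigma$; otherwise $\epsilon$ is the union of halves of a face $\tau$ of $K$ and a face $\tau'$ of $L$, and $F_{\sigma,\epsilon}=\frac12(F_{K,\tau}+F_{L,\tau'})$. *Scheme.* Let $N\ge1$, $\delta t=T/N$, $t_n=n\,\delta t$, let $0<\rho_{\min}<\rho_0\le\rho_{\max}$ a.e. in $\Omega$, with $\rho_0$ measurable, put $\rho^0_K=\frac1{|K|}\int_K\rho_0\,dx$, and let $\mathbf u^0\in\mathbf H_{\mathcal E,0}$ be any velocity with $\mathrm{div}_{\mathcal M}\mathbf u^0=0$ (for instance the Fortin interpolate, by mean values on the faces, of a divergence-free $\mathbf u_0\in H^1_0(\Omega)^d$). Suppose that, for $0\le n\le N-1$, $\mathbf u^{n+1}\in\mathbf H_{\mathcal E,0}$, the cell function $\rho^{n+1}$ and the cell function $p^{n+1}$ of zero mean satisfy, in all cells and at all interior faces $\sigma$, $$\tfrac1{\delta t}(\rho^{n+1}-\rho^n)+\mathrm{div}_{\mathcal M}(\rho^{n+1}\mathbf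 u^n)=0,\qquad \mathrm{div}_{\mathcal M}\mathbf u^{n+1}=0,$$ $$\tfrac1{\delta t}\bigl(\rho^{n+1}_{D_\sigma}u^{n+1}_\sigma-\rho^n_{D_\sigma}u^n_\sigma\bigr)+(\mathbf C_{\mathcal E}(\rho^{n+1}\mathbf u^n)\mathbf u^{n+1})_\sigma-(\Delta_{\mathcal E}\mathbf u^{n+1})_\sigma+(\nabla_{\mathcal E}p^{n+1})_\sigma=f^{n+1}_\sigma,$$ where $f^{n+1}_\sigma$ is the mean value of $f_i$ on $(t_n,t_{n+1})\times D_\sigma$, $\sigma\in\mathcal E^{(i)}_{\rm int}$. Let $\mathbf u(x,t)=\mathbf u^{n+1}(x)$ for $t\in(t_n,t_{n+1}]$, and $\|\mathbf u\|_{L^2(\mathbf H_{\mathcal E,0})}=\bigl(\sum_{n=0}^{N-1}\delta t\,\|\mathbf u^{n+1}\|_{1,\mathcal E,0}^2\bigr)^{1/2}$. *Claim.* For every $\eta$ there is a constant $C>0$, depending only on $\Omega$, $T$, $\mathbf f$ and $\eta$, such that for every mesh with $\eta_{\mathcal M}\le\eta$, all $N$, $\rho_{\min}$, $\rho_{\max}$,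 $\rho_0$, $\mathbf u^0$ and $(\mathbf u,\rho,p)$ as above, and every $\tau>0$, $$\int_0^{T-\tau}\!\!\int_\Omega|\mathbf u(x,t+\tau)-\mathbf u(x,t)|^2\,dx\,dt\le C\,\frac{\max(\rho_{\max},1)}{\rho_{\min}}\bigl(\|\mathbf u\|_{L^2(\mathbf H_{\mathcal E,0})}^3+1\bigr)\sqrt{\tau+\delta t}$$ (the left-hand side being $0$ if $\tau\ge T$). -/

import Mathlib

open MeasureTheory

noncomputable section

/-- The open box `∏ⱼ (aⱼ, bⱼ)` of `ℝ^d`. -/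
def boxDomain {d : ℕ} (a b : Fin d → ℝ) : Set (Fin d → ℝ) :=
  Set.univ.pi fun j => Set.Ioo (a j) (b j)

/-- A MAC grid of the box `∏ⱼ (aⱼ, bⱼ)`: a conforming partition of it into boxes, that is, a
subdivision `a j = x j 0 < x j 1 < ⋯ < x j (n j) = b j` of each edge.
(The values of `x j` outside `0, …, n j` are irrelevant.)

Multi-indices `k : Fin d → ℤ` number the cells and the faces.
* Cell `K` (`0 ≤ K j < n j`) is `∏ⱼ (x j (K j), x j (K j + 1))`.
* Face `σ` orthogonal to `eᵢ` (`0 ≤ σ i ≤ n i` and `0 ≤ σ j < n j` for `j ≠ i`) lies in the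
  hyperplane of the points with `i`-th coordinate `x i (σ i)` and spans
  `(x j (σ j), x j (σ j + 1))` in the directions `j ≠ i`. It is the lower face, in the direction
  `i`, of the cell `σ` and the upper face of the cell `σ - eᵢ`; it is interior when
  `0 < σ i < n i`. -/
structure MACGrid (d : ℕ) (a b : Fin d → ℝ) where
  n : Fin d → ℕ
  x : Fin d → ℤ → ℝ
  x_first : ∀ j, x j 0 = a j
  x_last : ∀ j, x j (n j) = b j
  x_strictMono : ∀ j, StrictMonoOn (x j) (Set.Icc 0 (n j : ℤ))

/-- The unit multi-index in the direction `j`. -/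
def unitIdx {d : ℕ} (j : Fin d) : Fin d → ℤ := Pi.single j 1

namespace MACGrid

variable {d : ℕ} {a b : Fin d → ℝ} (M : MACGrid d a b)

/-- Length of the `k`-th interval of the subdivision in the direction `j`. -/
def h (j : Fin d) (k : ℤ) : ℝ := M.x j (k + 1) - M.x j k

/-- Midpoint of the `k`-th interval of the subdivision in the direction `j`. -/
def mid (j : Fin d) (k : ℤ) : ℝ := (M.x j k + M.x j (k + 1)) / 2

/-! ### Cells, faces, regularity -/

def cells : Finset (Fin d → ℤ) :=
  Fintype.piFinset fun j => Finset.Ico 0 (M.n j : ℤ)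

/-- All faces orthogonal to `eᵢ`. -/
def faces (i : Fin d) : Finset (Fin d → ℤ) :=
  Fintype.piFinset fun j => if j = i then Finset.Icc 0 (M.n j : ℤ) else Finset.Ico 0 (M.n j : ℤ)

/-- Interior faces orthogonal to `eᵢ`. -/
def intFaces (i : Fin d) : Finset (Fin d → ℤ) :=
  Fintype.piFinset fun j => if j = i then Finset.Ioo 0 (M.n j : ℤ) else Finset.Ico 0 (M.n j : ℤ)

/-- The cell `K`, as a set. -/
def cellSet (K : Fin d → ℤ) : Set (Fin d → ℝ) :=
  Set.univ.pi fun j => Set.Ioo (M.x j (K j)) (M.x j (K j + 1))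

/-- `|K|`. -/
def cellVol (K : Fin d → ℤ) : ℝ := ∏ j, M.h j (K j)

/-- `|σ|` for a face `σ` orthogonal to `eᵢ`. -/
def faceArea (i : Fin d) (σ : Fin d → ℤ) : ℝ := ∏ j ∈ Finset.univ.erase i, M.h j (σ j)

/-- The regularity `η` of the mesh: the largest ratio `|σ| / |σ'|` of the areas of two faces
orthogonal to different directions (a maximum over a finite set, nonempty when `2 ≤ d`). -/
def regularity : ℝ :=
  sSup {r : ℝ | ∃ i j : Fin d, i ≠ j ∧ ∃ σ ∈ M.faces i, ∃ σ' ∈ M.faces j,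
    r = M.faceArea i σ / M.faceArea j σ'}

/-! ### Dual cells -/

/-- The dual cell `D_σ` of an interior face `σ` orthogonal to `eᵢ`: the union of the two halves
adjacent to `σ` of the two cells that share `σ`. -/
def dualSet (i : Fin d) (σ : Fin d → ℤ) : Set (Fin d → ℝ) :=
  Set.univ.pi fun j => if j = i then Set.Ioo (M.mid i (σ i - 1)) (M.mid i (σ i))
    else Set.Ioo (M.x j (σ j)) (M.x j (σ j + 1))

/-- Extent in the direction `j` of the dual cell of the interior face `σ` orthogonal to `eᵢ`. -/
def dualWidth (i : Fin d) (σ : Fin d → ℤ) (j : Fin d) : ℝ :=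
  if j = i then (M.h i (σ i - 1) + M.h i (σ i)) / 2 else M.h j (σ j)

/-- `|D_σ|`. -/
def dualVol (i : Fin d) (σ : Fin d → ℤ) : ℝ := ∏ j, M.dualWidth i σ j

/-- The dual face, orthogonal to `eⱼ`, between the dual cells of the faces `σ` and `σ + eⱼ`
(both orthogonal to `eᵢ`): its area `|ε|`. -/
def dualFaceArea (i j : Fin d) (σ : Fin d → ℤ) : ℝ :=
  ∏ k ∈ Finset.univ.erase j, M.dualWidth i σ k

/-- `j`-th coordinate of the centers of the faces orthogonal to `eᵢ`, `i ≠ j`, with `j`-th index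
`k`; for an index out of range, the coordinate of the corresponding side of the domain. -/
def center (j : Fin d) (k : ℤ) : ℝ :=
  if k < 0 then a j else if (M.n j : ℤ) ≤ k then b j else M.mid j k

/-- The distance `d_ε` attached to the dual face `ε` between (the dual cells of) `σ` and `σ + eⱼ`:
the distance of the centers of these two faces or, when `ε` lies on the boundary of the domain,
the distance from the center of the one that exists to `ε`. -/
def dualDist (i j : Fin d) (σ : Fin d → ℤ) : ℝ :=
  if j = i then M.h i (σ i) else M.center j (σ j + 1) - M.center j (σ j)

/-- Indices `σ` of the dual faces between `σ` and `σ + eⱼ` (faces orthogonal to `eᵢ`), including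
those on the boundary of the domain, where only one of `σ`, `σ + eⱼ` is a face.
(The dual faces between two boundary half cells, where every discrete velocity
vanishes on both sides, are left out.) -/
def dualFaces (i j : Fin d) : Finset (Fin d → ℤ) :=
  Fintype.piFinset fun k =>
    if k = i then (if j = i then Finset.Ico 0 (M.n k : ℤ) else Finset.Ioo 0 (M.n k : ℤ))
    else if k = j then Finset.Ico (-1) (M.n k : ℤ) else Finset.Ico 0 (M.n k : ℤ)

/-! ### Discrete velocities

A discrete velocity is given by its values `v i σ` at the faces `σ` orthogonal to `eᵢ`, a discrete
scalar function by its values `q K` at the cells `K`. -/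

/-- The discrete velocity space with homogeneous Dirichlet conditions: zero at the
boundary faces (and at the multi-indices that are no faces). -/
def velSpace : Set (Fin d → (Fin d → ℤ) → ℝ) :=
  {v | ∀ i σ, σ ∉ M.intFaces i → v i σ = 0}

/-- Square of the discrete `H¹₀` norm. -/
def h1NormSq (v : Fin d → (Fin d → ℤ) → ℝ) : ℝ :=
  ∑ i, ∑ j, ∑ σ ∈ M.dualFaces i j,
    M.dualFaceArea i j σ / M.dualDist i j σ * (v i σ - v i (σ + unitIdx j)) ^ 2

/-! ### Discrete operators -/

/-- Upwind mass flux, in the direction `eᵢ`, through the face `σ` orthogonal to `eᵢ`. With outward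
normals, `F_{K,σ}` is this number for the cell `K = σ - eᵢ` and its opposite for `K = σ`. -/
def massFlux (q : (Fin d → ℤ) → ℝ) (v : Fin d → (Fin d → ℤ) → ℝ) (i : Fin d)
    (σ : Fin d → ℤ) : ℝ :=
  M.faceArea i σ * (if 0 ≤ v i σ then q (σ - unitIdx i) else q σ) * v i σ

/-- Upwind discrete divergence `div_M (q v)` at the cell `K`. -/
def divMass (q : (Fin d → ℤ) → ℝ) (v : Fin d → (Fin d → ℤ) → ℝ) (K : Fin d → ℤ) : ℝ :=
  1 / M.cellVol K * ∑ i, (M.massFlux q v i (K + unitIdx i) - M.massFlux q v i K)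

/-- Discrete divergence of a velocity at the cell `K`. -/
def divVel (v : Fin d → (Fin d → ℤ) → ℝ) (K : Fin d → ℤ) : ℝ := M.divMass (fun _ => 1) v K

/-- The subspace of discretely divergence free velocities. -/
def divFreeSpace : Set (Fin d → (Fin d → ℤ) → ℝ) :=
  {v | v ∈ M.velSpace ∧ ∀ K ∈ M.cells, M.divVel v K = 0}

/-- Component `i` of the discrete pressure gradient, at the interior face `σ`. -/
def gradP (p : (Fin d → ℤ) → ℝ) (i : Fin d) (σ : Fin d → ℤ) : ℝ :=
  M.faceArea i σ / M.dualVol i σ * (p σ - p (σ - unitIdx i))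

/-- Component `i` of the discrete Laplacian, at the interior face `σ`. -/
def lap (v : Fin d → (Fin d → ℤ) → ℝ) (i : Fin d) (σ : Fin d → ℤ) : ℝ :=
  1 / M.dualVol i σ * ∑ j,
    (M.dualFaceArea i j σ / M.dualDist i j σ * (v i (σ + unitIdx j) - v i σ)
      - M.dualFaceArea i j (σ - unitIdx j) / M.dualDist i j (σ - unitIdx j) *
        (v i σ - v i (σ - unitIdx j)))

/-- Mass flux, in the direction `eⱼ`, through the dual face between `σ` and `σ + eⱼ`
(faces orthogonal to `eᵢ`). For `j = i` this dual face lies inside the cell `σ` and the flux is the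
mean of those through the faces `σ` and `σ + eᵢ`; for `j ≠ i` it consists of the halves of a
face of the cell `σ - eᵢ` and a face of the cell `σ`, both orthogonal to `eⱼ`. -/
def dualFlux (q : (Fin d → ℤ) → ℝ) (v : Fin d → (Fin d → ℤ) → ℝ) (i j : Fin d)
    (σ : Fin d → ℤ) : ℝ :=
  if j = i then (M.massFlux q v i σ + M.massFlux q v i (σ + unitIdx i)) / 2
  else (M.massFlux q v j (σ - unitIdx i + unitIdx j) + M.massFlux q v j (σ + unitIdx j)) / 2

/-- Component `i` of the discrete convection term `C(q v) w`, at the interior face `σ`. (The fluxes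
through the dual faces on the boundary of the domain vanish for `v` in `velSpace`.) -/
def conv (q : (Fin d → ℤ) → ℝ) (v w : Fin d → (Fin d → ℤ) → ℝ) (i : Fin d)
    (σ : Fin d → ℤ) : ℝ :=
  1 / M.dualVol i σ * ∑ j,
    (M.dualFlux q v i j σ * ((w i σ + w i (σ + unitIdx j)) / 2)
      - M.dualFlux q v i j (σ - unitIdx j) * ((w i σ + w i (σ - unitIdx j)) / 2))

/-- Density on the dual cell of the interior face `σ` orthogonal to `eᵢ`: the mean of the densities
of the two cells that share `σ`, weighted by the volumes of their halves. -/
def dualDensity (q : (Fin d → ℤ) → ℝ) (i : Fin d) (σ : Fin d → ℤ) : ℝ :=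
  (M.cellVol (σ - unitIdx i) / 2 * q (σ - unitIdx i) + M.cellVol σ / 2 * q σ) / M.dualVol i σ

/-- Mean value on the cell `K`. -/
def cellMean (r : (Fin d → ℝ) → ℝ) (K : Fin d → ℤ) : ℝ :=
  1 / M.cellVol K * ∫ y in M.cellSet K, r y

/-- Mean value of the `i`-th component of the force on `(t₁, t₂) × D_σ`. -/
def forceMean (f : ℝ → (Fin d → ℝ) → Fin d → ℝ) (t₁ t₂ : ℝ) (i : Fin d) (σ : Fin d → ℤ) : ℝ :=
  1 / ((t₂ - t₁) * M.dualVol i σ) *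
    ∫ z in Set.Ioo t₁ t₂ ×ˢ M.dualSet i σ, f z.1 z.2 i

/-- `(u, ρ, p)` is a solution of the scheme on `(0, T)` with `N` time steps of length `T / N`,
force `f` and initial density `ρ₀`; the initial discrete velocity `u 0` is an arbitrary
discretely divergence free velocity. `u m`, `ρ m`, `p m` are the unknowns at the time `m T / N`
(`p 0` is not used). -/
structure IsSolution (T : ℝ) (N : ℕ) (f : ℝ → (Fin d → ℝ) → Fin d → ℝ) (ρ₀ : (Fin d → ℝ) → ℝ)
    (u : ℕ → Fin d → (Fin d → ℤ) → ℝ) (ρ p : ℕ → (Fin d → ℤ) → ℝ) : Prop where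
  init_vel : u 0 ∈ M.divFreeSpace
  init_density : ∀ K ∈ M.cells, ρ 0 K = M.cellMean ρ₀ K
  vel_mem : ∀ m < N, u (m + 1) ∈ M.velSpace
  pressure_mean : ∀ m < N, ∑ K ∈ M.cells, M.cellVol K * p (m + 1) K = 0
  mass : ∀ m < N, ∀ K ∈ M.cells,
    (ρ (m + 1) K - ρ m K) / (T / N) + M.divMass (ρ (m + 1)) (u m) K = 0
  momentum : ∀ m < N, ∀ i, ∀ σ ∈ M.intFaces i,
    (M.dualDensity (ρ (m + 1)) i σ * u (m + 1) i σ - M.dualDensity (ρ m) i σ * u m i σ) / (T / N)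
      + M.conv (ρ (m + 1)) (u m) (u (m + 1)) i σ - M.lap (u (m + 1)) i σ
      + M.gradP (p (m + 1)) i σ
      = M.forceMean f (m * (T / N)) ((m + 1) * (T / N)) i σ
  incompressible : ∀ m < N, ∀ K ∈ M.cells, M.divVel (u (m + 1)) K = 0

/-- Component `i` of the piecewise constant velocity function: its value is `u (m + 1) i σ` for `y`
in `D_σ` and `t` in `(t_m, t_{m+1}]`, where `t_m = m T / N`. -/
def velFun (T : ℝ) (N : ℕ) (u : ℕ → Fin d → (Fin d → ℤ) → ℝ) (y : Fin d → ℝ) (t : ℝ)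
    (i : Fin d) : ℝ :=
  ∑ m ∈ Finset.range N, ∑ σ ∈ M.intFaces i,
    u (m + 1) i σ * (M.dualSet i σ).indicator (fun _ => (1 : ℝ)) y
      * (Set.Ioc (m * (T / N)) ((m + 1) * (T / N))).indicator (fun _ => (1 : ℝ)) t

/-- The norm of a discrete velocity in `L²(0, T; H¹₀)`, with the discrete `H¹₀` norm. -/
def l2H1Norm (T : ℝ) (N : ℕ) (u : ℕ → Fin d → (Fin d → ℤ) → ℝ) : ℝ :=
  Real.sqrt (∑ m ∈ Finset.range N, T / N * M.h1NormSq (u (m + 1)))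

end MACGrid

end

/-!
The time translates of the velocity are estimated by testing with differences of the velocity.
For time indices `1 ≤ s ≤ r ≤ N` put `v = u^r - u^s`. Then
`ρ^r v = (ρ^r u^r - ρ^s u^s) - (ρ^r - ρ^s) u^s`, and since the densities stay above `ρmin`
(discrete maximum principle), `ρmin ‖v‖²_{L²}` is at most the sum over the dual cells of the
right-hand side times `v`. The first bracket is a telescoping sum of momentum balances, the second
one of mass balances on the dual cells (`IsSolution.l2NormSq_sub_le`). The pressure disappears
because `v` is divergence free, and after a summation by parts the remaining terms are trilinear
forms `∑ F_ε w (v_σ - v_σ')` in which `F_ε` is a mass flux, besides the diffusion and the force.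
Only the velocities `u^1, …, u^N` occur, so that the initial velocity does not enter the bound.

The trilinear forms are bounded by the product of the three discrete `H¹₀` norms
(`QuasiUniform.sum_abs_dualFlux_mul_le`): Hölder's inequality with exponents `4, 4, 2` and the
discrete embedding of `H¹₀` into `L⁴` (`lattice_poincare_sobolev`). The latter is the
Ladyzhenskaya inequality of the lattice `ℤ^d`, `d ∈ {2, 3}`; it applies because a bound on the
ratios of the areas of faces orthogonal to different directions makes all edges of all cells
comparable (`exists_quasiUniform`), so that every weight is a power of one mesh size `H`.

With `b(t)` the norm of `u(t)`, this bounds the squared `L²` distance of `u(t + τ)` and `u(t)` by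
`(∑ₖ δt Bₖ + 2 c ∑ₖ δt bₖ b(t)) (b(t) + b(t + τ))`, up to constants, where `k` runs over the time
steps crossed between `t` and `t + τ`, `Bₖ` is summable in time (a product of two `L²` functions
of time) and `b` is square integrable. A given step is crossed for `t` in an interval of length
`τ` and at most `τ / δt + 1` steps are crossed for a given `t`, which yields the factor
`√(τ + δt)` on integrating in time (`integral_le_of_step_bound`).
-/

noncomputable section

/-! ### Sums of lattice functions -/

section Lattice

variable {ι : Type*} [AddCommGroup ι] [DecidableEq ι]

/-- Summation by parts for a lattice function `z` vanishing outside `F`. -/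
lemma sum_sub_comp_sub_mul (e : ι) {F E : Finset ι} (hFE : ∀ σ ∈ F, σ ∈ E)
    (hFE' : ∀ σ ∈ F, σ - e ∈ E) (G z : ι → ℝ) (hz : ∀ σ, σ ∉ F → z σ = 0) :
    ∑ σ ∈ F, (G σ - G (σ - e)) * z σ = ∑ σ ∈ E, G σ * (z σ - z (σ + e)) := by
  have h1 : ∑ σ ∈ F, G σ * z σ = ∑ σ ∈ E, G σ * z σ :=
    Finset.sum_subset hFE fun σ _ h => by rw [hz σ h, mul_zero]
  have h2 : ∑ σ ∈ F, G (σ - e) * z σ = ∑ σ ∈ E, G σ * z (σ + e) := by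
    have : ∑ σ ∈ F, G (σ - e) * z σ = ∑ σ ∈ F.image (· - e), G σ * z (σ + e) := by
      rw [Finset.sum_image (fun x _ y _ h => sub_left_injective h)]
      simp
    rw [this]
    refine Finset.sum_subset (fun σ h => ?_) fun σ _ h => ?_
    · obtain ⟨τ, hτ, rfl⟩ := Finset.mem_image.1 h
      exact hFE' τ hτ
    · rw [hz, mul_zero]
      intro hF
      exact h (Finset.mem_image.2 ⟨σ + e, hF, by simp⟩)
  simp only [sub_mul, mul_sub, Finset.sum_sub_distrib, h1, h2]

/-- Enlarging the index set beyond `F` does not enlarge a sum of nonnegative terms that vanish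
outside `F`. -/
lemma sum_le_sum_of_vanish {ι : Type*} [DecidableEq ι] {F E : Finset ι} {f : ι → ℝ}
    (hf : ∀ σ, 0 ≤ f σ)
    (hz : ∀ σ, σ ∉ F → f σ = 0) : ∑ σ ∈ E, f σ ≤ ∑ σ ∈ F, f σ := by
  calc ∑ σ ∈ E, f σ = ∑ σ ∈ E with σ ∈ F, f σ := by
        rw [Finset.sum_filter]
        exact Finset.sum_congr rfl fun σ _ => by split_ifs with h <;> simp [hz, h]
    _ ≤ _ := Finset.sum_le_sum_of_subset_of_nonneg
        (fun σ h => (Finset.mem_filter.1 h).2) fun σ _ _ => hf σ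

lemma sum_comp_add_le {F E : Finset ι} (e : ι) {f : ι → ℝ} (hf : ∀ σ, 0 ≤ f σ)
    (hz : ∀ σ, σ ∉ F → f σ = 0) : ∑ σ ∈ E, f (σ + e) ≤ ∑ σ ∈ F, f σ := by
  calc ∑ σ ∈ E, f (σ + e) = ∑ σ ∈ E.image (· + e), f σ := by
        rw [Finset.sum_image (fun x _ y _ h => add_left_injective e h)]
    _ ≤ _ := sum_le_sum_of_vanish hf hz

end Lattice

/-- Hölder's inequality with exponents `4, 4, 2`. -/
lemma sum_mul_mul_pow_four_le {ι : Type*} (s : Finset ι) (p q c : ι → ℝ) :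
    (∑ i ∈ s, p i * q i * c i) ^ 4
      ≤ (∑ i ∈ s, p i ^ 4) * (∑ i ∈ s, q i ^ 4) * (∑ i ∈ s, c i ^ 2) ^ 2 := by
  have h1 := Finset.sum_mul_sq_le_sq_mul_sq s (fun i => p i * q i) c
  have h2 := Finset.sum_mul_sq_le_sq_mul_sq s (fun i => p i ^ 2) (fun i => q i ^ 2)
  have e1 : ∀ i, (p i * q i) ^ 2 = p i ^ 2 * q i ^ 2 := fun i => mul_pow ..
  have e2 : ∀ r : ℝ, (r ^ 2) ^ 2 = r ^ 4 := fun r => by ring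
  simp only [e1] at h1
  simp only [e2] at h2
  calc (∑ i ∈ s, p i * q i * c i) ^ 4 = ((∑ i ∈ s, p i * q i * c i) ^ 2) ^ 2 := by ring
    _ ≤ ((∑ i ∈ s, p i ^ 2 * q i ^ 2) * ∑ i ∈ s, c i ^ 2) ^ 2 :=
        pow_le_pow_left₀ (sq_nonneg _) h1 2
    _ = (∑ i ∈ s, p i ^ 2 * q i ^ 2) ^ 2 * (∑ i ∈ s, c i ^ 2) ^ 2 := by ring
    _ ≤ _ := mul_le_mul_of_nonneg_right h2 (sq_nonneg _)

/-! ### Discrete Sobolev inequalities -/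

/-- A function on `ℤ` that vanishes outside `[0, n)` is bounded by its total variation. -/
lemma abs_le_sum_abs_sub {n : ℕ} {g : ℤ → ℝ} (hg : ∀ x, x ∉ Finset.Ico (0 : ℤ) n → g x = 0)
    (x : ℤ) : |g x| ≤ ∑ k ∈ Finset.Ico (-1 : ℤ) n, |g (k + 1) - g k| := by
  have hnn : ∀ s : Finset ℤ, 0 ≤ ∑ k ∈ s, |g (k + 1) - g k| :=
    fun s => Finset.sum_nonneg fun _ _ => abs_nonneg _
  by_cases hx : x ∈ Finset.Ico (0 : ℤ) n
  · have key : ∀ y : ℤ, -1 ≤ y → |g y| ≤ ∑ k ∈ Finset.Ico (-1 : ℤ) y, |g (k + 1) - g k| := by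
      intro y hy
      induction y, hy using Int.leInduction with
      | base => simp [hg]
      | succ m hm ih =>
        rw [← Finset.insert_Ico_right_eq_Ico_add_one hm, Finset.sum_insert (by simp)]
        have := abs_add_le (g (m + 1) - g m) (g m)
        rw [sub_add_cancel] at this
        linarith
    rw [Finset.mem_Ico] at hx
    refine (key x (by omega)).trans (Finset.sum_le_sum_of_subset_of_nonneg ?_ ?_)
    · exact Finset.Ico_subset_Ico le_rfl hx.2.le
    · exact fun _ _ _ => abs_nonneg _
  · rw [hg x hx, abs_zero]
    exact hnn _

/-- The one-dimensional discrete Poincaré inequality. -/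
lemma sum_sq_le_mul_sum_sub_sq {n : ℕ} {g : ℤ → ℝ}
    (hg : ∀ x, x ∉ Finset.Ico (0 : ℤ) n → g x = 0) :
    ∑ x ∈ Finset.Ico (-1 : ℤ) n, g x ^ 2
      ≤ ((n : ℝ) + 1) ^ 2 * ∑ k ∈ Finset.Ico (-1 : ℤ) n, (g (k + 1) - g k) ^ 2 := by
  have hc : ((Finset.Ico (-1 : ℤ) n).card : ℝ) = n + 1 := by
    rw [Int.card_Ico]
    have : ((n : ℤ) - -1).toNat = n + 1 := by omega
    rw [this]; push_cast; ring
  have h : ∀ x ∈ Finset.Ico (-1 : ℤ) n, g x ^ 2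
      ≤ ((n : ℝ) + 1) * ∑ k ∈ Finset.Ico (-1 : ℤ) n, (g (k + 1) - g k) ^ 2 := by
    intro x _
    have h1 := pow_le_pow_left₀ (abs_nonneg _) (abs_le_sum_abs_sub hg x) 2
    have h2 := sq_sum_le_card_mul_sum_sq (s := Finset.Ico (-1 : ℤ) n)
      (f := fun k => |g (k + 1) - g k|)
    simp only [sq_abs, hc] at h1 h2
    exact h1.trans h2
  refine (Finset.sum_le_card_nsmul _ _ _ h).trans (le_of_eq ?_)
  rw [nsmul_eq_mul, hc]; ring

/-- The total variation of `w²` (for `w'` a translate of `w`) is bounded by the `L²` norms of `w` and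
of its differences, since `w'² - w² = (w' + w) (w' - w)`. -/
lemma sum_abs_sq_sub_sq_sq_le {ι : Type*} (s : Finset ι) {w w' : ι → ℝ} {S : ℝ}
    (h : ∑ i ∈ s, w i ^ 2 ≤ S) (h' : ∑ i ∈ s, w' i ^ 2 ≤ S) :
    (∑ i ∈ s, |w' i ^ 2 - w i ^ 2|) ^ 2 ≤ 4 * S * ∑ i ∈ s, (w' i - w i) ^ 2 := by
  have h1 := Finset.sum_mul_sq_le_sq_mul_sq s (fun i => |w' i + w i|) (fun i => |w' i - w i|)
  have e : ∀ i, |w' i + w i| * |w' i - w i| = |w' i ^ 2 - w i ^ 2| := fun i => by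
    rw [← abs_mul]; congr 1; ring
  simp only [e, sq_abs] at h1
  refine h1.trans (mul_le_mul_of_nonneg_right ?_ (Finset.sum_nonneg fun _ _ => sq_nonneg _))
  calc ∑ i ∈ s, (w' i + w i) ^ 2 ≤ ∑ i ∈ s, (2 * w' i ^ 2 + 2 * w i ^ 2) :=
        Finset.sum_le_sum fun i _ => by nlinarith [sq_nonneg (w' i - w i)]
    _ ≤ 4 * S := by
        rw [Finset.sum_add_distrib, ← Finset.mul_sum, ← Finset.mul_sum]; linarith

lemma sum_comp_add_one_le {n : ℕ} {g : ℤ → ℝ} (hg0 : ∀ x, 0 ≤ g x)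
    (hg : ∀ x, x ∉ Finset.Ico (0 : ℤ) n → g x = 0) :
    ∑ x ∈ Finset.Ico (-1 : ℤ) n, g (x + 1) ≤ ∑ x ∈ Finset.Ico (-1 : ℤ) n, g x :=
  sum_comp_add_le 1 hg0 fun x hx => hg x fun h => hx
    (Finset.Ico_subset_Ico (by norm_num) le_rfl h)

/-- Ladyzhenskaya's inequality on the two-dimensional lattice: `w²` is bounded both by its total
variation along the row and by that along the column, and `w⁴` by the product of the two. -/
lemma sum_pow_four_le_two {m n : ℕ} {w : ℤ → ℤ → ℝ}
    (hx : ∀ x y, x ∉ Finset.Ico (0 : ℤ) m → w x y = 0)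
    (hy : ∀ x y, y ∉ Finset.Ico (0 : ℤ) n → w x y = 0) :
    ∑ x ∈ Finset.Ico (-1 : ℤ) m, ∑ y ∈ Finset.Ico (-1 : ℤ) n, w x y ^ 4
      ≤ 2 * (∑ x ∈ Finset.Ico (-1 : ℤ) m, ∑ y ∈ Finset.Ico (-1 : ℤ) n, w x y ^ 2) *
        (∑ x ∈ Finset.Ico (-1 : ℤ) m, ∑ y ∈ Finset.Ico (-1 : ℤ) n, (w (x + 1) y - w x y) ^ 2
        + ∑ x ∈ Finset.Ico (-1 : ℤ) m, ∑ y ∈ Finset.Ico (-1 : ℤ) n,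
          (w x (y + 1) - w x y) ^ 2) := by
  set X := Finset.Ico (-1 : ℤ) m
  set Y := Finset.Ico (-1 : ℤ) n
  set S := ∑ x ∈ X, ∑ y ∈ Y, w x y ^ 2
  have hA : ∀ x y, w x y ^ 2 ≤ ∑ k ∈ X, |w (k + 1) y ^ 2 - w k y ^ 2| := fun x y => by
    have := abs_le_sum_abs_sub (n := m) (g := fun x => w x y ^ 2)
      (fun x h => by simp [hx x y h]) x
    simpa only [abs_of_nonneg (sq_nonneg (w x y))] using this
  have hB : ∀ x y, w x y ^ 2 ≤ ∑ k ∈ Y, |w x (k + 1) ^ 2 - w x k ^ 2| := fun x y => by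
    have := abs_le_sum_abs_sub (n := n) (g := fun y => w x y ^ 2)
      (fun y h => by simp [hy x y h]) y
    simpa only [abs_of_nonneg (sq_nonneg (w x y))] using this
  have h4 : ∑ x ∈ X, ∑ y ∈ Y, w x y ^ 4
      ≤ (∑ x ∈ X, ∑ k ∈ Y, |w x (k + 1) ^ 2 - w x k ^ 2|) *
        (∑ y ∈ Y, ∑ k ∈ X, |w (k + 1) y ^ 2 - w k y ^ 2|) := by
    rw [Finset.sum_mul_sum]
    refine Finset.sum_le_sum fun x _ => Finset.sum_le_sum fun y _ => ?_
    calc w x y ^ 4 = w x y ^ 2 * w x y ^ 2 := by ring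
      _ ≤ _ := mul_le_mul (hB x y) (hA x y) (sq_nonneg _) ((sq_nonneg _).trans (hB x y))
  have hTx : (∑ y ∈ Y, ∑ k ∈ X, |w (k + 1) y ^ 2 - w k y ^ 2|) ^ 2
      ≤ 4 * S * ∑ x ∈ X, ∑ y ∈ Y, (w (x + 1) y - w x y) ^ 2 := by
    rw [Finset.sum_comm, ← Finset.sum_product', ← Finset.sum_product']
    refine sum_abs_sq_sub_sq_sq_le (X ×ˢ Y) (w := fun p => w p.1 p.2)
      (w' := fun p => w (p.1 + 1) p.2) (by rw [Finset.sum_product]) ?_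
    rw [Finset.sum_product, Finset.sum_comm, show S = ∑ y ∈ Y, ∑ x ∈ X, w x y ^ 2 from
      Finset.sum_comm]
    exact Finset.sum_le_sum fun y _ => sum_comp_add_one_le (g := fun x => w x y ^ 2)
      (fun x => sq_nonneg _) (fun x h => by simp [hx x y h])
  have hTy : (∑ x ∈ X, ∑ k ∈ Y, |w x (k + 1) ^ 2 - w x k ^ 2|) ^ 2
      ≤ 4 * S * ∑ x ∈ X, ∑ y ∈ Y, (w x (y + 1) - w x y) ^ 2 := by
    rw [← Finset.sum_product', ← Finset.sum_product']
    refine sum_abs_sq_sub_sq_sq_le (X ×ˢ Y) (w := fun p => w p.1 p.2)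
      (w' := fun p => w p.1 (p.2 + 1)) (by rw [Finset.sum_product]) ?_
    rw [Finset.sum_product]
    exact Finset.sum_le_sum fun x _ => sum_comp_add_one_le (g := fun y => w x y ^ 2)
      (fun y => sq_nonneg _) (fun y h => by simp [hy x y h])
  refine h4.trans ?_
  have := two_mul_le_add_sq (∑ x ∈ X, ∑ k ∈ Y, |w x (k + 1) ^ 2 - w x k ^ 2|)
    (∑ y ∈ Y, ∑ k ∈ X, |w (k + 1) y ^ 2 - w k y ^ 2|)
  linarith

/-- Ladyzhenskaya's inequality on the three-dimensional lattice: the two-dimensional one on each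
slice, with the square sums of the slices bounded by the total variation in the third direction. -/
lemma sum_pow_four_sq_le_three {l m n : ℕ} {w : ℤ → ℤ → ℤ → ℝ}
    (hx : ∀ x y z, x ∉ Finset.Ico (0 : ℤ) l → w x y z = 0)
    (hy : ∀ x y z, y ∉ Finset.Ico (0 : ℤ) m → w x y z = 0)
    (hz : ∀ x y z, z ∉ Finset.Ico (0 : ℤ) n → w x y z = 0) :
    (∑ x ∈ Finset.Ico (-1 : ℤ) l, ∑ y ∈ Finset.Ico (-1 : ℤ) m, ∑ z ∈ Finset.Ico (-1 : ℤ) n,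
        w x y z ^ 4) ^ 2
      ≤ 16 * (∑ x ∈ Finset.Ico (-1 : ℤ) l, ∑ y ∈ Finset.Ico (-1 : ℤ) m,
          ∑ z ∈ Finset.Ico (-1 : ℤ) n, w x y z ^ 2) *
        (∑ x ∈ Finset.Ico (-1 : ℤ) l, ∑ y ∈ Finset.Ico (-1 : ℤ) m, ∑ z ∈ Finset.Ico (-1 : ℤ) n,
          (w (x + 1) y z - w x y z) ^ 2
        + ∑ x ∈ Finset.Ico (-1 : ℤ) l, ∑ y ∈ Finset.Ico (-1 : ℤ) m, ∑ z ∈ Finset.Ico (-1 : ℤ) n,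
          (w x (y + 1) z - w x y z) ^ 2
        + ∑ x ∈ Finset.Ico (-1 : ℤ) l, ∑ y ∈ Finset.Ico (-1 : ℤ) m, ∑ z ∈ Finset.Ico (-1 : ℤ) n,
          (w x y (z + 1) - w x y z) ^ 2) ^ 3 := by
  set X := Finset.Ico (-1 : ℤ) l
  set Y := Finset.Ico (-1 : ℤ) m
  set Z := Finset.Ico (-1 : ℤ) n
  set S := ∑ x ∈ X, ∑ y ∈ Y, ∑ z ∈ Z, w x y z ^ 2
  set D₁ := ∑ x ∈ X, ∑ y ∈ Y, ∑ z ∈ Z, (w (x + 1) y z - w x y z) ^ 2 with hD₁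
  set D₂ := ∑ x ∈ X, ∑ y ∈ Y, ∑ z ∈ Z, (w x (y + 1) z - w x y z) ^ 2 with hD₂
  set D₃ := ∑ x ∈ X, ∑ y ∈ Y, ∑ z ∈ Z, (w x y (z + 1) - w x y z) ^ 2 with hD₃
  set V := ∑ x ∈ X, ∑ y ∈ Y, ∑ z ∈ Z, |w x y (z + 1) ^ 2 - w x y z ^ 2|
  have nn : ∀ g : ℤ → ℤ → ℤ → ℝ, 0 ≤ ∑ x ∈ X, ∑ y ∈ Y, ∑ z ∈ Z, g x y z ^ 2 := fun g =>
    Finset.sum_nonneg fun _ _ => Finset.sum_nonneg fun _ _ => Finset.sum_nonneg fun _ _ =>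
      sq_nonneg _
  have h1 : 0 ≤ D₁ := nn _
  have h2 : 0 ≤ D₂ := nn _
  have h3 : 0 ≤ D₃ := nn _
  have hS : 0 ≤ S := nn _
  have hV0 : 0 ≤ V := Finset.sum_nonneg fun _ _ => Finset.sum_nonneg fun _ _ =>
    Finset.sum_nonneg fun _ _ => abs_nonneg _
  have toZ : ∀ g : ℤ → ℤ → ℤ → ℝ, ∑ x ∈ X, ∑ y ∈ Y, ∑ z ∈ Z, g x y z
      = ∑ z ∈ Z, ∑ x ∈ X, ∑ y ∈ Y, g x y z := fun g => by
    rw [Finset.sum_comm]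
    rw [Finset.sum_congr rfl fun y _ => Finset.sum_comm]
    rw [Finset.sum_comm]
    exact Finset.sum_congr rfl fun z _ => Finset.sum_comm
  have hV : V ^ 2 ≤ 4 * S * D₃ := by
    have hp : ∀ g : ℤ → ℤ → ℤ → ℝ, ∑ x ∈ X, ∑ y ∈ Y, ∑ z ∈ Z, g x y z
        = ∑ p ∈ X ×ˢ Y ×ˢ Z, g p.1 p.2.1 p.2.2 := fun g => by
      rw [Finset.sum_product]
      exact Finset.sum_congr rfl fun x _ => by rw [Finset.sum_product]
    rw [show V = _ from hp _, hD₃, hp]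
    refine sum_abs_sq_sub_sq_sq_le (X ×ˢ Y ×ˢ Z) (w := fun p => w p.1 p.2.1 p.2.2)
      (w' := fun p => w p.1 p.2.1 (p.2.2 + 1)) (hp fun x y z => w x y z ^ 2).ge ?_
    rw [← hp fun x y z => w x y (z + 1) ^ 2]
    exact Finset.sum_le_sum fun x _ => Finset.sum_le_sum fun y _ =>
      sum_comp_add_one_le (g := fun z => w x y z ^ 2)
      (fun z => sq_nonneg _) (fun z h => by simp [hz x y z h])
  have hslice : ∀ z, ∑ x ∈ X, ∑ y ∈ Y, w x y z ^ 2 ≤ V := fun z => by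
    have := abs_le_sum_abs_sub (n := n) (g := fun z => ∑ x ∈ X, ∑ y ∈ Y, w x y z ^ 2)
      (fun z h => by simp [hz _ _ z h]) z
    refine (le_abs_self _).trans (this.trans ?_)
    rw [show V = _ from toZ _]
    refine Finset.sum_le_sum fun z _ => ?_
    rw [← Finset.sum_sub_distrib]
    refine (Finset.abs_sum_le_sum_abs _ _).trans (Finset.sum_le_sum fun x _ => ?_)
    rw [← Finset.sum_sub_distrib]
    exact Finset.abs_sum_le_sum_abs _ _
  have h4 : ∑ x ∈ X, ∑ y ∈ Y, ∑ z ∈ Z, w x y z ^ 4 ≤ 2 * V * (D₁ + D₂) := by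
    rw [toZ, hD₁, hD₂, toZ, toZ, ← Finset.sum_add_distrib, Finset.mul_sum]
    refine Finset.sum_le_sum fun z _ => (sum_pow_four_le_two (w := fun x y => w x y z)
      (fun x y => hx x y z) (fun x y => hy x y z)).trans ?_
    refine mul_le_mul_of_nonneg_right (by linarith [hslice z]) ?_
    refine add_nonneg ?_ ?_ <;> exact Finset.sum_nonneg fun _ _ => Finset.sum_nonneg fun _ _ =>
      sq_nonneg _
  have h40 : 0 ≤ ∑ x ∈ X, ∑ y ∈ Y, ∑ z ∈ Z, w x y z ^ 4 :=
    Finset.sum_nonneg fun _ _ => Finset.sum_nonneg fun _ _ => Finset.sum_nonneg fun _ _ => by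
      positivity
  refine (pow_le_pow_left₀ h40 h4 2).trans ?_
  clear h40 h4 hslice toZ nn
  clear_value S D₁ D₂ D₃ V
  calc (2 * V * (D₁ + D₂)) ^ 2
      = 4 * V ^ 2 * (D₁ + D₂) ^ 2 := by ring
    _ ≤ 4 * (4 * S * D₃) * (D₁ + D₂) ^ 2 := by gcongr
    _ = 16 * S * (D₃ * (D₁ + D₂) ^ 2) := by ring
    _ ≤ 16 * S * ((D₁ + D₂ + D₃) * (D₁ + D₂ + D₃) ^ 2) := by
        refine mul_le_mul_of_nonneg_left ?_ (by positivity)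
        exact mul_le_mul (by linarith) (pow_le_pow_left₀ (by linarith) (by linarith) 2)
          (sq_nonneg _) (by linarith)
    _ = 16 * S * (D₁ + D₂ + D₃) ^ 3 := by ring

lemma sum_piFinset_fin_two (I : Fin 2 → Finset ℤ) (g : (Fin 2 → ℤ) → ℝ) :
    ∑ σ ∈ Fintype.piFinset I, g σ = ∑ x ∈ I 0, ∑ y ∈ I 1, g ![x, y] := by
  rw [← Finset.sum_product']
  refine Finset.sum_nbij' (fun σ => (σ 0, σ 1)) (fun p => ![p.1, p.2]) ?_ ?_ ?_ ?_ ?_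
  · intro σ h
    rw [Fintype.mem_piFinset] at h
    exact Finset.mem_product.2 ⟨h 0, h 1⟩
  · intro p h
    rw [Finset.mem_product] at h
    rw [Fintype.mem_piFinset]
    intro j
    fin_cases j
    exacts [h.1, h.2]
  · intro σ _
    ext j
    fin_cases j <;> rfl
  · intro p _; rfl
  · intro σ _
    congr 1
    ext j
    fin_cases j <;> rfl

lemma sum_piFinset_fin_three (I : Fin 3 → Finset ℤ) (g : (Fin 3 → ℤ) → ℝ) :
    ∑ σ ∈ Fintype.piFinset I, g σ = ∑ x ∈ I 0, ∑ y ∈ I 1, ∑ z ∈ I 2, g ![x, y, z] := by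
  rw [Finset.sum_congr rfl fun x _ => (Finset.sum_product' (I 1) (I 2) fun y z => g ![x, y, z]).symm,
    ← Finset.sum_product']
  refine Finset.sum_nbij' (fun σ => (σ 0, σ 1, σ 2)) (fun p => ![p.1, p.2.1, p.2.2]) ?_ ?_ ?_ ?_ ?_
  · intro σ h
    rw [Fintype.mem_piFinset] at h
    exact Finset.mem_product.2 ⟨h 0, Finset.mem_product.2 ⟨h 1, h 2⟩⟩
  · intro p h
    rw [Finset.mem_product, Finset.mem_product] at h
    rw [Fintype.mem_piFinset]
    intro j
    fin_cases j
    exacts [h.1, h.2.1, h.2.2]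
  · intro σ _
    ext j
    fin_cases j <;> rfl
  · intro p _; rfl
  · intro σ _
    congr 1
    ext j
    fin_cases j <;> rfl

/-- The discrete Poincaré and Sobolev (`H¹ ⊂ L⁴`) inequalities, for a function on the lattice
`H ℤ^d`, `d ∈ {2, 3}`, supported in a box with edges of lengths at most `L`. -/
lemma lattice_poincare_sobolev {d : ℕ} (hd : d = 2 ∨ d = 3) {n : Fin d → ℕ}
    {w : (Fin d → ℤ) → ℝ}
    (hw : ∀ σ, σ ∉ Fintype.piFinset (fun j => Finset.Ico (0 : ℤ) (n j)) → w σ = 0)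
    {H L : ℝ} (hH : 0 < H) (hL : ∀ j, ((n j : ℝ) + 1) * H ≤ L) :
    H ^ d * ∑ σ ∈ Fintype.piFinset (fun j => Finset.Ico (-1 : ℤ) (n j)), w σ ^ 2
        ≤ L ^ 2 * (H ^ (d - 2) * ∑ j, ∑ σ ∈ Fintype.piFinset (fun j => Finset.Ico (-1 : ℤ) (n j)),
          (w (σ + unitIdx j) - w σ) ^ 2) ∧
      H ^ d * ∑ σ ∈ Fintype.piFinset (fun j => Finset.Ico (-1 : ℤ) (n j)), w σ ^ 4
        ≤ (2 * L ^ 2 + 4 * L) *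
          (H ^ (d - 2) * ∑ j, ∑ σ ∈ Fintype.piFinset (fun j => Finset.Ico (-1 : ℤ) (n j)),
          (w (σ + unitIdx j) - w σ) ^ 2) ^ 2 := by
  have hw' : ∀ σ j, σ j ∉ Finset.Ico (0 : ℤ) (n j) → w σ = 0 := fun σ j h =>
    hw σ fun h' => h (Fintype.mem_piFinset.1 h' j)
  rcases hd with rfl | rfl
  · have hLH : (((n 0 : ℝ) + 1) * H) ^ 2 ≤ L ^ 2 :=
      pow_le_pow_left₀ (by positivity) (hL 0) 2
    have hL0 : 0 ≤ L := le_trans (by positivity) (hL 0)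
    have ex : ∀ x y : ℤ, ![x, y] + unitIdx 0 = ![x + 1, y] := fun x y => by
      ext j; fin_cases j <;> simp [unitIdx]
    have ey : ∀ x y : ℤ, ![x, y] + unitIdx 1 = ![x, y + 1] := fun x y => by
      ext j; fin_cases j <;> simp [unitIdx]
    simp only [Fin.sum_univ_two, sum_piFinset_fin_two, ex, ey]
    have hx : ∀ x y, x ∉ Finset.Ico (0 : ℤ) (n 0) → w ![x, y] = 0 := fun x y h =>
      hw' _ 0 (by simpa using h)
    have hy : ∀ x y, y ∉ Finset.Ico (0 : ℤ) (n 1) → w ![x, y] = 0 := fun x y h =>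
      hw' _ 1 (by simpa using h)
    have h4 := sum_pow_four_le_two hx hy
    have h2 : ∑ x ∈ Finset.Ico (-1 : ℤ) (n 0), ∑ y ∈ Finset.Ico (-1 : ℤ) (n 1), w ![x, y] ^ 2
        ≤ ((n 0 : ℝ) + 1) ^ 2 * ∑ x ∈ Finset.Ico (-1 : ℤ) (n 0),
          ∑ y ∈ Finset.Ico (-1 : ℤ) (n 1), (w ![x + 1, y] - w ![x, y]) ^ 2 := by
      rw [Finset.sum_comm, Finset.sum_comm (s := Finset.Ico (-1 : ℤ) (n 0)), Finset.mul_sum]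
      exact Finset.sum_le_sum fun y _ => sum_sq_le_mul_sum_sub_sq fun x => hx x y
    set S := ∑ x ∈ Finset.Ico (-1 : ℤ) (n 0), ∑ y ∈ Finset.Ico (-1 : ℤ) (n 1), w ![x, y] ^ 2
    set Q := ∑ x ∈ Finset.Ico (-1 : ℤ) (n 0), ∑ y ∈ Finset.Ico (-1 : ℤ) (n 1), w ![x, y] ^ 4
    set D₁ := ∑ x ∈ Finset.Ico (-1 : ℤ) (n 0), ∑ y ∈ Finset.Ico (-1 : ℤ) (n 1),
      (w ![x + 1, y] - w ![x, y]) ^ 2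
    set D₂ := ∑ x ∈ Finset.Ico (-1 : ℤ) (n 0), ∑ y ∈ Finset.Ico (-1 : ℤ) (n 1),
      (w ![x, y + 1] - w ![x, y]) ^ 2
    have h1 : 0 ≤ D₁ := Finset.sum_nonneg fun _ _ => Finset.sum_nonneg fun _ _ => sq_nonneg _
    have h3 : 0 ≤ D₂ := Finset.sum_nonneg fun _ _ => Finset.sum_nonneg fun _ _ => sq_nonneg _
    clear_value S Q D₁ D₂
    have hP : H ^ 2 * S ≤ L ^ 2 * (D₁ + D₂) := by
      calc H ^ 2 * S ≤ H ^ 2 * (((n 0 : ℝ) + 1) ^ 2 * D₁) := by gcongr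
        _ = (((n 0 : ℝ) + 1) * H) ^ 2 * D₁ := by ring
        _ ≤ L ^ 2 * (D₁ + D₂) := mul_le_mul hLH (by linarith) h1 (sq_nonneg _)
    refine ⟨by simpa using hP, ?_⟩
    calc H ^ 2 * Q ≤ H ^ 2 * (2 * S * (D₁ + D₂)) := by gcongr
      _ = 2 * (H ^ 2 * S) * (D₁ + D₂) := by ring
      _ ≤ 2 * (L ^ 2 * (D₁ + D₂)) * (D₁ + D₂) := by gcongr
      _ = 2 * L ^ 2 * (D₁ + D₂) ^ 2 := by ring
      _ ≤ (2 * L ^ 2 + 4 * L) * (D₁ + D₂) ^ 2 := by gcongr; linarith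
      _ = _ := by simp
  · have hLH : (((n 0 : ℝ) + 1) * H) ^ 2 ≤ L ^ 2 :=
      pow_le_pow_left₀ (by positivity) (hL 0) 2
    have hL0 : 0 ≤ L := le_trans (by positivity) (hL 0)
    have ex : ∀ x y z : ℤ, ![x, y, z] + unitIdx 0 = ![x + 1, y, z] := fun x y z => by
      ext j; fin_cases j <;> simp [unitIdx]
    have ey : ∀ x y z : ℤ, ![x, y, z] + unitIdx 1 = ![x, y + 1, z] := fun x y z => by
      ext j; fin_cases j <;> simp [unitIdx]
    have ez : ∀ x y z : ℤ, ![x, y, z] + unitIdx 2 = ![x, y, z + 1] := fun x y z => by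
      ext j; fin_cases j <;> simp [unitIdx]
    simp only [Fin.sum_univ_three, sum_piFinset_fin_three, ex, ey, ez]
    have hx : ∀ x y z, x ∉ Finset.Ico (0 : ℤ) (n 0) → w ![x, y, z] = 0 := fun x y z h =>
      hw' _ 0 (by simpa using h)
    have hy : ∀ x y z, y ∉ Finset.Ico (0 : ℤ) (n 1) → w ![x, y, z] = 0 := fun x y z h =>
      hw' _ 1 (by simpa using h)
    have hz : ∀ x y z, z ∉ Finset.Ico (0 : ℤ) (n 2) → w ![x, y, z] = 0 := fun x y z h =>
      hw' _ 2 (by simpa using h)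
    have h4 := sum_pow_four_sq_le_three hx hy hz
    have comm : ∀ (X Y Z : Finset ℤ) (g : ℤ → ℤ → ℤ → ℝ), ∑ x ∈ X, ∑ y ∈ Y, ∑ z ∈ Z, g x y z
        = ∑ y ∈ Y, ∑ z ∈ Z, ∑ x ∈ X, g x y z := fun X Y Z g => by
      rw [Finset.sum_comm]
      exact Finset.sum_congr rfl fun y _ => Finset.sum_comm
    have h2 : ∑ x ∈ Finset.Ico (-1 : ℤ) (n 0), ∑ y ∈ Finset.Ico (-1 : ℤ) (n 1),
          ∑ z ∈ Finset.Ico (-1 : ℤ) (n 2), w ![x, y, z] ^ 2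
        ≤ ((n 0 : ℝ) + 1) ^ 2 * ∑ x ∈ Finset.Ico (-1 : ℤ) (n 0),
          ∑ y ∈ Finset.Ico (-1 : ℤ) (n 1), ∑ z ∈ Finset.Ico (-1 : ℤ) (n 2),
            (w ![x + 1, y, z] - w ![x, y, z]) ^ 2 := by
      rw [comm _ _ _ fun x y z => w ![x, y, z] ^ 2,
        comm _ _ _ fun x y z => (w ![x + 1, y, z] - w ![x, y, z]) ^ 2, Finset.mul_sum]
      refine Finset.sum_le_sum fun y _ => ?_
      rw [Finset.mul_sum]
      exact Finset.sum_le_sum fun z _ => sum_sq_le_mul_sum_sub_sq fun x => hx x y z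
    set S := ∑ x ∈ Finset.Ico (-1 : ℤ) (n 0), ∑ y ∈ Finset.Ico (-1 : ℤ) (n 1),
      ∑ z ∈ Finset.Ico (-1 : ℤ) (n 2), w ![x, y, z] ^ 2
    set Q := ∑ x ∈ Finset.Ico (-1 : ℤ) (n 0), ∑ y ∈ Finset.Ico (-1 : ℤ) (n 1),
      ∑ z ∈ Finset.Ico (-1 : ℤ) (n 2), w ![x, y, z] ^ 4
    set D₁ := ∑ x ∈ Finset.Ico (-1 : ℤ) (n 0), ∑ y ∈ Finset.Ico (-1 : ℤ) (n 1),
      ∑ z ∈ Finset.Ico (-1 : ℤ) (n 2), (w ![x + 1, y, z] - w ![x, y, z]) ^ 2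
    set D₂ := ∑ x ∈ Finset.Ico (-1 : ℤ) (n 0), ∑ y ∈ Finset.Ico (-1 : ℤ) (n 1),
      ∑ z ∈ Finset.Ico (-1 : ℤ) (n 2), (w ![x, y + 1, z] - w ![x, y, z]) ^ 2
    set D₃ := ∑ x ∈ Finset.Ico (-1 : ℤ) (n 0), ∑ y ∈ Finset.Ico (-1 : ℤ) (n 1),
      ∑ z ∈ Finset.Ico (-1 : ℤ) (n 2), (w ![x, y, z + 1] - w ![x, y, z]) ^ 2
    have h1 : 0 ≤ D₁ := Finset.sum_nonneg fun _ _ => Finset.sum_nonneg fun _ _ =>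
      Finset.sum_nonneg fun _ _ => sq_nonneg _
    have h3 : 0 ≤ D₂ := Finset.sum_nonneg fun _ _ => Finset.sum_nonneg fun _ _ =>
      Finset.sum_nonneg fun _ _ => sq_nonneg _
    have h5 : 0 ≤ D₃ := Finset.sum_nonneg fun _ _ => Finset.sum_nonneg fun _ _ =>
      Finset.sum_nonneg fun _ _ => sq_nonneg _
    have hD : D₁ ≤ D₁ + D₂ + D₃ := by linarith only [h3, h5]
    have hD0 : 0 ≤ D₁ + D₂ + D₃ := by linarith
    generalize D₁ + D₂ + D₃ = D at *
    clear_value S Q D₁ D₂ D₃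
    have hP : S ≤ ((n 0 : ℝ) + 1) ^ 2 * D := h2.trans (by gcongr)
    have hQ : Q ≤ 4 * ((n 0 : ℝ) + 1) * D ^ 2 := by
      refine le_of_sq_le_sq ?_ (by positivity)
      calc Q ^ 2 ≤ 16 * S * D ^ 3 := h4
        _ ≤ 16 * (((n 0 : ℝ) + 1) ^ 2 * D) * D ^ 3 := by gcongr
        _ = _ := by ring
    constructor
    · calc H ^ 3 * S ≤ H ^ 3 * (((n 0 : ℝ) + 1) ^ 2 * D) := by gcongr
        _ = (((n 0 : ℝ) + 1) * H) ^ 2 * (H * D) := by ring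
        _ ≤ L ^ 2 * (H * D) := by gcongr
        _ = _ := by simp
    · calc H ^ 3 * Q ≤ H ^ 3 * (4 * ((n 0 : ℝ) + 1) * D ^ 2) := by gcongr
        _ = 4 * (((n 0 : ℝ) + 1) * H) * (H * D) ^ 2 := by ring
        _ ≤ 4 * L * (H * D) ^ 2 := by gcongr; exact hL 0
        _ ≤ (2 * L ^ 2 + 4 * L) * (H * D) ^ 2 := by gcongr; nlinarith [sq_nonneg L]
        _ = _ := by simp

namespace MACGrid

variable {d : ℕ} {a b : Fin d → ℝ} {M : MACGrid d a b}

/-! ### Quasi-uniformity of the mesh -/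

lemma n_pos (M : MACGrid d a b) (hab : ∀ i, a i < b i) (j : Fin d) : 0 < M.n j := by
  by_contra h
  have h0 : M.n j = 0 := by omega
  have := M.x_last j
  rw [h0, Nat.cast_zero, M.x_first j] at this
  exact absurd this (hab j).ne

lemma h_pos (M : MACGrid d a b) {j : Fin d} {k : ℤ} (h0 : 0 ≤ k) (h1 : k < M.n j) :
    0 < M.h j k :=
  sub_pos.2 (M.x_strictMono j ⟨h0, h1.le⟩ ⟨by omega, by omega⟩ (by omega))

lemma sum_h (M : MACGrid d a b) (j : Fin d) :
    ∑ k ∈ Finset.Ico (0 : ℤ) (M.n j), M.h j k = b j - a j := by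
  have key : ∀ m : ℤ, 0 ≤ m → ∑ k ∈ Finset.Ico (0 : ℤ) m, M.h j k = M.x j m - M.x j 0 := by
    intro m hm
    induction m, hm using Int.leInduction with
    | base => simp
    | succ m hm ih =>
      rw [← Finset.insert_Ico_right_eq_Ico_add_one hm, Finset.sum_insert (by simp), ih, h]
      ring
  rw [key _ (Int.natCast_nonneg _), M.x_last, M.x_first]

/-- All edges of all cells have length between `H / κ` and `κ H`. For `κ` depending only on the
regularity of the mesh, `H` plays the role of the mesh size. -/
structure QuasiUniform (M : MACGrid d a b) (κ H : ℝ) : Prop where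
  one_le : 1 ≤ κ
  pos : 0 < H
  le_h : ∀ j (k : ℤ), 0 ≤ k → k < M.n j → H ≤ κ * M.h j k
  h_le : ∀ j (k : ℤ), 0 ≤ k → k < M.n j → M.h j k ≤ κ * H

/-- Two faces orthogonal to different directions `i`, `j` that have the same extent in the other
directions have areas in the ratio of one edge length in direction `j` to one in direction `i`. -/
lemma h_le_of_regularity_le (hab : ∀ i, a i < b i) {η : ℝ} (hη : M.regularity ≤ η)
    {i j : Fin d} (hij : i ≠ j) {k l : ℤ} (hk0 : 0 ≤ k) (hk : k < M.n j) (hl0 : 0 ≤ l)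
    (hl : l < M.n i) : M.h j k ≤ η * M.h i l := by
  have hn := M.n_pos hab
  have hbdd : BddAbove {r : ℝ | ∃ i j : Fin d, i ≠ j ∧ ∃ σ ∈ M.faces i, ∃ σ' ∈ M.faces j,
      r = M.faceArea i σ / M.faceArea j σ'} := by
    refine Set.Finite.bddAbove ?_
    have : {r : ℝ | ∃ i j : Fin d, i ≠ j ∧ ∃ σ ∈ M.faces i, ∃ σ' ∈ M.faces j,
        r = M.faceArea i σ / M.faceArea j σ'} ⊆
        ⋃ i : Fin d, ⋃ j : Fin d, ((M.faces i ×ˢ M.faces j : Finset _).image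
          fun p => M.faceArea i p.1 / M.faceArea j p.2 : Finset ℝ) := by
      rintro r ⟨i, j, -, σ, hσ, σ', hσ', rfl⟩
      refine Set.mem_iUnion.2 ⟨i, Set.mem_iUnion.2 ⟨j, ?_⟩⟩
      exact Finset.mem_coe.2 (Finset.mem_image.2 ⟨(σ, σ'), Finset.mem_product.2 ⟨hσ, hσ'⟩, rfl⟩)
    exact (Set.finite_iUnion fun i => Set.finite_iUnion fun j => Finset.finite_toSet _).subset this
  have hmem := le_csSup hbdd ⟨i, j, hij, fun m => if m = j then k else 0, ?_,
    fun m => if m = i then l else 0, ?_, rfl⟩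
  · have hprod : ∀ m : Fin d, 0 < M.h m 0 := fun m => M.h_pos le_rfl (by exact_mod_cast hn m)
    have e1 : M.faceArea i (fun m => if m = j then k else 0)
        = M.h j k * ∏ m ∈ (Finset.univ.erase i).erase j, M.h m 0 := by
      rw [faceArea, ← Finset.mul_prod_erase _ _ (Finset.mem_erase.2 ⟨hij.symm, Finset.mem_univ j⟩),
        if_pos rfl]
      congr 1
      exact Finset.prod_congr rfl fun m hm => by rw [if_neg (Finset.ne_of_mem_erase hm)]
    have e2 : M.faceArea j (fun m => if m = i then l else 0)
        = M.h i l * ∏ m ∈ (Finset.univ.erase i).erase j, M.h m 0 := by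
      rw [Finset.erase_right_comm, faceArea,
        ← Finset.mul_prod_erase _ _ (Finset.mem_erase.2 ⟨hij, Finset.mem_univ i⟩), if_pos rfl]
      congr 1
      exact Finset.prod_congr rfl fun m hm => by rw [if_neg (Finset.ne_of_mem_erase hm)]
    have hp : 0 < ∏ m ∈ (Finset.univ.erase i).erase j, M.h m 0 :=
      Finset.prod_pos fun m _ => hprod m
    rw [e1, e2, mul_div_mul_right _ _ hp.ne'] at hmem
    exact (div_le_iff₀ (M.h_pos hl0 hl)).1 (hmem.trans hη)
  · refine Fintype.mem_piFinset.2 fun m => ?_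
    have := hn m
    by_cases h1 : m = i
    · simp [h1, hij]
    · by_cases h2 : m = j
      · subst h2; simp [h1, hk0, hk]
      · simp [h1, h2, this]
  · refine Fintype.mem_piFinset.2 fun m => ?_
    have := hn m
    by_cases h1 : m = j
    · simp [h1, hij.symm]
    · by_cases h2 : m = i
      · subst h2; simp [h1, hl0, hl]
      · simp [h1, h2, this]

/-- The square of the regularity appears because two edges in the same direction are compared
through an edge in another direction. -/
lemma exists_quasiUniform (hd : 2 ≤ d) (hab : ∀ i, a i < b i) {η : ℝ} (hη : M.regularity ≤ η) :
    ∃ H, M.QuasiUniform (max η 1 ^ 2) H := by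
  have h1 : (1 : ℝ) ≤ max η 1 := le_max_right _ _
  have hn := M.n_pos hab
  have hstep : ∀ {i j : Fin d}, i ≠ j → ∀ {k l : ℤ}, 0 ≤ k → k < M.n j → 0 ≤ l → l < M.n i →
      M.h j k ≤ max η 1 * M.h i l := fun hij k l hk0 hk hl0 hl =>
    (h_le_of_regularity_le hab hη hij hk0 hk hl0 hl).trans
      (mul_le_mul_of_nonneg_right (le_max_left _ _) (M.h_pos hl0 hl).le)
  have hall : ∀ (i j : Fin d) {k l : ℤ}, 0 ≤ k → k < M.n j → 0 ≤ l → l < M.n i →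
      M.h j k ≤ max η 1 ^ 2 * M.h i l := by
    intro i j k l hk0 hk hl0 hl
    by_cases hij : i = j
    · -- pass through an edge in another direction
      obtain ⟨m, hm⟩ : ∃ m : Fin d, m ≠ j := by
        have : Nontrivial (Fin d) := Fin.nontrivial_iff_two_le.2 hd
        exact exists_ne j
      have hm0 : (0 : ℤ) < M.n m := by exact_mod_cast hn m
      calc M.h j k ≤ max η 1 * M.h m 0 := hstep hm hk0 hk le_rfl hm0
        _ ≤ max η 1 * (max η 1 * M.h i l) := by
            gcongr; exact hstep (hij ▸ hm.symm) le_rfl hm0 hl0 hl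
        _ = _ := by ring
    · refine (hstep hij hk0 hk hl0 hl).trans ?_
      have := M.h_pos hl0 hl
      gcongr
      exact le_self_pow₀ h1 two_ne_zero
  have i₀ : Fin d := ⟨0, by omega⟩
  have hi₀ : (0 : ℤ) < M.n i₀ := by exact_mod_cast hn i₀
  exact ⟨M.h i₀ 0, one_le_pow₀ h1, M.h_pos le_rfl hi₀, fun j k hk0 hk => hall j i₀ le_rfl hi₀ hk0 hk,
    fun j k hk0 hk => hall i₀ j hk0 hk le_rfl hi₀⟩

/-! ### Index sets and weights -/

lemma mem_cells {K : Fin d → ℤ} : K ∈ M.cells ↔ ∀ j, 0 ≤ K j ∧ K j < M.n j := by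
  simp [cells]

lemma mem_intFaces {i : Fin d} {σ : Fin d → ℤ} :
    σ ∈ M.intFaces i ↔ 0 < σ i ∧ ∀ j, 0 ≤ σ j ∧ σ j < M.n j := by
  simp only [intFaces, Fintype.mem_piFinset]
  constructor
  · intro h
    have hi := h i
    simp only [if_true, Finset.mem_Ioo] at hi
    refine ⟨hi.1, fun j => ?_⟩
    have hj := h j
    by_cases hji : j = i
    · subst hji; exact ⟨hi.1.le, hi.2⟩
    · simpa [hji] using hj
  · rintro ⟨h0, h⟩ j
    by_cases hji : j = i
    · subst hji; simpa [h0] using (h j).2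
    · simpa [hji] using h j

@[simp] lemma add_unitIdx_same (σ : Fin d → ℤ) (j : Fin d) : (σ + unitIdx j) j = σ j + 1 := by
  simp [unitIdx]

@[simp] lemma sub_unitIdx_same (σ : Fin d → ℤ) (j : Fin d) : (σ - unitIdx j) j = σ j - 1 := by
  simp [unitIdx]

lemma sub_unitIdx_of_ne (σ : Fin d → ℤ) {j k : Fin d} (h : k ≠ j) :
    (σ - unitIdx j) k = σ k := by
  simp [unitIdx, h]

lemma mem_dualFaces_self {i : Fin d} {σ : Fin d → ℤ} :
    σ ∈ M.dualFaces i i ↔ ∀ k, 0 ≤ σ k ∧ σ k < M.n k := by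
  simp only [dualFaces, Fintype.mem_piFinset]
  refine forall_congr' fun k => ?_
  by_cases h : k = i <;> simp [h]

lemma mem_dualFaces_of_ne {i j : Fin d} (hij : j ≠ i) {σ : Fin d → ℤ} :
    σ ∈ M.dualFaces i j ↔ 0 < σ i ∧ -1 ≤ σ j ∧ σ j < M.n j ∧
      ∀ k, k ≠ j → 0 ≤ σ k ∧ σ k < M.n k := by
  simp only [dualFaces, Fintype.mem_piFinset, if_neg hij]
  constructor
  · intro h
    have hi := h i
    have hj := h j
    simp only [if_true, Finset.mem_Ioo, if_neg hij, Finset.mem_Ico] at hi hj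
    refine ⟨hi.1, hj.1, hj.2, fun k hk => ?_⟩
    have h' := h k
    by_cases hki : k = i
    · subst hki; exact ⟨hi.1.le, hi.2⟩
    · simpa [hki, hk] using h'
  · rintro ⟨h0, h1, h2, h⟩ k
    by_cases hki : k = i
    · subst hki; simpa [h0] using (h k hij.symm).2
    · by_cases hkj : k = j
      · subst hkj; simp [hki, h1, h2]
      · simpa [hki, hkj] using h k hkj

lemma intFaces_subset_cells (i : Fin d) : M.intFaces i ⊆ M.cells := fun _ h =>
  mem_cells.2 (mem_intFaces.1 h).2

lemma sub_unitIdx_mem_cells {i : Fin d} {σ : Fin d → ℤ} (h : σ ∈ M.intFaces i) :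
    σ - unitIdx i ∈ M.cells := by
  rw [mem_intFaces] at h
  refine mem_cells.2 fun j => ?_
  have := h.2 j
  by_cases hj : j = i
  · subst hj; rw [sub_unitIdx_same]; omega
  · rwa [sub_unitIdx_of_ne _ hj]

lemma mem_dualFaces_of_mem_intFaces {i : Fin d} (j : Fin d) {σ : Fin d → ℤ}
    (h : σ ∈ M.intFaces i) : σ ∈ M.dualFaces i j := by
  rw [mem_intFaces] at h
  by_cases hj : j = i
  · subst hj; exact mem_dualFaces_self.2 h.2
  · have := h.2 j
    exact (mem_dualFaces_of_ne hj).2 ⟨h.1, by omega, this.2, fun k _ => h.2 k⟩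

lemma sub_unitIdx_mem_dualFaces {i : Fin d} (j : Fin d) {σ : Fin d → ℤ}
    (h : σ ∈ M.intFaces i) : σ - unitIdx j ∈ M.dualFaces i j := by
  by_cases hj : j = i
  · subst hj; exact mem_dualFaces_self.2 (mem_cells.1 (sub_unitIdx_mem_cells h))
  · rw [mem_intFaces] at h
    have := h.2 j
    refine (mem_dualFaces_of_ne hj).2 ⟨?_, ?_, ?_, fun k hk => ?_⟩
    · rw [sub_unitIdx_of_ne _ (Ne.symm hj)]; exact h.1
    · rw [sub_unitIdx_same]; omega
    · rw [sub_unitIdx_same]; omega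
    · rw [sub_unitIdx_of_ne _ hk]; exact h.2 k

namespace QuasiUniform

variable {κ H : ℝ}

lemma kappa_pos (hM : M.QuasiUniform κ H) : 0 < κ := zero_lt_one.trans_le hM.one_le

lemma dualWidth_bounds (hM : M.QuasiUniform κ H) {i k : Fin d} {σ : Fin d → ℤ}
    (h0 : 0 ≤ σ k) (h1 : σ k < M.n k) (hi : k = i → 0 < σ i) :
    0 < M.dualWidth i σ k ∧ H ≤ κ * M.dualWidth i σ k ∧ M.dualWidth i σ k ≤ κ * H := by
  by_cases hk : k = i
  · subst hk
    have h2 := hi rfl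
    simp only [dualWidth, if_true]
    have e1 := M.h_pos h0 h1
    have e2 := M.h_pos (j := k) (k := σ k - 1) (by omega) (by omega)
    have e3 := hM.le_h k _ h0 h1
    have e4 := hM.le_h k (σ k - 1) (by omega) (by omega)
    have e5 := hM.h_le k _ h0 h1
    have e6 := hM.h_le k (σ k - 1) (by omega) (by omega)
    exact ⟨by linarith, by linarith, by linarith⟩
  · simp only [dualWidth, if_neg hk]
    exact ⟨M.h_pos h0 h1, hM.le_h k _ h0 h1, hM.h_le k _ h0 h1⟩

lemma dualFace_dualWidth_bounds (hM : M.QuasiUniform κ H) {i j k : Fin d} (hk : k ≠ j)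
    {σ : Fin d → ℤ} (h : σ ∈ M.dualFaces i j) :
    0 < M.dualWidth i σ k ∧ H ≤ κ * M.dualWidth i σ k ∧ M.dualWidth i σ k ≤ κ * H := by
  by_cases hij : j = i
  · subst hij
    rw [mem_dualFaces_self] at h
    exact hM.dualWidth_bounds (h k).1 (h k).2 fun h' => absurd h' hk
  · rw [mem_dualFaces_of_ne hij] at h
    obtain ⟨h0, -, -, h⟩ := h
    exact hM.dualWidth_bounds (h k hk).1 (h k hk).2 fun _ => h0

lemma dualFaceArea_bounds (hM : M.QuasiUniform κ H) {i j : Fin d} {σ : Fin d → ℤ}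
    (h : σ ∈ M.dualFaces i j) :
    0 < M.dualFaceArea i j σ ∧ H ^ (d - 1) ≤ κ ^ (d - 1) * M.dualFaceArea i j σ := by
  constructor
  · exact Finset.prod_pos fun k hk =>
      (hM.dualFace_dualWidth_bounds (Finset.ne_of_mem_erase hk) h).1
  · have hc : (Finset.univ.erase j).card = d - 1 := by
      rw [Finset.card_erase_of_mem (Finset.mem_univ j), Finset.card_univ, Fintype.card_fin]
    rw [dualFaceArea, ← hc, ← Finset.prod_const, ← Finset.prod_const, ← Finset.prod_mul_distrib]
    exact Finset.prod_le_prod (fun _ _ => hM.pos.le) fun k hk =>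
      (hM.dualFace_dualWidth_bounds (Finset.ne_of_mem_erase hk) h).2.1

lemma dualDist_bounds (hM : M.QuasiUniform κ H) (hab : ∀ i, a i < b i) {i j : Fin d}
    {σ : Fin d → ℤ} (h : σ ∈ M.dualFaces i j) :
    0 < M.dualDist i j σ ∧ M.dualDist i j σ ≤ κ * H := by
  have hn : (0 : ℤ) < M.n j := by exact_mod_cast M.n_pos hab j
  have hκH : 0 < κ * H := mul_pos hM.kappa_pos hM.pos
  by_cases hij : j = i
  · subst hij
    rw [mem_dualFaces_self] at h
    simp only [dualDist, if_true]
    exact ⟨M.h_pos (h j).1 (h j).2, hM.h_le j _ (h j).1 (h j).2⟩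
  · rw [mem_dualFaces_of_ne hij] at h
    obtain ⟨-, h1, h2, -⟩ := h
    simp only [dualDist, if_neg hij]
    -- a dual face on the boundary is at half a cell from the center of its only neighbour
    by_cases hlo : σ j < 0
    · have e : σ j = -1 := by omega
      have e1 : M.center j (σ j) = a j := by simp [center, hlo]
      have e2 : M.center j (σ j + 1) = M.mid j 0 := by
        rw [e, center, if_neg (by norm_num), if_neg (by omega)]; rfl
      have e3 := M.h_pos (j := j) le_rfl hn
      have e4 := hM.h_le j 0 le_rfl hn
      have e5 := M.x_first j
      rw [e1, e2]
      simp only [mid, MACGrid.h, zero_add, e5] at e3 e4 ⊢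
      exact ⟨by linarith, by linarith⟩
    · have e1 : M.center j (σ j) = M.mid j (σ j) := by simp [center, hlo, h2]
      have e3 := M.h_pos (j := j) (not_lt.1 hlo) h2
      have e4 := hM.h_le j _ (not_lt.1 hlo) h2
      rw [e1]
      by_cases hhi : (M.n j : ℤ) ≤ σ j + 1
      · have e : σ j + 1 = M.n j := by omega
        have e2 : M.center j (σ j + 1) = b j := by
          rw [e, center, if_neg (by omega), if_pos le_rfl]
        have e5 := M.x_last j
        rw [← e] at e5
        rw [e2]
        simp only [mid, MACGrid.h, e5] at e3 e4 ⊢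
        exact ⟨by linarith, by linarith⟩
      · have e2 : M.center j (σ j + 1) = M.mid j (σ j + 1) := by
          rw [center, if_neg (by omega), if_neg hhi]
        have e5 := M.h_pos (j := j) (k := σ j + 1) (by omega) (by omega)
        have e6 := hM.h_le j (σ j + 1) (by omega) (by omega)
        rw [e2]
        simp only [mid, MACGrid.h] at e3 e4 e5 e6 ⊢
        exact ⟨by linarith, by linarith⟩

lemma dualWeight_pos (hM : M.QuasiUniform κ H) (hab : ∀ i, a i < b i) {i j : Fin d}
    {σ : Fin d → ℤ} (h : σ ∈ M.dualFaces i j) :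
    0 < M.dualFaceArea i j σ / M.dualDist i j σ :=
  div_pos (hM.dualFaceArea_bounds h).1 (hM.dualDist_bounds hab h).1

/-- The weights in the discrete `H¹₀` norm are at least of the order `H ^ (d - 2)`. -/
lemma le_dualWeight (hM : M.QuasiUniform κ H) (hd : 2 ≤ d) (hab : ∀ i, a i < b i) {i j : Fin d}
    {σ : Fin d → ℤ} (h : σ ∈ M.dualFaces i j) :
    H ^ (d - 2) ≤ κ ^ d * (M.dualFaceArea i j σ / M.dualDist i j σ) := by
  have h1 := hM.dualFaceArea_bounds h
  have h2 := hM.dualDist_bounds hab h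
  have hκ := hM.kappa_pos
  have hH := hM.pos
  rw [← mul_div_assoc, le_div_iff₀ h2.1]
  calc H ^ (d - 2) * M.dualDist i j σ ≤ H ^ (d - 2) * (κ * H) := by gcongr; exact h2.2
    _ = κ * H ^ (d - 1) := by
        obtain ⟨m, rfl⟩ := Nat.exists_eq_add_of_le hd
        simp only [show 2 + m - 2 = m by omega, show 2 + m - 1 = m + 1 by omega]; ring
    _ ≤ κ * (κ ^ (d - 1) * M.dualFaceArea i j σ) := by gcongr; exact h1.2
    _ = κ ^ d * M.dualFaceArea i j σ := by
        obtain ⟨m, rfl⟩ := Nat.exists_eq_add_of_le hd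
        simp only [show 2 + m - 1 = m + 1 by omega]; ring

lemma dualVol_bounds (hM : M.QuasiUniform κ H) {i : Fin d} {σ : Fin d → ℤ}
    (h : σ ∈ M.intFaces i) : 0 < M.dualVol i σ ∧ M.dualVol i σ ≤ κ ^ d * H ^ d := by
  rw [mem_intFaces] at h
  have hb : ∀ k, _ := fun k => hM.dualWidth_bounds (h.2 k).1 (h.2 k).2 (i := i) fun _ => h.1
  refine ⟨Finset.prod_pos fun k _ => (hb k).1, ?_⟩
  rw [← mul_pow, dualVol]
  refine (Finset.prod_le_prod (fun k _ => (hb k).1.le) fun k _ => (hb k).2.2).trans ?_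
  simp

lemma faceArea_bounds (hM : M.QuasiUniform κ H) {i : Fin d} {σ : Fin d → ℤ}
    (h : σ ∈ M.cells) : 0 < M.faceArea i σ ∧ M.faceArea i σ ≤ (κ * H) ^ (d - 1) := by
  rw [mem_cells] at h
  refine ⟨Finset.prod_pos fun k _ => M.h_pos (h k).1 (h k).2, ?_⟩
  have hc : (Finset.univ.erase i).card = d - 1 := by
    rw [Finset.card_erase_of_mem (Finset.mem_univ i), Finset.card_univ, Fintype.card_fin]
  rw [faceArea, ← hc, ← Finset.prod_const]
  exact Finset.prod_le_prod (fun k _ => (M.h_pos (h k).1 (h k).2).le) fun k _ =>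
    hM.h_le k _ (h k).1 (h k).2

lemma n_add_one_mul_le (hM : M.QuasiUniform κ H) (hab : ∀ i, a i < b i) (j : Fin d) :
    ((M.n j : ℝ) + 1) * H ≤ 2 * κ * (b j - a j) := by
  have hn : (1 : ℝ) ≤ M.n j := by exact_mod_cast M.n_pos hab j
  have h1 : (M.n j : ℝ) * H ≤ κ * (b j - a j) := by
    rw [← M.sum_h j, Finset.mul_sum]
    have := Finset.card_nsmul_le_sum (Finset.Ico (0 : ℤ) (M.n j)) (fun k => κ * M.h j k) H
      fun k hk => by
        rw [Finset.mem_Ico] at hk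
        exact hM.le_h j k hk.1 hk.2
    simpa using this
  nlinarith [hM.pos]

end QuasiUniform

/-! ### The discrete norms -/

/-- The discrete `H¹₀` norm. -/
def h1Norm (M : MACGrid d a b) (v : Fin d → (Fin d → ℤ) → ℝ) : ℝ := √(M.h1NormSq v)

/-- Square of the `L²` norm of the piecewise constant function with value `v i σ` on `D_σ`. -/
def l2NormSq (M : MACGrid d a b) (v : Fin d → (Fin d → ℤ) → ℝ) : ℝ :=
  ∑ i, ∑ σ ∈ M.intFaces i, M.dualVol i σ * v i σ ^ 2

lemma h1Norm_nonneg (v : Fin d → (Fin d → ℤ) → ℝ) : 0 ≤ M.h1Norm v := Real.sqrt_nonneg _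

lemma sub_mem_velSpace {u v : Fin d → (Fin d → ℤ) → ℝ} (hu : u ∈ M.velSpace)
    (hv : v ∈ M.velSpace) : u - v ∈ M.velSpace := fun i σ h => by
  simp [hu i σ h, hv i σ h]

lemma sub_eq_zero_of_notMem_dualFaces {w : Fin d → (Fin d → ℤ) → ℝ} (hw : w ∈ M.velSpace)
    {i j : Fin d} {σ : Fin d → ℤ} (h : σ ∉ M.dualFaces i j) :
    w i (σ + unitIdx j) - w i σ = 0 := by
  rw [hw i σ fun h' => h (mem_dualFaces_of_mem_intFaces j h'),
    hw i (σ + unitIdx j) fun h' => h (by simpa using sub_unitIdx_mem_dualFaces j h'), sub_zero]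

/-- Summation by parts over the interior faces: the sum of a discrete divergence on the dual mesh
against a function vanishing at the boundary. -/
lemma sum_intFaces_sub_mul (i : Fin d) (G : Fin d → (Fin d → ℤ) → ℝ) {z : (Fin d → ℤ) → ℝ}
    (hz : ∀ σ, σ ∉ M.intFaces i → z σ = 0) :
    ∑ σ ∈ M.intFaces i, (∑ j, (G j σ - G j (σ - unitIdx j))) * z σ
      = ∑ j, ∑ σ ∈ M.dualFaces i j, G j σ * (z σ - z (σ + unitIdx j)) := by
  simp only [Finset.sum_mul]
  rw [Finset.sum_comm]
  exact Finset.sum_congr rfl fun j _ => sum_sub_comp_sub_mul (unitIdx j)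
    (fun σ h => mem_dualFaces_of_mem_intFaces j h) (fun σ h => sub_unitIdx_mem_dualFaces j h) _ _ hz

namespace QuasiUniform

variable {κ H : ℝ}

lemma edge_bound_nonneg (hM : M.QuasiUniform κ H) (hd : 2 ≤ d) (hab : ∀ i, a i < b i) {L : ℝ}
    (hL : ∀ j, 2 * κ * (b j - a j) ≤ L) : 0 ≤ L := by
  have i₀ : Fin d := ⟨0, by omega⟩
  exact le_trans (mul_nonneg (mul_nonneg zero_le_two hM.kappa_pos.le) (sub_pos.2 (hab i₀)).le)
    (hL i₀)

lemma h1NormSq_term_nonneg (hM : M.QuasiUniform κ H) (hab : ∀ i, a i < b i)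
    (v : Fin d → (Fin d → ℤ) → ℝ) {i j : Fin d} {σ : Fin d → ℤ} (h : σ ∈ M.dualFaces i j) :
    0 ≤ M.dualFaceArea i j σ / M.dualDist i j σ * (v i σ - v i (σ + unitIdx j)) ^ 2 :=
  mul_nonneg (hM.dualWeight_pos hab h).le (sq_nonneg _)

lemma h1NormSq_nonneg (hM : M.QuasiUniform κ H) (hab : ∀ i, a i < b i)
    (v : Fin d → (Fin d → ℤ) → ℝ) : 0 ≤ M.h1NormSq v :=
  Finset.sum_nonneg fun _ _ => Finset.sum_nonneg fun _ _ => Finset.sum_nonneg fun _ h =>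
    hM.h1NormSq_term_nonneg hab v h

lemma sq_h1Norm (hM : M.QuasiUniform κ H) (hab : ∀ i, a i < b i)
    (v : Fin d → (Fin d → ℤ) → ℝ) : M.h1Norm v ^ 2 = M.h1NormSq v :=
  Real.sq_sqrt (hM.h1NormSq_nonneg hab v)

lemma h1Norm_sub_le (hM : M.QuasiUniform κ H) (hab : ∀ i, a i < b i)
    (u v : Fin d → (Fin d → ℤ) → ℝ) : M.h1Norm (u - v) ≤ 2 * (M.h1Norm u + M.h1Norm v) := by
  have h : M.h1NormSq (u - v) ≤ 2 * M.h1NormSq u + 2 * M.h1NormSq v := by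
    simp only [h1NormSq, Finset.mul_sum, ← Finset.sum_add_distrib]
    refine Finset.sum_le_sum fun i _ => Finset.sum_le_sum fun j _ => Finset.sum_le_sum
      fun σ hσ => ?_
    have hw := hM.dualWeight_pos hab hσ
    simp only [Pi.sub_apply]
    generalize u i σ = x, u i (σ + unitIdx j) = x', v i σ = y, v i (σ + unitIdx j) = y'
    nlinarith [mul_nonneg hw.le (sq_nonneg (x - x' + (y - y')))]
  refine le_of_sq_le_sq ?_ (by positivity [M.h1Norm_nonneg u, M.h1Norm_nonneg v])
  rw [hM.sq_h1Norm hab]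
  have hu := hM.sq_h1Norm hab u
  have hv := hM.sq_h1Norm hab v
  nlinarith [mul_nonneg (M.h1Norm_nonneg u) (M.h1Norm_nonneg v), hM.h1NormSq_nonneg hab u,
    hM.h1NormSq_nonneg hab v]

/-- The lattice energy of one component is controlled by the discrete `H¹₀` norm. -/
lemma sum_sub_sq_le (hM : M.QuasiUniform κ H) (hd : 2 ≤ d) (hab : ∀ i, a i < b i)
    (v : Fin d → (Fin d → ℤ) → ℝ) (i : Fin d) :
    H ^ (d - 2) * ∑ j, ∑ σ ∈ M.dualFaces i j, (v i σ - v i (σ + unitIdx j)) ^ 2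
      ≤ κ ^ d * M.h1NormSq v := by
  calc _ ≤ κ ^ d * ∑ j, ∑ σ ∈ M.dualFaces i j,
        M.dualFaceArea i j σ / M.dualDist i j σ * (v i σ - v i (σ + unitIdx j)) ^ 2 := by
        simp only [Finset.mul_sum]
        refine Finset.sum_le_sum fun j _ => Finset.sum_le_sum fun σ hσ => ?_
        rw [← mul_assoc]
        exact mul_le_mul_of_nonneg_right (hM.le_dualWeight hd hab hσ) (sq_nonneg _)
    _ ≤ _ := by
        have := hM.kappa_pos
        gcongr
        exact Finset.single_le_sum (f := fun i => ∑ j, ∑ σ ∈ M.dualFaces i j,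
          M.dualFaceArea i j σ / M.dualDist i j σ * (v i σ - v i (σ + unitIdx j)) ^ 2)
          (fun i _ => Finset.sum_nonneg fun _ _ => Finset.sum_nonneg fun _ h =>
            hM.h1NormSq_term_nonneg hab v h) (Finset.mem_univ i)

lemma sum_dualFaces_sub_sq_le (hM : M.QuasiUniform κ H) (hd : 2 ≤ d) (hab : ∀ i, a i < b i)
    (v : Fin d → (Fin d → ℤ) → ℝ) (i j : Fin d) :
    H ^ (d - 2) * ∑ σ ∈ M.dualFaces i j, (v i σ - v i (σ + unitIdx j)) ^ 2
      ≤ κ ^ d * M.h1NormSq v := by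
  refine le_trans ?_ (hM.sum_sub_sq_le hd hab v i)
  have := hM.pos
  gcongr
  exact Finset.single_le_sum (f := fun j => ∑ σ ∈ M.dualFaces i j,
    (v i σ - v i (σ + unitIdx j)) ^ 2)
    (fun _ _ => Finset.sum_nonneg fun _ _ => sq_nonneg _) (Finset.mem_univ j)

/-- The discrete Poincaré and Sobolev inequalities for each component of a discrete velocity. -/
lemma poincare_sobolev (hM : M.QuasiUniform κ H) (hd : d = 2 ∨ d = 3) (hab : ∀ i, a i < b i)
    {L : ℝ} (hL : ∀ j, 2 * κ * (b j - a j) ≤ L) {w : Fin d → (Fin d → ℤ) → ℝ}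
    (hw : w ∈ M.velSpace) (i : Fin d) :
    H ^ d * ∑ σ ∈ M.intFaces i, w i σ ^ 2 ≤ L ^ 2 * (κ ^ d * M.h1NormSq w) ∧
      H ^ d * ∑ σ ∈ M.intFaces i, w i σ ^ 4
        ≤ (2 * L ^ 2 + 4 * L) * (κ ^ d * M.h1NormSq w) ^ 2 := by
  have hd2 : 2 ≤ d := by omega
  have hH := hM.pos
  have hL0 := hM.edge_bound_nonneg hd2 hab hL
  have hw0 : ∀ σ, σ ∉ Fintype.piFinset (fun j => Finset.Ico (0 : ℤ) (M.n j)) → w i σ = 0 :=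
    fun σ h => hw i σ fun h' => h (intFaces_subset_cells i h')
  obtain ⟨h2, h4⟩ := lattice_poincare_sobolev hd hw0 hH
    fun j => (hM.n_add_one_mul_le hab j).trans (hL j)
  have hsub : M.intFaces i ⊆ Fintype.piFinset (fun j => Finset.Ico (-1 : ℤ) (M.n j)) :=
    fun σ h => Fintype.mem_piFinset.2 fun j => by
      have := (mem_intFaces.1 h).2 j
      exact Finset.mem_Ico.2 ⟨by omega, this.2⟩
  have hD0 : 0 ≤ H ^ (d - 2) * ∑ j, ∑ σ ∈ Fintype.piFinset
      (fun j => Finset.Ico (-1 : ℤ) (M.n j)), (w i (σ + unitIdx j) - w i σ) ^ 2 :=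
    mul_nonneg (by positivity) (Finset.sum_nonneg fun _ _ => Finset.sum_nonneg fun _ _ =>
      sq_nonneg _)
  have hD : H ^ (d - 2) * ∑ j, ∑ σ ∈ Fintype.piFinset (fun j => Finset.Ico (-1 : ℤ) (M.n j)),
      (w i (σ + unitIdx j) - w i σ) ^ 2 ≤ κ ^ d * M.h1NormSq w := by
    refine le_trans ?_ (hM.sum_sub_sq_le hd2 hab w i)
    gcongr with j _
    simp only [sub_sq_comm (w i _) (w i (_ + _))]
    exact sum_le_sum_of_vanish (fun _ => sq_nonneg _) fun σ h => by
      rw [sub_eq_zero_of_notMem_dualFaces hw h]; norm_num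
  constructor
  · refine le_trans (le_trans ?_ h2) (by gcongr)
    exact mul_le_mul_of_nonneg_left (Finset.sum_le_sum_of_subset_of_nonneg hsub
      fun _ _ _ => sq_nonneg _) (by positivity)
  · refine le_trans (le_trans ?_ h4) (by gcongr)
    exact mul_le_mul_of_nonneg_left (Finset.sum_le_sum_of_subset_of_nonneg hsub
      fun _ _ _ => by positivity) (by positivity)

/-- The discrete Poincaré inequality. -/
lemma l2NormSq_le (hM : M.QuasiUniform κ H) (hd : d = 2 ∨ d = 3) (hab : ∀ i, a i < b i)
    {L : ℝ} (hL : ∀ j, 2 * κ * (b j - a j) ≤ L) {w : Fin d → (Fin d → ℤ) → ℝ}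
    (hw : w ∈ M.velSpace) :
    M.l2NormSq w ≤ d * κ ^ (2 * d) * L ^ 2 * M.h1NormSq w := by
  have hκ := hM.kappa_pos
  have : ∀ i ∈ Finset.univ, ∑ σ ∈ M.intFaces i, M.dualVol i σ * w i σ ^ 2
      ≤ κ ^ (2 * d) * L ^ 2 * M.h1NormSq w := fun i _ => by
    calc _ ≤ ∑ σ ∈ M.intFaces i, κ ^ d * H ^ d * w i σ ^ 2 :=
          Finset.sum_le_sum fun σ h =>
            mul_le_mul_of_nonneg_right (hM.dualVol_bounds h).2 (sq_nonneg _)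
      _ = κ ^ d * (H ^ d * ∑ σ ∈ M.intFaces i, w i σ ^ 2) := by
          rw [← Finset.mul_sum]; ring
      _ ≤ κ ^ d * (L ^ 2 * (κ ^ d * M.h1NormSq w)) := by
          exact mul_le_mul_of_nonneg_left (hM.poincare_sobolev hd hab hL hw i).1 (by positivity)
      _ = _ := by ring
  refine (Finset.sum_le_card_nsmul _ _ _ this).trans (le_of_eq ?_)
  rw [Finset.card_univ, Fintype.card_fin, nsmul_eq_mul]; ring

/-! ### Estimate of the mass fluxes -/

lemma abs_massFlux_le (hM : M.QuasiUniform κ H) {q : (Fin d → ℤ) → ℝ} {R : ℝ}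
    (hq : ∀ K ∈ M.cells, |q K| ≤ R) {v : Fin d → (Fin d → ℤ) → ℝ} (hv : v ∈ M.velSpace)
    (j : Fin d) (τ : Fin d → ℤ) :
    |M.massFlux q v j τ| ≤ R * (κ * H) ^ (d - 1) * |v j τ| := by
  by_cases h : τ ∈ M.intFaces j
  · have hA := hM.faceArea_bounds (i := j) (intFaces_subset_cells j h)
    rw [massFlux, abs_mul, abs_mul, abs_of_pos hA.1, mul_comm R]
    refine mul_le_mul_of_nonneg_right (mul_le_mul hA.2 ?_ (abs_nonneg _) (hA.1.le.trans hA.2))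
      (abs_nonneg _)
    split_ifs
    exacts [hq _ (sub_unitIdx_mem_cells h), hq _ (intFaces_subset_cells j h)]
  · simp [massFlux, hv j τ h]

/-- A dual flux is the mean of two mass fluxes, through faces at fixed offsets. -/
lemma exists_abs_dualFlux_le (hM : M.QuasiUniform κ H) {q : (Fin d → ℤ) → ℝ} {R : ℝ}
    (hq : ∀ K ∈ M.cells, |q K| ≤ R) {v : Fin d → (Fin d → ℤ) → ℝ}
    (hv : v ∈ M.velSpace) (i j : Fin d) :
    ∃ s t : Fin d → ℤ, ∀ σ, |M.dualFlux q v i j σ|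
      ≤ R * (κ * H) ^ (d - 1) * ((|v j (σ + s)| + |v j (σ + t)|) / 2) := by
  have key : ∀ τ τ', |(M.massFlux q v j τ + M.massFlux q v j τ') / 2|
      ≤ R * (κ * H) ^ (d - 1) * ((|v j τ| + |v j τ'|) / 2) := fun τ τ' => by
    have h1 := hM.abs_massFlux_le hq hv j τ
    have h2 := hM.abs_massFlux_le hq hv j τ'
    have h3 := abs_add_le (M.massFlux q v j τ) (M.massFlux q v j τ')
    rw [abs_div, abs_two]
    linarith
  by_cases hij : j = i
  · subst hij
    exact ⟨0, unitIdx j, fun σ => by simpa [dualFlux] using key σ (σ + unitIdx j)⟩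
  · exact ⟨-unitIdx i + unitIdx j, unitIdx j, fun σ => by
      simpa [dualFlux, hij, sub_eq_add_neg, add_assoc] using
        key (σ - unitIdx i + unitIdx j) (σ + unitIdx j)⟩

end QuasiUniform

/-- The constant in the trilinear estimate of the mass fluxes, `L` being a bound on the edges of the
domain. For each of the `d ^ 2` pairs of directions, Hölder's inequality bounds the fourth power of
the sum with a constant `B`; the fourth root of `B` is replaced by the larger `1 + B`. -/
def fluxConst (d : ℕ) (κ L : ℝ) : ℝ :=
  d ^ 2 * (1 + 16 * κ ^ (10 * d) * (2 * L ^ 2 + 4 * L) ^ 2)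

lemma fluxConst_nonneg (d : ℕ) {κ : ℝ} (hκ : 0 < κ) (L : ℝ) : 0 ≤ fluxConst d κ L := by
  unfold fluxConst; positivity

namespace QuasiUniform

variable {κ H : ℝ}

/-- The trilinear estimate for the dual faces orthogonal to `eⱼ` of the `i`-th component. All weights
are compared with powers of `H`, which cancel. -/
lemma sum_abs_dualFlux_mul_le_aux (hM : M.QuasiUniform κ H) (hd : d = 2 ∨ d = 3)
    (hab : ∀ i, a i < b i) {L : ℝ} (hL : ∀ j, 2 * κ * (b j - a j) ≤ L)
    {q : (Fin d → ℤ) → ℝ} {R : ℝ} (hR : 0 ≤ R) (hq : ∀ K ∈ M.cells, |q K| ≤ R)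
    {v w z : Fin d → (Fin d → ℤ) → ℝ} (hv : v ∈ M.velSpace) (hw : w ∈ M.velSpace) (i j : Fin d) :
    ∑ σ ∈ M.dualFaces i j, |M.dualFlux q v i j σ| * (|w i σ| + |w i (σ + unitIdx j)|) *
        |z i σ - z i (σ + unitIdx j)|
      ≤ (1 + 16 * κ ^ (10 * d) * (2 * L ^ 2 + 4 * L) ^ 2) *
        (R * M.h1Norm v * M.h1Norm w * M.h1Norm z) := by
  have hd2 : 2 ≤ d := by omega
  have hH := hM.pos
  have hκ := hM.kappa_pos
  obtain ⟨s, t, hst⟩ := hM.exists_abs_dualFlux_le hq hv i j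
  have hol := sum_mul_mul_pow_four_le (M.dualFaces i j) (fun σ => |M.dualFlux q v i j σ|)
    (fun σ => |w i σ| + |w i (σ + unitIdx j)|) (fun σ => |z i σ - z i (σ + unitIdx j)|)
  have e4 : ∀ x : ℝ, |x| ^ 4 = x ^ 4 := fun x => by rw [pow_abs, abs_of_nonneg (by positivity)]
  have hconv : ∀ x y : ℝ, (x + y) ^ 4 ≤ 8 * (x ^ 4 + y ^ 4) := fun x y => by
    have h1 : (x + y) ^ 2 ≤ 2 * (x ^ 2 + y ^ 2) := by nlinarith [sq_nonneg (x - y)]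
    have h2 := pow_le_pow_left₀ (sq_nonneg _) h1 2
    nlinarith [sq_nonneg (x ^ 2 - y ^ 2)]
  have hshift : ∀ (u : Fin d → (Fin d → ℤ) → ℝ), u ∈ M.velSpace → ∀ (k : Fin d) (r : Fin d → ℤ),
      ∑ σ ∈ M.dualFaces i j, u k (σ + r) ^ 4 ≤ ∑ σ ∈ M.intFaces k, u k σ ^ 4 :=
    fun u hu k r => sum_comp_add_le r (f := fun σ => u k σ ^ 4) (fun σ => by positivity)
      fun σ h => by simp [hu k σ h]
  have hp : ∑ σ ∈ M.dualFaces i j, |M.dualFlux q v i j σ| ^ 4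
      ≤ (R * (κ * H) ^ (d - 1)) ^ 4 * ∑ σ ∈ M.intFaces j, v j σ ^ 4 := by
    calc _ ≤ ∑ σ ∈ M.dualFaces i j, (R * (κ * H) ^ (d - 1)) ^ 4 *
          ((v j (σ + s) ^ 4 + v j (σ + t) ^ 4) / 2) := by
          refine Finset.sum_le_sum fun σ _ => ?_
          refine (pow_le_pow_left₀ (abs_nonneg _) (hst σ) 4).trans ?_
          rw [mul_pow]
          refine mul_le_mul_of_nonneg_left ?_ (by positivity)
          have := hconv |v j (σ + s)| |v j (σ + t)|
          rw [e4, e4] at this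
          rw [div_pow]
          linarith
      _ = (R * (κ * H) ^ (d - 1)) ^ 4 * ((∑ σ ∈ M.dualFaces i j, v j (σ + s) ^ 4 +
            ∑ σ ∈ M.dualFaces i j, v j (σ + t) ^ 4) / 2) := by
          rw [← Finset.sum_add_distrib, Finset.sum_div, Finset.mul_sum]
      _ ≤ _ := by
          refine mul_le_mul_of_nonneg_left ?_ (by positivity)
          linarith [hshift v hv j s, hshift v hv j t]
  have hq4 : ∑ σ ∈ M.dualFaces i j, (|w i σ| + |w i (σ + unitIdx j)|) ^ 4
      ≤ 16 * ∑ σ ∈ M.intFaces i, w i σ ^ 4 := by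
    calc _ ≤ ∑ σ ∈ M.dualFaces i j, 8 * (w i (σ + 0) ^ 4 + w i (σ + unitIdx j) ^ 4) := by
          refine Finset.sum_le_sum fun σ _ => ?_
          have := hconv |w i σ| |w i (σ + unitIdx j)|
          rw [e4, e4] at this
          rwa [add_zero]
      _ ≤ _ := by
          rw [← Finset.mul_sum, Finset.sum_add_distrib]
          linarith [hshift w hw i 0, hshift w hw i (unitIdx j)]
  have hc := hM.sum_dualFaces_sub_sq_le hd2 hab z i j
  have hv4 := (hM.poincare_sobolev hd hab hL hv j).2
  have hw4 := (hM.poincare_sobolev hd hab hL hw i).2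
  simp only [sq_abs] at hol
  have hX0 : 0 ≤ ∑ σ ∈ M.intFaces j, v j σ ^ 4 := Finset.sum_nonneg fun _ _ => by positivity
  have hY0 : 0 ≤ ∑ σ ∈ M.intFaces i, w i σ ^ 4 := Finset.sum_nonneg fun _ _ => by positivity
  have hZ0 : 0 ≤ ∑ σ ∈ M.dualFaces i j, (z i σ - z i (σ + unitIdx j)) ^ 2 :=
    Finset.sum_nonneg fun _ _ => sq_nonneg _
  have hp0 : 0 ≤ ∑ σ ∈ M.dualFaces i j, |M.dualFlux q v i j σ| ^ 4 :=
    Finset.sum_nonneg fun _ _ => by positivity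
  have hq0 : 0 ≤ ∑ σ ∈ M.dualFaces i j, (|w i σ| + |w i (σ + unitIdx j)|) ^ 4 :=
    Finset.sum_nonneg fun _ _ => by positivity
  rw [← hM.sq_h1Norm hab] at hv4 hw4 hc
  have nv := M.h1Norm_nonneg v
  have nw := M.h1Norm_nonneg w
  have nz := M.h1Norm_nonneg z
  generalize ∑ σ ∈ M.dualFaces i j, |M.dualFlux q v i j σ| * (|w i σ| + |w i (σ + unitIdx j)|) *
        |z i σ - z i (σ + unitIdx j)| = A at hol ⊢
  generalize ∑ σ ∈ M.dualFaces i j, |M.dualFlux q v i j σ| ^ 4 = P at *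
  generalize ∑ σ ∈ M.dualFaces i j, (|w i σ| + |w i (σ + unitIdx j)|) ^ 4 = Q at *
  generalize ∑ σ ∈ M.intFaces j, v j σ ^ 4 = X at *
  generalize ∑ σ ∈ M.intFaces i, w i σ ^ 4 = Y at *
  generalize ∑ σ ∈ M.dualFaces i j, (z i σ - z i (σ + unitIdx j)) ^ 2 = Z at *
  generalize M.h1Norm v = α at *
  generalize M.h1Norm w = β at *
  generalize M.h1Norm z = γ at *
  have hL0 := hM.edge_bound_nonneg hd2 hab hL
  have hS0 : 0 ≤ 2 * L ^ 2 + 4 * L := by positivity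
  generalize 2 * L ^ 2 + 4 * L = S at *
  set B := 16 * κ ^ (10 * d) * S ^ 2 with hB
  have hB0 : 0 ≤ B := by positivity
  have hRabc : 0 ≤ R * α * β * γ := by positivity
  refine le_of_pow_le_pow_left₀ (n := 4) (by norm_num) (by positivity) ?_
  have hpow : (H ^ (d - 1)) ^ 4 = H ^ d * H ^ d * (H ^ (d - 2)) ^ 2 := by
    obtain ⟨m, rfl⟩ := Nat.exists_eq_add_of_le hd2
    simp only [show 2 + m - 2 = m by omega, show 2 + m - 1 = m + 1 by omega]; ring
  have hκd : (κ ^ (d - 1)) ^ 4 ≤ κ ^ (4 * d) := by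
    rw [← pow_mul]; exact pow_le_pow_right₀ hM.one_le (by omega)
  calc A ^ 4 ≤ P * Q * Z ^ 2 := hol
    _ ≤ ((R * (κ * H) ^ (d - 1)) ^ 4 * X) * (16 * Y) * Z ^ 2 := by gcongr
    _ = 16 * R ^ 4 * (κ ^ (d - 1)) ^ 4 * ((H ^ (d - 1)) ^ 4 * X * Y * Z ^ 2) := by
        rw [mul_pow κ]; ring
    _ = 16 * R ^ 4 * (κ ^ (d - 1)) ^ 4 *
        ((H ^ d * X) * (H ^ d * Y) * (H ^ (d - 2) * Z) ^ 2) := by rw [hpow]; ring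
    _ ≤ 16 * R ^ 4 * κ ^ (4 * d) * ((S * (κ ^ d * α ^ 2) ^ 2) * (S * (κ ^ d * β ^ 2) ^ 2) *
        (κ ^ d * γ ^ 2) ^ 2) := by gcongr
    _ = B * (R * α * β * γ) ^ 4 := by rw [hB]; ring
    _ ≤ (1 + B) ^ 4 * (R * α * β * γ) ^ 4 := by
        refine mul_le_mul_of_nonneg_right ?_ (by positivity)
        calc B ≤ 1 + B := by linarith
          _ ≤ (1 + B) ^ 4 := le_self_pow₀ (by linarith) (by norm_num)
    _ = ((1 + B) * (R * α * β * γ)) ^ 4 := by rw [mul_pow (1 + B)]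

/-- The trilinear estimate: the mass fluxes and the transported velocity are bounded in `L⁴` by
their discrete `H¹₀` norms, the differences of the test function in `L²`. -/
lemma sum_abs_dualFlux_mul_le (hM : M.QuasiUniform κ H) (hd : d = 2 ∨ d = 3)
    (hab : ∀ i, a i < b i) {L : ℝ} (hL : ∀ j, 2 * κ * (b j - a j) ≤ L)
    {q : (Fin d → ℤ) → ℝ} {R : ℝ} (hR : 0 ≤ R) (hq : ∀ K ∈ M.cells, |q K| ≤ R)
    {v w : Fin d → (Fin d → ℤ) → ℝ} (hv : v ∈ M.velSpace) (hw : w ∈ M.velSpace)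
    (z : Fin d → (Fin d → ℤ) → ℝ) :
    ∑ i, ∑ j, ∑ σ ∈ M.dualFaces i j,
        |M.dualFlux q v i j σ| * (|w i σ| + |w i (σ + unitIdx j)|) *
        |z i σ - z i (σ + unitIdx j)|
      ≤ fluxConst d κ L * (R * M.h1Norm v * M.h1Norm w * M.h1Norm z) := by
  refine (Finset.sum_le_sum fun i _ => Finset.sum_le_sum fun j _ =>
    hM.sum_abs_dualFlux_mul_le_aux hd hab hL hR hq hv hw i j).trans (le_of_eq ?_)
  simp only [Finset.sum_const, Finset.card_univ, Fintype.card_fin, nsmul_eq_mul, fluxConst]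
  ring

/-! ### Weak forms of the discrete operators -/

lemma abs_sum_conv_mul_le (hM : M.QuasiUniform κ H) (hd : d = 2 ∨ d = 3)
    (hab : ∀ i, a i < b i) {L : ℝ} (hL : ∀ j, 2 * κ * (b j - a j) ≤ L)
    {q : (Fin d → ℤ) → ℝ} {R : ℝ} (hR : 0 ≤ R) (hq : ∀ K ∈ M.cells, |q K| ≤ R)
    {v w z : Fin d → (Fin d → ℤ) → ℝ} (hv : v ∈ M.velSpace) (hw : w ∈ M.velSpace)
    (hz : z ∈ M.velSpace) :
    |∑ i, ∑ σ ∈ M.intFaces i, M.dualVol i σ * M.conv q v w i σ * z i σ|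
      ≤ fluxConst d κ L * (R * M.h1Norm v * M.h1Norm w * M.h1Norm z) := by
  have hform : ∑ i, ∑ σ ∈ M.intFaces i, M.dualVol i σ * M.conv q v w i σ * z i σ
      = ∑ i, ∑ j, ∑ σ ∈ M.dualFaces i j,
        M.dualFlux q v i j σ * ((w i σ + w i (σ + unitIdx j)) / 2) *
          (z i σ - z i (σ + unitIdx j)) := by
    refine Finset.sum_congr rfl fun i _ => ?_
    rw [← sum_intFaces_sub_mul i
      (fun j σ => M.dualFlux q v i j σ * ((w i σ + w i (σ + unitIdx j)) / 2)) (hz i)]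
    refine Finset.sum_congr rfl fun σ hσ => ?_
    rw [conv, ← mul_assoc, mul_one_div_cancel (hM.dualVol_bounds hσ).1.ne', one_mul]
    simp only [sub_add_cancel, add_comm (w i σ) (w i (σ - _))]
  rw [hform]
  refine le_trans ?_ (hM.sum_abs_dualFlux_mul_le hd hab hL hR hq hv hw z)
  refine (Finset.abs_sum_le_sum_abs _ _).trans (Finset.sum_le_sum fun i _ => ?_)
  refine (Finset.abs_sum_le_sum_abs _ _).trans (Finset.sum_le_sum fun j _ => ?_)
  refine (Finset.abs_sum_le_sum_abs _ _).trans (Finset.sum_le_sum fun σ _ => ?_)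
  rw [abs_mul, abs_mul, abs_div, abs_two]
  gcongr
  have := abs_add_le (w i σ) (w i (σ + unitIdx j))
  have := abs_nonneg (w i σ + w i (σ + unitIdx j))
  linarith

/-- The discrete divergence of the mass fluxes on the dual mesh, tested by a product of velocities. -/
lemma abs_sum_dualFlux_sub_mul_le (hM : M.QuasiUniform κ H) (hd : d = 2 ∨ d = 3)
    (hab : ∀ i, a i < b i) {L : ℝ} (hL : ∀ j, 2 * κ * (b j - a j) ≤ L)
    {q : (Fin d → ℤ) → ℝ} {R : ℝ} (hR : 0 ≤ R) (hq : ∀ K ∈ M.cells, |q K| ≤ R)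
    {v w z : Fin d → (Fin d → ℤ) → ℝ} (hv : v ∈ M.velSpace) (hw : w ∈ M.velSpace)
    (hz : z ∈ M.velSpace) :
    |∑ i, ∑ σ ∈ M.intFaces i, (∑ j, (M.dualFlux q v i j σ - M.dualFlux q v i j (σ - unitIdx j))) *
        (w i σ * z i σ)|
      ≤ 2 * fluxConst d κ L * (R * M.h1Norm v * M.h1Norm w * M.h1Norm z) := by
  have h1 := hM.sum_abs_dualFlux_mul_le hd hab hL hR hq hv hw z
  have h2 := hM.sum_abs_dualFlux_mul_le hd hab hL hR hq hv hz w
  have hsum : |∑ i, ∑ σ ∈ M.intFaces i,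
      (∑ j, (M.dualFlux q v i j σ - M.dualFlux q v i j (σ - unitIdx j))) * (w i σ * z i σ)|
      ≤ (∑ i, ∑ j, ∑ σ ∈ M.dualFaces i j,
        |M.dualFlux q v i j σ| * (|w i σ| + |w i (σ + unitIdx j)|) *
        |z i σ - z i (σ + unitIdx j)|) + ∑ i, ∑ j, ∑ σ ∈ M.dualFaces i j,
        |M.dualFlux q v i j σ| * (|z i σ| + |z i (σ + unitIdx j)|) *
        |w i σ - w i (σ + unitIdx j)| := by
    simp only [← Finset.sum_add_distrib]
    refine (Finset.abs_sum_le_sum_abs _ _).trans (Finset.sum_le_sum fun i _ => ?_)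
    rw [sum_intFaces_sub_mul i (fun j σ => M.dualFlux q v i j σ) (z := fun σ => w i σ * z i σ)
      fun σ h => by rw [hw i σ h, zero_mul]]
    refine (Finset.abs_sum_le_sum_abs _ _).trans (Finset.sum_le_sum fun j _ => ?_)
    refine (Finset.abs_sum_le_sum_abs _ _).trans (Finset.sum_le_sum fun σ _ => ?_)
    rw [abs_mul, mul_assoc, mul_assoc, ← mul_add]
    gcongr
    generalize w i σ = x, w i (σ + unitIdx j) = x', z i σ = y, z i (σ + unitIdx j) = y'
    calc |x * y - x' * y'| = |x * (y - y') + y' * (x - x')| := by congr 1; ring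
      _ ≤ |x| * |y - y'| + |y'| * |x - x'| := by
          refine (abs_add_le _ _).trans ?_
          rw [abs_mul, abs_mul]
      _ ≤ _ := by gcongr <;> simp
  refine hsum.trans ((add_le_add h1 h2).trans (le_of_eq ?_))
  ring

lemma abs_sum_lap_mul_le (hM : M.QuasiUniform κ H) (hab : ∀ i, a i < b i)
    (w : Fin d → (Fin d → ℤ) → ℝ) {z : Fin d → (Fin d → ℤ) → ℝ} (hz : z ∈ M.velSpace) :
    |∑ i, ∑ σ ∈ M.intFaces i, M.dualVol i σ * M.lap w i σ * z i σ|
      ≤ M.h1Norm w * M.h1Norm z := by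
  have hform : ∑ i, ∑ σ ∈ M.intFaces i, M.dualVol i σ * M.lap w i σ * z i σ
      = ∑ i, ∑ j, ∑ σ ∈ M.dualFaces i j,
        M.dualFaceArea i j σ / M.dualDist i j σ * (w i (σ + unitIdx j) - w i σ) *
          (z i σ - z i (σ + unitIdx j)) := by
    refine Finset.sum_congr rfl fun i _ => ?_
    rw [← sum_intFaces_sub_mul i
      (fun j σ => M.dualFaceArea i j σ / M.dualDist i j σ * (w i (σ + unitIdx j) - w i σ)) (hz i)]
    refine Finset.sum_congr rfl fun σ hσ => ?_
    rw [lap, ← mul_assoc, mul_one_div_cancel (hM.dualVol_bounds hσ).1.ne', one_mul]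
    simp only [sub_add_cancel]
  rw [hform]
  refine abs_le_of_sq_le_sq ?_ (mul_nonneg (M.h1Norm_nonneg _) (M.h1Norm_nonneg _))
  rw [mul_pow, hM.sq_h1Norm hab, hM.sq_h1Norm hab]
  simp only [h1NormSq, Finset.sum_sigma']
  refine Finset.sum_sq_le_sum_mul_sum_of_sq_le_mul _ (fun x hx => ?_) (fun x hx => ?_)
    fun x _ => le_of_eq (by ring)
  all_goals
    simp only [Finset.mem_sigma, Finset.mem_univ, true_and] at hx
    exact hM.h1NormSq_term_nonneg hab _ hx

end QuasiUniform

lemma divVel_eq (v : Fin d → (Fin d → ℤ) → ℝ) (K : Fin d → ℤ) :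
    M.divVel v K = 1 / M.cellVol K * ∑ i, (M.faceArea i (K + unitIdx i) * v i (K + unitIdx i)
      - M.faceArea i K * v i K) := by
  simp [divVel, divMass, massFlux]

lemma cellVol_pos {K : Fin d → ℤ} (hK : K ∈ M.cells) : 0 < M.cellVol K :=
  Finset.prod_pos fun k _ => M.h_pos (mem_cells.1 hK k).1 (mem_cells.1 hK k).2

lemma sum_flux_eq_zero {v : Fin d → (Fin d → ℤ) → ℝ} {K : Fin d → ℤ} (hK : K ∈ M.cells)
    (hv : M.divVel v K = 0) : ∑ i, (M.faceArea i (K + unitIdx i) * v i (K + unitIdx i)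
      - M.faceArea i K * v i K) = 0 := by
  rw [divVel_eq] at hv
  exact (mul_eq_zero.1 hv).resolve_left (one_div_pos.2 (cellVol_pos hK)).ne'

lemma sub_mem_divFreeSpace {u v : Fin d → (Fin d → ℤ) → ℝ} (hu : u ∈ M.divFreeSpace)
    (hv : v ∈ M.divFreeSpace) : u - v ∈ M.divFreeSpace := by
  refine ⟨sub_mem_velSpace hu.1 hv.1, fun K hK => ?_⟩
  have h1 := sum_flux_eq_zero hK (hu.2 K hK)
  have h2 := sum_flux_eq_zero hK (hv.2 K hK)
  rw [divVel_eq]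
  have : ∑ i, (M.faceArea i (K + unitIdx i) * (u - v) i (K + unitIdx i)
      - M.faceArea i K * (u - v) i K) = 0 := by
    rw [← sub_zero 0]
    nth_rw 1 [← h1]
    rw [← h2, ← Finset.sum_sub_distrib]
    refine Finset.sum_congr rfl fun i _ => ?_
    simp only [Pi.sub_apply]; ring
  rw [this, mul_zero]

/-- The discrete pressure gradient is orthogonal to the divergence free velocities. -/
lemma sum_gradP_mul_eq_zero {κ H : ℝ} (hM : M.QuasiUniform κ H) (p : (Fin d → ℤ) → ℝ)
    {z : Fin d → (Fin d → ℤ) → ℝ} (hz : z ∈ M.divFreeSpace) :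
    ∑ i, ∑ σ ∈ M.intFaces i, M.dualVol i σ * M.gradP p i σ * z i σ = 0 := by
  have hform : ∀ i, ∑ σ ∈ M.intFaces i, M.dualVol i σ * M.gradP p i σ * z i σ
      = ∑ K ∈ M.cells, p K * (M.faceArea i K * z i K
        - M.faceArea i (K + unitIdx i) * z i (K + unitIdx i)) := fun i => by
    rw [← sum_sub_comp_sub_mul (unitIdx i) (F := M.intFaces i)
      (fun σ h => intFaces_subset_cells i h) (fun σ h => sub_unitIdx_mem_cells h) p
      (fun σ => M.faceArea i σ * z i σ) fun σ h => by rw [hz.1 i σ h, mul_zero]]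
    refine Finset.sum_congr rfl fun σ hσ => ?_
    have := (hM.dualVol_bounds hσ).1.ne'
    rw [gradP]
    field_simp
  rw [Finset.sum_congr rfl fun i _ => hform i, Finset.sum_comm]
  refine Finset.sum_eq_zero fun K hK => ?_
  rw [← Finset.mul_sum]
  have h0 := sum_flux_eq_zero hK (hz.2 K hK)
  rw [← neg_eq_zero, ← Finset.sum_neg_distrib] at h0
  simp only [neg_sub] at h0
  rw [h0, mul_zero]

variable {κ H : ℝ}

/-! ### The discrete maximum principle -/

lemma cellVol_mul_divMass (q : (Fin d → ℤ) → ℝ) (v : Fin d → (Fin d → ℤ) → ℝ) {K : Fin d → ℤ}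
    (hK : K ∈ M.cells) : M.cellVol K * M.divMass q v K
      = ∑ i, (M.massFlux q v i (K + unitIdx i) - M.massFlux q v i K) := by
  rw [divMass, ← mul_assoc, mul_one_div_cancel (cellVol_pos hK).ne', one_mul]

/-- The implicit upwind scheme for the mass balance does not increase the maximum of the density:
in a cell where the new density is largest, the upwind divergence is nonnegative. -/
lemma le_of_upwind_le (hM : M.QuasiUniform κ H) {v : Fin d → (Fin d → ℤ) → ℝ}
    (hv : v ∈ M.divFreeSpace)
    {q q' : (Fin d → ℤ) → ℝ} {δ : ℝ} (hδ : 0 < δ)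
    (heq : ∀ K ∈ M.cells, (q' K - q K) / δ + M.divMass q' v K = 0) {R : ℝ}
    (hq : ∀ K ∈ M.cells, q K ≤ R) : ∀ K ∈ M.cells, q' K ≤ R := by
  intro K₀ hK₀
  obtain ⟨K, hK, hmax⟩ := M.cells.exists_max_image q' ⟨K₀, hK₀⟩
  refine (hmax K₀ hK₀).trans ?_
  have hin : ∀ {i τ}, v i τ ≠ 0 → τ ∈ M.intFaces i := fun {i τ} h => by
    by_contra h'
    exact h (hv.1 i τ h')
  have hdiv : 0 ≤ M.cellVol K * M.divMass q' v K := by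
    rw [cellVol_mul_divMass _ _ hK, ← mul_zero (q' K), ← sum_flux_eq_zero hK (hv.2 K hK),
      Finset.mul_sum]
    refine Finset.sum_le_sum fun i _ => ?_
    have hup : q' K * (M.faceArea i (K + unitIdx i) * v i (K + unitIdx i))
        ≤ M.massFlux q' v i (K + unitIdx i) := by
      rw [massFlux, add_sub_cancel_right]
      split_ifs with h
      · exact le_of_eq (by ring)
      · rw [not_le] at h
        have hτ := intFaces_subset_cells i (hin h.ne)
        have := (hM.faceArea_bounds (i := i) hτ).1
        nlinarith [mul_nonneg (mul_nonneg this.le (neg_nonneg.2 h.le))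
          (sub_nonneg.2 (hmax _ hτ))]
    have hlo : M.massFlux q' v i K ≤ q' K * (M.faceArea i K * v i K) := by
      rw [massFlux]
      split_ifs with h
      · rcases h.eq_or_lt with h0 | h0
        · rw [← h0]; simp
        · have hτ := sub_unitIdx_mem_cells (hin h0.ne')
          have := (hM.faceArea_bounds (i := i) hK).1
          nlinarith [mul_nonneg (mul_nonneg this.le h) (sub_nonneg.2 (hmax _ hτ))]
      · exact le_of_eq (by ring)
    linarith
  have h0 : 0 ≤ M.divMass q' v K := nonneg_of_mul_nonneg_right hdiv (cellVol_pos hK)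
  have h1 := heq K hK
  have h2 : (q' K - q K) / δ ≤ 0 := by linarith
  rw [div_le_iff₀ hδ, zero_mul] at h2
  linarith [hq K hK]

lemma divMass_neg (q : (Fin d → ℤ) → ℝ) (v : Fin d → (Fin d → ℤ) → ℝ) (K : Fin d → ℤ) :
    M.divMass (-q) v K = -M.divMass q v K := by
  have h : ∀ i σ, M.massFlux (-q) v i σ = -M.massFlux q v i σ := fun i σ => by
    simp only [massFlux, Pi.neg_apply]
    split_ifs <;> ring
  simp only [divMass, h]
  rw [← mul_neg, ← Finset.sum_neg_distrib]
  congr 1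
  exact Finset.sum_congr rfl fun i _ => by ring

lemma x_mono (M : MACGrid d a b) {j : Fin d} {k l : ℤ} (hk : 0 ≤ k) (hkl : k ≤ l)
    (hl : l ≤ M.n j) : M.x j k ≤ M.x j l :=
  (M.x_strictMono j).monotoneOn ⟨hk, hkl.trans hl⟩ ⟨hk.trans hkl, hl⟩ hkl

lemma cellSet_subset {K : Fin d → ℤ} (hK : K ∈ M.cells) : M.cellSet K ⊆ boxDomain a b := by
  intro y hy j _
  have hyj := hy j trivial
  have hKj := mem_cells.1 hK j
  have h1 := M.x_mono le_rfl hKj.1 hKj.2.le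
  have h2 := M.x_mono (l := M.n j) (k := K j + 1) (by omega) (by omega) le_rfl
  rw [M.x_first] at h1
  rw [M.x_last] at h2
  exact ⟨h1.trans_lt hyj.1, hyj.2.trans_le h2⟩

lemma volume_cellSet {K : Fin d → ℤ} (hK : K ∈ M.cells) :
    (volume : Measure (Fin d → ℝ)).real (M.cellSet K) = M.cellVol K := by
  rw [Measure.real, cellSet, Real.volume_pi_Ioo_toReal]
  · rfl
  · exact fun j => (sub_pos.1 (M.h_pos (mem_cells.1 hK j).1 (mem_cells.1 hK j).2)).le

lemma cellMean_mem_Icc {r : (Fin d → ℝ) → ℝ} {R₁ R₂ : ℝ}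
    (hr : AEMeasurable r (volume.restrict (boxDomain a b)))
    (hR : ∀ᵐ y ∂(volume.restrict (boxDomain a b)), R₁ < r y ∧ r y ≤ R₂)
    {K : Fin d → ℤ} (hK : K ∈ M.cells) : R₁ ≤ M.cellMean r K ∧ M.cellMean r K ≤ R₂ := by
  have hle : volume.restrict (M.cellSet K) ≤ volume.restrict (boxDomain a b) :=
    Measure.restrict_mono (cellSet_subset hK) le_rfl
  have hR' : ∀ᵐ y ∂(volume.restrict (M.cellSet K)), R₁ < r y ∧ r y ≤ R₂ := ae_mono hle hR
  have hfin : IsFiniteMeasure (volume.restrict (M.cellSet K)) := by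
    refine ⟨?_⟩
    rw [Measure.restrict_apply_univ, cellSet, Real.volume_pi_Ioo]
    exact ENNReal.prod_lt_top fun _ _ => ENNReal.ofReal_lt_top
  have hint : Integrable r (volume.restrict (M.cellSet K)) := by
    refine Integrable.of_bound (hr.mono_measure hle).aestronglyMeasurable (max |R₁| |R₂|) ?_
    filter_upwards [hR'] with y hy
    exact abs_le_max_abs_abs hy.1.le hy.2
  have hV := cellVol_pos hK
  have hconst : ∀ c : ℝ, ∫ _ in M.cellSet K, c = M.cellVol K * c := fun c => by
    rw [setIntegral_const, volume_cellSet hK, smul_eq_mul]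
  have h1 : M.cellVol K * R₁ ≤ ∫ y in M.cellSet K, r y := by
    rw [← hconst]
    exact integral_mono_ae (integrable_const _) hint (hR'.mono fun y hy => hy.1.le)
  have h2 : ∫ y in M.cellSet K, r y ≤ M.cellVol K * R₂ := by
    rw [← hconst]
    exact integral_mono_ae hint (integrable_const _) (hR'.mono fun y hy => hy.2)
  rw [cellMean, one_div, inv_mul_eq_div]
  exact ⟨(le_div_iff₀ hV).2 (by linarith), (div_le_iff₀ hV).2 (by linarith)⟩

/-! ### The mass balance on the dual cells -/

lemma dualVol_eq (i : Fin d) (σ : Fin d → ℤ) :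
    M.dualVol i σ = M.cellVol (σ - unitIdx i) / 2 + M.cellVol σ / 2 := by
  rw [dualVol, cellVol, cellVol, ← Finset.mul_prod_erase _ _ (Finset.mem_univ i),
    ← Finset.mul_prod_erase _ _ (Finset.mem_univ i),
    ← Finset.mul_prod_erase _ (fun j => M.h j (σ j)) (Finset.mem_univ i), sub_unitIdx_same]
  have e1 : ∏ k ∈ Finset.univ.erase i, M.dualWidth i σ k
      = ∏ k ∈ Finset.univ.erase i, M.h k (σ k) :=
    Finset.prod_congr rfl fun k hk => by simp [dualWidth, Finset.ne_of_mem_erase hk]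
  have e2 : ∏ k ∈ Finset.univ.erase i, M.h k ((σ - unitIdx i) k)
      = ∏ k ∈ Finset.univ.erase i, M.h k (σ k) :=
    Finset.prod_congr rfl fun k hk => by rw [sub_unitIdx_of_ne _ (Finset.ne_of_mem_erase hk)]
  rw [e1, e2, dualWidth, if_pos rfl]
  ring

lemma dualVol_mul_dualDensity (hM : M.QuasiUniform κ H) (q : (Fin d → ℤ) → ℝ) {i : Fin d}
    {σ : Fin d → ℤ} (hσ : σ ∈ M.intFaces i) : M.dualVol i σ * M.dualDensity q i σ
      = M.cellVol (σ - unitIdx i) / 2 * q (σ - unitIdx i) + M.cellVol σ / 2 * q σ := by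
  rw [dualDensity, mul_div_cancel₀ _ (hM.dualVol_bounds hσ).1.ne']

lemma le_dualDensity (hM : M.QuasiUniform κ H) {q : (Fin d → ℤ) → ℝ} {R : ℝ}
    (hq : ∀ K ∈ M.cells, R ≤ q K) {i : Fin d} {σ : Fin d → ℤ} (hσ : σ ∈ M.intFaces i) :
    R * M.dualVol i σ ≤ M.dualVol i σ * M.dualDensity q i σ := by
  rw [dualVol_mul_dualDensity hM q hσ, dualVol_eq]
  have hK := sub_unitIdx_mem_cells hσ
  have hL := intFaces_subset_cells i hσ
  nlinarith [mul_nonneg (cellVol_pos hK).le (sub_nonneg.2 (hq _ hK)),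
    mul_nonneg (cellVol_pos hL).le (sub_nonneg.2 (hq _ hL))]

/-- The mass balances of the two cells sharing `σ` add up to a mass balance of `D_σ`. -/
lemma dual_mass_balance (hM : M.QuasiUniform κ H) {v : Fin d → (Fin d → ℤ) → ℝ}
    {q q' : (Fin d → ℤ) → ℝ} {δ : ℝ} (hδ : 0 < δ)
    (heq : ∀ K ∈ M.cells, (q' K - q K) / δ + M.divMass q' v K = 0) {i : Fin d}
    {σ : Fin d → ℤ} (hσ : σ ∈ M.intFaces i) :
    M.dualVol i σ * (M.dualDensity q' i σ - M.dualDensity q i σ)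
      = -δ * ∑ j, (M.dualFlux q' v i j σ - M.dualFlux q' v i j (σ - unitIdx j)) := by
  have hcell : ∀ K ∈ M.cells, M.cellVol K * (q' K - q K)
      = -δ * ∑ j, (M.massFlux q' v j (K + unitIdx j) - M.massFlux q' v j K) := fun K hK => by
    rw [← cellVol_mul_divMass _ _ hK]
    have := heq K hK
    field_simp at this
    linear_combination M.cellVol K * this
  have h1 := hcell _ (sub_unitIdx_mem_cells hσ)
  have h2 := hcell _ (intFaces_subset_cells i hσ)
  have hflux : ∑ j, (M.dualFlux q' v i j σ - M.dualFlux q' v i j (σ - unitIdx j))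
      = (∑ j, (M.massFlux q' v j (σ - unitIdx i + unitIdx j)
          - M.massFlux q' v j (σ - unitIdx i)) +
        ∑ j, (M.massFlux q' v j (σ + unitIdx j) - M.massFlux q' v j σ)) / 2 := by
    rw [← Finset.sum_add_distrib, Finset.sum_div]
    refine Finset.sum_congr rfl fun j _ => ?_
    by_cases hij : j = i
    · subst hij
      simp only [dualFlux, if_true, sub_add_cancel]
      ring
    · have e : σ - unitIdx j - unitIdx i + unitIdx j = σ - unitIdx i := by abel
      simp only [dualFlux, if_neg hij, sub_add_cancel, e]
      ring
  rw [mul_sub, dualVol_mul_dualDensity hM q' hσ, dualVol_mul_dualDensity hM q hσ, hflux]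
  linear_combination h1 / 2 + h2 / 2

/-! ### Energy estimates for the scheme -/

/-- `L²` norm of the discrete force in the time step from `m T / N` to `(m + 1) T / N`. -/
def forceNorm (M : MACGrid d a b) (T : ℝ) (N : ℕ) (f : ℝ → (Fin d → ℝ) → Fin d → ℝ) (m : ℕ) : ℝ :=
  √(M.l2NormSq (M.forceMean f (m * (T / N)) ((m + 1) * (T / N))))

lemma forceNorm_nonneg (T : ℝ) (N : ℕ) (f : ℝ → (Fin d → ℝ) → Fin d → ℝ) (m : ℕ) :
    0 ≤ M.forceNorm T N f m := Real.sqrt_nonneg _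

lemma QuasiUniform.l2NormSq_nonneg (hM : M.QuasiUniform κ H) (v : Fin d → (Fin d → ℤ) → ℝ) :
    0 ≤ M.l2NormSq v :=
  Finset.sum_nonneg fun _ _ => Finset.sum_nonneg fun _ h =>
    mul_nonneg (hM.dualVol_bounds h).1.le (sq_nonneg _)

lemma abs_sum_mul_le_sqrt_l2NormSq (hM : M.QuasiUniform κ H) (v w : Fin d → (Fin d → ℤ) → ℝ) :
    |∑ i, ∑ σ ∈ M.intFaces i, M.dualVol i σ * v i σ * w i σ|
      ≤ √(M.l2NormSq v) * √(M.l2NormSq w) := by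
  rw [← Real.sqrt_mul (hM.l2NormSq_nonneg v)]
  refine Real.abs_le_sqrt ?_
  simp only [l2NormSq, Finset.sum_sigma']
  refine Finset.sum_sq_le_sum_mul_sum_of_sq_le_mul _ (fun x hx => ?_) (fun x hx => ?_)
    fun x _ => le_of_eq (by ring)
  all_goals
    simp only [Finset.mem_sigma, Finset.mem_univ, true_and] at hx
    exact mul_nonneg (hM.dualVol_bounds hx).1.le (sq_nonneg _)

/-- The constant in the discrete Poincaré inequality. -/
def poincareConst (d : ℕ) (κ L : ℝ) : ℝ := √(d * κ ^ (2 * d) * L ^ 2)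

lemma QuasiUniform.sqrt_l2NormSq_le (hM : M.QuasiUniform κ H) (hd : d = 2 ∨ d = 3)
    (hab : ∀ i, a i < b i) {L : ℝ} (hL : ∀ j, 2 * κ * (b j - a j) ≤ L)
    {w : Fin d → (Fin d → ℤ) → ℝ} (hw : w ∈ M.velSpace) :
    √(M.l2NormSq w) ≤ poincareConst d κ L * M.h1Norm w := by
  have := hM.kappa_pos
  rw [poincareConst, h1Norm, ← Real.sqrt_mul (by positivity)]
  exact Real.sqrt_le_sqrt (hM.l2NormSq_le hd hab hL hw)

section Scheme

variable {T : ℝ} {N : ℕ} {f : ℝ → (Fin d → ℝ) → Fin d → ℝ} {ρ₀ : (Fin d → ℝ) → ℝ}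
  {u : ℕ → Fin d → (Fin d → ℤ) → ℝ} {ρ p : ℕ → (Fin d → ℤ) → ℝ}

lemma IsSolution.vel_mem_divFreeSpace (hs : M.IsSolution T N f ρ₀ u ρ p) {m : ℕ} (hm : m ≤ N) :
    u m ∈ M.divFreeSpace := by
  rcases m with _ | m
  · exact hs.init_vel
  · exact ⟨hs.vel_mem m hm, hs.incompressible m hm⟩

/-- The densities remain between the bounds of the initial density; the lower bound is the upper
bound for the opposite density. -/
lemma IsSolution.density_bounds (hs : M.IsSolution T N f ρ₀ u ρ p) (hM : M.QuasiUniform κ H)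
    (hδ : 0 < T / N) {R₁ R₂ : ℝ} (hr : AEMeasurable ρ₀ (volume.restrict (boxDomain a b)))
    (hR : ∀ᵐ y ∂(volume.restrict (boxDomain a b)), R₁ < ρ₀ y ∧ ρ₀ y ≤ R₂) {m : ℕ} (hm : m ≤ N) :
    ∀ K ∈ M.cells, R₁ ≤ ρ m K ∧ ρ m K ≤ R₂ := by
  induction m with
  | zero =>
    intro K hK
    rw [hs.init_density K hK]
    exact cellMean_mem_Icc hr hR hK
  | succ m ih =>
    have hv := hs.vel_mem_divFreeSpace (m := m) (by omega)
    have ih := ih (by omega)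
    have heq := hs.mass m hm
    have hup := le_of_upwind_le hM hv hδ heq fun K hK => (ih K hK).2
    have hlo := le_of_upwind_le hM hv hδ (q := -ρ m) (q' := -ρ (m + 1)) (R := -R₁)
      (fun K hK => by
        have := heq K hK
        rw [divMass_neg]
        simp only [Pi.neg_apply]
        linear_combination -this)
      fun K hK => neg_le_neg (ih K hK).1
    exact fun K hK => ⟨neg_le_neg_iff.1 (hlo K hK), hup K hK⟩

/-- Change of the momentum in one time step, tested by a divergence free velocity. -/
lemma IsSolution.momentum_step (hs : M.IsSolution T N f ρ₀ u ρ p) (hM : M.QuasiUniform κ H)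
    (hd : d = 2 ∨ d = 3) (hab : ∀ i, a i < b i) {L : ℝ} (hL : ∀ j, 2 * κ * (b j - a j) ≤ L)
    (hδ : 0 < T / N) {m : ℕ} (hm : m < N) {R : ℝ} (hR : 0 ≤ R)
    (hρ : ∀ K ∈ M.cells, |ρ (m + 1) K| ≤ R)
    {z : Fin d → (Fin d → ℤ) → ℝ} (hz : z ∈ M.divFreeSpace) :
    ∑ i, ∑ σ ∈ M.intFaces i, M.dualVol i σ * (M.dualDensity (ρ (m + 1)) i σ * u (m + 1) i σ
        - M.dualDensity (ρ m) i σ * u m i σ) * z i σ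
      ≤ T / N * (fluxConst d κ L * R * M.h1Norm (u m) * M.h1Norm (u (m + 1))
        + M.h1Norm (u (m + 1)) + poincareConst d κ L * M.forceNorm T N f m) * M.h1Norm z := by
  have hum := hs.vel_mem_divFreeSpace hm.le
  have hum' := hs.vel_mem_divFreeSpace (m := m + 1) hm
  set F := M.forceMean f (m * (T / N)) ((m + 1) * (T / N)) with hF
  have hconv := hM.abs_sum_conv_mul_le hd hab hL hR hρ hum.1 hum'.1 hz.1
  have hlap := hM.abs_sum_lap_mul_le hab (u (m + 1)) hz.1
  have hp := sum_gradP_mul_eq_zero hM (p (m + 1)) hz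
  have hf := abs_sum_mul_le_sqrt_l2NormSq hM F z
  have hP := mul_le_mul_of_nonneg_left (hM.sqrt_l2NormSq_le hd hab hL hz.1)
    (Real.sqrt_nonneg (M.l2NormSq F))
  have hfn : M.forceNorm T N f m = √(M.l2NormSq F) := rfl
  have hsplit : ∑ i, ∑ σ ∈ M.intFaces i, M.dualVol i σ *
      (M.dualDensity (ρ (m + 1)) i σ * u (m + 1) i σ
        - M.dualDensity (ρ m) i σ * u m i σ) * z i σ
      = T / N * (-(∑ i, ∑ σ ∈ M.intFaces i,
          M.dualVol i σ * M.conv (ρ (m + 1)) (u m) (u (m + 1)) i σ * z i σ)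
        + (∑ i, ∑ σ ∈ M.intFaces i, M.dualVol i σ * M.lap (u (m + 1)) i σ * z i σ)
        - (∑ i, ∑ σ ∈ M.intFaces i, M.dualVol i σ * M.gradP (p (m + 1)) i σ * z i σ)
        + ∑ i, ∑ σ ∈ M.intFaces i, M.dualVol i σ * F i σ * z i σ) := by
    simp only [← Finset.sum_neg_distrib, ← Finset.sum_add_distrib, ← Finset.sum_sub_distrib,
      Finset.mul_sum]
    refine Finset.sum_congr rfl fun i _ => Finset.sum_congr rfl fun σ hσ => ?_
    have h := hs.momentum m hm i σ hσ
    rw [← hF, div_add' _ _ _ hδ.ne', div_sub' hδ.ne', div_add' _ _ _ hδ.ne', div_eq_iff hδ.ne'] at h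
    linear_combination M.dualVol i σ * z i σ * h
  rw [hsplit, hp, hfn, mul_assoc]
  refine mul_le_mul_of_nonneg_left ?_ hδ.le
  have h1 := neg_le_of_abs_le hconv
  have h2 := le_of_abs_le hlap
  have h3 := le_of_abs_le hf
  nlinarith only [h1, h2, h3, hP]

/-- Change of the dual densities in one time step, tested by a product of velocities. -/
lemma IsSolution.density_step (hs : M.IsSolution T N f ρ₀ u ρ p) (hM : M.QuasiUniform κ H)
    (hd : d = 2 ∨ d = 3) (hab : ∀ i, a i < b i) {L : ℝ} (hL : ∀ j, 2 * κ * (b j - a j) ≤ L)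
    (hδ : 0 < T / N) {m : ℕ} (hm : m < N) {R : ℝ} (hR : 0 ≤ R)
    (hρ : ∀ K ∈ M.cells, |ρ (m + 1) K| ≤ R)
    {w z : Fin d → (Fin d → ℤ) → ℝ} (hw : w ∈ M.velSpace) (hz : z ∈ M.velSpace) :
    -∑ i, ∑ σ ∈ M.intFaces i, M.dualVol i σ * (M.dualDensity (ρ (m + 1)) i σ
        - M.dualDensity (ρ m) i σ) * (w i σ * z i σ)
      ≤ T / N * (2 * fluxConst d κ L * R * M.h1Norm (u m) * M.h1Norm w) * M.h1Norm z := by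
  have hum := hs.vel_mem_divFreeSpace hm.le
  have h := hM.abs_sum_dualFlux_sub_mul_le hd hab hL hR hρ hum.1 hw hz
  have e : -∑ i, ∑ σ ∈ M.intFaces i, M.dualVol i σ * (M.dualDensity (ρ (m + 1)) i σ
        - M.dualDensity (ρ m) i σ) * (w i σ * z i σ)
      = T / N * ∑ i, ∑ σ ∈ M.intFaces i, (∑ j, (M.dualFlux (ρ (m + 1)) (u m) i j σ
        - M.dualFlux (ρ (m + 1)) (u m) i j (σ - unitIdx j))) * (w i σ * z i σ) := by
    simp only [← Finset.sum_neg_distrib, Finset.mul_sum (Finset.univ : Finset (Fin d)),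
      Finset.mul_sum (M.intFaces _)]
    refine Finset.sum_congr rfl fun i _ => Finset.sum_congr rfl fun σ hσ => ?_
    rw [dual_mass_balance hM hδ (hs.mass m hm) hσ]
    ring
  rw [e]
  calc _ ≤ T / N * (2 * fluxConst d κ L * (R * M.h1Norm (u m) * M.h1Norm w * M.h1Norm z)) :=
        mul_le_mul_of_nonneg_left (le_of_abs_le h) hδ.le
    _ = _ := by ring

/-- The `L²` distance of the velocities at two times. With `v = u^r - u^s`, the identity
`ρ^r v = (ρ^r u^r - ρ^s u^s) - (ρ^r - ρ^s) u^s`, tested by `v`, reduces it to the sums over the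
intermediate time steps of the changes of momentum and of density. -/
lemma IsSolution.l2NormSq_sub_le (hs : M.IsSolution T N f ρ₀ u ρ p) (hM : M.QuasiUniform κ H)
    (hd : d = 2 ∨ d = 3) (hab : ∀ i, a i < b i) {L : ℝ} (hL : ∀ j, 2 * κ * (b j - a j) ≤ L)
    (hδ : 0 < T / N) {R₁ R₂ : ℝ} (hR₁ : 0 < R₁)
    (hρ : ∀ m ≤ N, ∀ K ∈ M.cells, R₁ ≤ ρ m K ∧ ρ m K ≤ R₂) (hR : 0 ≤ R₂) {r s : ℕ} (hsr : s ≤ r)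
    (hr : r ≤ N) :
    R₁ * M.l2NormSq (u r - u s) ≤ (∑ k ∈ Finset.Ico s r, T / N *
      (fluxConst d κ L * R₂ * M.h1Norm (u k) * M.h1Norm (u (k + 1)) + M.h1Norm (u (k + 1))
        + poincareConst d κ L * M.forceNorm T N f k
        + 2 * fluxConst d κ L * R₂ * M.h1Norm (u k) * M.h1Norm (u s))) *
      (2 * (M.h1Norm (u r) + M.h1Norm (u s))) := by
  have hur := hs.vel_mem_divFreeSpace hr
  have hus := hs.vel_mem_divFreeSpace (hsr.trans hr)
  set z := u r - u s with hz_def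
  have hz : z ∈ M.divFreeSpace := sub_mem_divFreeSpace hur hus
  have habs : ∀ m ≤ N, ∀ K ∈ M.cells, |ρ m K| ≤ R₂ := fun m hm K hK => by
    rw [abs_of_nonneg (hR₁.le.trans (hρ m hm K hK).1)]
    exact (hρ m hm K hK).2
  have tele : ∀ g : ℕ → ℝ, ∑ k ∈ Finset.Ico s r, (g (k + 1) - g k) = g r - g s :=
    fun g => Finset.sum_Ico_sub g hsr
  have h1 : ∑ i, ∑ σ ∈ M.intFaces i, M.dualVol i σ * (M.dualDensity (ρ r) i σ * u r i σ
        - M.dualDensity (ρ s) i σ * u s i σ) * z i σ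
      = ∑ k ∈ Finset.Ico s r, ∑ i, ∑ σ ∈ M.intFaces i, M.dualVol i σ *
        (M.dualDensity (ρ (k + 1)) i σ * u (k + 1) i σ
        - M.dualDensity (ρ k) i σ * u k i σ) * z i σ := by
    rw [Finset.sum_comm]
    refine Finset.sum_congr rfl fun i _ => ?_
    rw [Finset.sum_comm]
    refine Finset.sum_congr rfl fun σ _ => ?_
    rw [← Finset.sum_mul, ← Finset.mul_sum, tele fun k => M.dualDensity (ρ k) i σ * u k i σ]
  have h2 : -∑ i, ∑ σ ∈ M.intFaces i, M.dualVol i σ * (M.dualDensity (ρ r) i σ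
        - M.dualDensity (ρ s) i σ) * (u s i σ * z i σ)
      = ∑ k ∈ Finset.Ico s r, -∑ i, ∑ σ ∈ M.intFaces i, M.dualVol i σ *
        (M.dualDensity (ρ (k + 1)) i σ - M.dualDensity (ρ k) i σ) * (u s i σ * z i σ) := by
    rw [Finset.sum_neg_distrib, neg_inj, Finset.sum_comm]
    refine Finset.sum_congr rfl fun i _ => ?_
    rw [Finset.sum_comm]
    refine Finset.sum_congr rfl fun σ _ => ?_
    rw [← Finset.sum_mul, ← Finset.mul_sum, tele fun k => M.dualDensity (ρ k) i σ]
  have h0 : R₁ * M.l2NormSq z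
      ≤ (∑ i, ∑ σ ∈ M.intFaces i, M.dualVol i σ * (M.dualDensity (ρ r) i σ * u r i σ
        - M.dualDensity (ρ s) i σ * u s i σ) * z i σ)
        + -∑ i, ∑ σ ∈ M.intFaces i, M.dualVol i σ * (M.dualDensity (ρ r) i σ
        - M.dualDensity (ρ s) i σ) * (u s i σ * z i σ) := by
    simp only [l2NormSq, Finset.mul_sum, ← Finset.sum_neg_distrib, ← Finset.sum_add_distrib]
    refine Finset.sum_le_sum fun i _ => Finset.sum_le_sum fun σ hσ => ?_
    have hD := le_dualDensity hM (fun K hK => (hρ r hr K hK).1) hσ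
    have hzσ : z i σ = u r i σ - u s i σ := by simp [hz_def]
    calc R₁ * (M.dualVol i σ * z i σ ^ 2) = R₁ * M.dualVol i σ * z i σ ^ 2 := by ring
      _ ≤ M.dualVol i σ * M.dualDensity (ρ r) i σ * z i σ ^ 2 :=
          mul_le_mul_of_nonneg_right hD (sq_nonneg _)
      _ = _ := by rw [hzσ]; ring
  have hκ := hM.kappa_pos
  have hfc := fluxConst_nonneg d hκ L
  have hpc : 0 ≤ poincareConst d κ L := Real.sqrt_nonneg _
  rw [h1, h2, ← Finset.sum_add_distrib] at h0
  refine h0.trans ?_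
  calc _ ≤ ∑ k ∈ Finset.Ico s r, T / N *
      (fluxConst d κ L * R₂ * M.h1Norm (u k) * M.h1Norm (u (k + 1)) + M.h1Norm (u (k + 1))
        + poincareConst d κ L * M.forceNorm T N f k
        + 2 * fluxConst d κ L * R₂ * M.h1Norm (u k) * M.h1Norm (u s)) * M.h1Norm z := by
        refine Finset.sum_le_sum fun k hk => ?_
        have hkN : k < N := (Finset.mem_Ico.1 hk).2.trans_le hr
        have hm := hs.momentum_step hM hd hab hL hδ hkN hR (habs (k + 1) hkN) hz
        have hd' := hs.density_step hM hd hab hL hδ hkN hR (habs (k + 1) hkN) hus.1 hz.1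
        exact (add_le_add hm hd').trans (le_of_eq (by ring))
    _ = (∑ k ∈ Finset.Ico s r, T / N *
      (fluxConst d κ L * R₂ * M.h1Norm (u k) * M.h1Norm (u (k + 1)) + M.h1Norm (u (k + 1))
        + poincareConst d κ L * M.forceNorm T N f k
        + 2 * fluxConst d κ L * R₂ * M.h1Norm (u k) * M.h1Norm (u s))) * M.h1Norm z := by
        rw [Finset.sum_mul]
    _ ≤ _ := by
        refine mul_le_mul_of_nonneg_left (hM.h1Norm_sub_le hab _ _) (Finset.sum_nonneg fun k _ => ?_)
        have n1 := M.h1Norm_nonneg (u k)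
        have n2 := M.h1Norm_nonneg (u (k + 1))
        have n3 := M.h1Norm_nonneg (u s)
        have n4 := M.forceNorm_nonneg T N f k
        exact mul_nonneg hδ.le (by positivity)

end Scheme

/-! ### The dual cells as sets -/

/-- Lower end of the dual cell of `σ` in the direction `j`. -/
def dualLo (M : MACGrid d a b) (i : Fin d) (σ : Fin d → ℤ) (j : Fin d) : ℝ :=
  if j = i then M.mid i (σ i - 1) else M.x j (σ j)

/-- Upper end of the dual cell of `σ` in the direction `j`. -/
def dualHi (M : MACGrid d a b) (i : Fin d) (σ : Fin d → ℤ) (j : Fin d) : ℝ :=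
  if j = i then M.mid i (σ i) else M.x j (σ j + 1)

lemma dualSet_eq (i : Fin d) (σ : Fin d → ℤ) :
    M.dualSet i σ = Set.univ.pi fun j => Set.Ioo (M.dualLo i σ j) (M.dualHi i σ j) := by
  rw [dualSet]
  congr 1
  ext1 j
  simp only [dualLo, dualHi]
  split_ifs <;> rfl

lemma dualHi_sub_dualLo (i : Fin d) (σ : Fin d → ℤ) (j : Fin d) :
    M.dualHi i σ j - M.dualLo i σ j = M.dualWidth i σ j := by
  simp only [dualLo, dualHi, dualWidth, mid, h]
  split_ifs with hj
  · rw [sub_add_cancel]; ring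
  · rfl

lemma measurableSet_dualSet (i : Fin d) (σ : Fin d → ℤ) : MeasurableSet (M.dualSet i σ) := by
  rw [dualSet_eq]
  exact MeasurableSet.univ_pi fun _ => measurableSet_Ioo

lemma volume_dualSet (hM : M.QuasiUniform κ H) {i : Fin d} {σ : Fin d → ℤ}
    (hσ : σ ∈ M.intFaces i) :
    (volume : Measure (Fin d → ℝ)).real (M.dualSet i σ) = M.dualVol i σ := by
  rw [Measure.real, dualSet_eq, Real.volume_pi_Ioo_toReal]
  · simp only [dualHi_sub_dualLo]; rfl
  · intro j
    have := (hM.dualWidth_bounds (i := i) ((mem_intFaces.1 hσ).2 j).1 ((mem_intFaces.1 hσ).2 j).2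
      fun _ => (mem_intFaces.1 hσ).1).1
    rw [← dualHi_sub_dualLo] at this
    exact (sub_pos.1 this).le

lemma volume_dualSet_lt_top (i : Fin d) (σ : Fin d → ℤ) :
    (volume : Measure (Fin d → ℝ)) (M.dualSet i σ) < ⊤ := by
  rw [dualSet_eq, Real.volume_pi_Ioo]
  exact ENNReal.prod_lt_top fun _ _ => ENNReal.ofReal_lt_top

lemma dualSet_subset {i : Fin d} {σ : Fin d → ℤ} (hσ : σ ∈ M.intFaces i) :
    M.dualSet i σ ⊆ boxDomain a b := by
  rw [mem_intFaces] at hσ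
  intro y hy j _
  rw [dualSet_eq] at hy
  have hyj := hy j trivial
  have h2 := hσ.2 j
  have e1 := M.x_mono le_rfl h2.1 h2.2.le
  have e2 := M.x_mono (l := M.n j) (k := σ j + 1) (by omega) (by omega) le_rfl
  rw [M.x_first] at e1
  rw [M.x_last] at e2
  by_cases hj : j = i
  · subst hj
    simp only [dualLo, dualHi, if_true, mid, sub_add_cancel] at hyj
    have e3 := M.x_mono (j := j) le_rfl (show 0 ≤ σ j - 1 by omega) (by omega)
    have e4 := M.x_mono (j := j) (l := M.n j) (k := σ j) (by omega) (by omega) le_rfl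
    rw [M.x_first] at e3
    rw [M.x_last] at e4
    exact ⟨by linarith [hyj.1], by linarith [hyj.2]⟩
  · simp only [dualLo, dualHi, if_neg hj] at hyj
    exact ⟨e1.trans_lt hyj.1, hyj.2.trans_le e2⟩

lemma dualHi_le_dualLo {i j : Fin d} {σ σ' : Fin d → ℤ} (hσ : σ ∈ M.intFaces i)
    (hσ' : σ' ∈ M.intFaces i) (h : σ j < σ' j) : M.dualHi i σ j ≤ M.dualLo i σ' j := by
  rw [mem_intFaces] at hσ hσ'
  have h1 := hσ.2 j
  have h2 := hσ'.2 j
  simp only [dualHi, dualLo]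
  split_ifs with hj
  · subst hj
    have e1 := M.x_mono (j := j) (k := σ j) (l := σ' j - 1) (by omega) (by omega) (by omega)
    have e2 := M.x_mono (j := j) (k := σ j + 1) (l := σ' j - 1 + 1) (by omega) (by omega)
      (by omega)
    simp only [mid]
    linarith
  · exact M.x_mono (by omega) (by omega) (by omega)

lemma disjoint_dualSet {i : Fin d} {σ σ' : Fin d → ℤ} (hσ : σ ∈ M.intFaces i)
    (hσ' : σ' ∈ M.intFaces i) (h : σ ≠ σ') : Disjoint (M.dualSet i σ) (M.dualSet i σ') := by
  rw [Set.disjoint_left]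
  intro y hy hy'
  obtain ⟨j, hj⟩ := Function.ne_iff.1 h
  rw [dualSet_eq] at hy hy'
  have h1 := hy j trivial
  have h2 := hy' j trivial
  rcases lt_or_gt_of_ne hj with hlt | hlt
  · have := dualHi_le_dualLo hσ hσ' hlt
    linarith [h1.2, h2.1]
  · have := dualHi_le_dualLo hσ' hσ hlt
    linarith [h1.1, h2.2]

/-! ### The discrete force -/

/-- Jensen's inequality for the square of a mean value. -/
lemma sq_setIntegral_le {α : Type*} [MeasurableSpace α] {μ : Measure α} {A : Set α}
    (hA : μ A < ⊤) {g : α → ℝ} (hg : MemLp g 2 (μ.restrict A)) :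
    (∫ y in A, g y ∂μ) ^ 2 ≤ μ.real A * ∫ y in A, g y ^ 2 ∂μ := by
  have : IsFiniteMeasure (μ.restrict A) := ⟨by rwa [Measure.restrict_apply_univ]⟩
  have hg1 : Integrable g (μ.restrict A) := hg.integrable one_le_two
  have hg2 : Integrable (fun y => g y ^ 2) (μ.restrict A) := hg.integrable_sq
  have key : ∀ c : ℝ, 0 ≤ (∫ y in A, g y ^ 2 ∂μ) - 2 * c * (∫ y in A, g y ∂μ)
      + c ^ 2 * μ.real A := fun c => by
    have h0 : 0 ≤ ∫ y in A, (g y - c) ^ 2 ∂μ := integral_nonneg fun _ => sq_nonneg _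
    have e : ∀ y, (g y - c) ^ 2 = g y ^ 2 - 2 * c * g y + c ^ 2 := fun y => by ring
    simp only [e] at h0
    have h12 : Integrable (fun y => g y ^ 2 - 2 * c * g y) (μ.restrict A) :=
      hg2.sub (hg1.const_mul _)
    rw [integral_add h12 (integrable_const _),
      integral_sub hg2 (hg1.const_mul _), integral_const_mul, setIntegral_const, smul_eq_mul] at h0
    linarith
  have hV : 0 ≤ μ.real A := measureReal_nonneg
  rcases hV.eq_or_lt with h0 | h0
  · have hz : μ.restrict A = 0 := by
      rw [Measure.restrict_eq_zero]
      exact (measureReal_eq_zero_iff hA.ne).1 h0.symm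
    simp [hz]
  · have h1 := key ((∫ y in A, g y ∂μ) / μ.real A)
    have h2 := mul_nonneg h0.le h1
    have : μ.real A * ((∫ y in A, g y ^ 2 ∂μ) - 2 * ((∫ y in A, g y ∂μ) / μ.real A) *
        (∫ y in A, g y ∂μ) + ((∫ y in A, g y ∂μ) / μ.real A) ^ 2 * μ.real A)
        = μ.real A * (∫ y in A, g y ^ 2 ∂μ) - (∫ y in A, g y ∂μ) ^ 2 := by
      field_simp; ring
    linarith

lemma time_step_le {T : ℝ} {N : ℕ} (hδ : 0 < T / N) {m : ℕ} (hm : m < N) :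
    ((m : ℝ) + 1) * (T / N) ≤ T := by
  have hN : (0 : ℝ) < N := by exact_mod_cast (Nat.zero_le m).trans_lt hm
  have : ((m : ℝ) + 1) ≤ N := by exact_mod_cast hm
  calc ((m : ℝ) + 1) * (T / N) ≤ N * (T / N) := by gcongr
    _ = T := by field_simp

/-- The discrete force is bounded in `L²` by the force. -/
lemma sum_forceNorm_sq_le (hM : M.QuasiUniform κ H) {T : ℝ} {N : ℕ} (hδ : 0 < T / N)
    {f : ℝ → (Fin d → ℝ) → Fin d → ℝ}
    (hf : ∀ i, MemLp (fun z : ℝ × (Fin d → ℝ) => f z.1 z.2 i) 2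
      (volume.restrict (Set.Ioo 0 T ×ˢ boxDomain a b))) :
    ∑ m ∈ Finset.range N, T / N * M.forceNorm T N f m ^ 2
      ≤ ∑ i, ∫ z in Set.Ioo 0 T ×ˢ boxDomain a b, f z.1 z.2 i ^ 2 := by
  set A : Fin d → ℕ × (Fin d → ℤ) → Set (ℝ × (Fin d → ℝ)) := fun i c =>
    Set.Ioo (c.1 * (T / N)) ((c.1 + 1) * (T / N)) ×ˢ M.dualSet i c.2 with hA
  have hAm : ∀ i c, MeasurableSet (A i c) := fun i c =>
    measurableSet_Ioo.prod (measurableSet_dualSet i c.2)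
  have hAsub : ∀ i, ∀ c ∈ Finset.range N ×ˢ M.intFaces i,
      A i c ⊆ Set.Ioo 0 T ×ˢ boxDomain a b := fun i c hc => by
    rw [Finset.mem_product, Finset.mem_range] at hc
    refine Set.prod_mono (Set.Ioo_subset_Ioo (by positivity) (time_step_le hδ hc.1))
      (dualSet_subset hc.2)
  have hAvol : ∀ i, ∀ c ∈ Finset.range N ×ˢ M.intFaces i,
      (volume : Measure (ℝ × (Fin d → ℝ))).real (A i c) = T / N * M.dualVol i c.2 ∧
      (volume : Measure (ℝ × (Fin d → ℝ))) (A i c) < ⊤ := fun i c hc => by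
    rw [Finset.mem_product] at hc
    constructor
    · rw [hA, Measure.volume_eq_prod, measureReal_prod_prod, volume_dualSet hM hc.2,
        Real.volume_real_Ioo_of_le (by nlinarith)]
      ring
    · rw [hA, Measure.volume_eq_prod, Measure.prod_prod]
      exact ENNReal.mul_lt_top (by simp) (volume_dualSet_lt_top i c.2)
  have hdisj : ∀ i, (↑(Finset.range N ×ˢ M.intFaces i) : Set _).Pairwise
      (Function.onFun Disjoint (A i)) := fun i c hc c' hc' hne => by
    rw [Finset.mem_coe, Finset.mem_product] at hc hc'
    have hord : ∀ {p q : ℕ}, p < q → Disjoint (Set.Ioo (p * (T / N)) ((p + 1) * (T / N)))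
        (Set.Ioo (q * (T / N)) ((q + 1) * (T / N))) := fun {p q} hpq => by
      rw [Set.disjoint_left]
      intro t ht ht'
      have : ((p : ℝ) + 1) ≤ q := by exact_mod_cast hpq
      have := mul_le_mul_of_nonneg_right this hδ.le
      linarith [ht.2, ht'.1]
    by_cases h1 : c.1 = c'.1
    · have h2 : c.2 ≠ c'.2 := fun h => hne (Prod.ext h1 h)
      exact Set.disjoint_prod.2 (Or.inr (disjoint_dualSet hc.2 hc'.2 h2))
    · refine Set.disjoint_prod.2 (Or.inl ?_)
      rcases lt_or_gt_of_ne h1 with h | h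
      exacts [hord h, (hord h).symm]
  have hterm : ∀ i, ∀ c ∈ Finset.range N ×ˢ M.intFaces i,
      T / N * (M.dualVol i c.2 * M.forceMean f (c.1 * (T / N)) ((c.1 + 1) * (T / N)) i c.2 ^ 2)
      ≤ ∫ z in A i c, f z.1 z.2 i ^ 2 := fun i c hc => by
    have hD := (hM.dualVol_bounds (Finset.mem_product.1 hc).2).1
    have hj := sq_setIntegral_le (hAvol i c hc).2
      ((hf i).mono_measure (Measure.restrict_mono (hAsub i c hc) le_rfl))
    rw [(hAvol i c hc).1] at hj
    have e : ((c.1 : ℝ) + 1) * (T / N) - c.1 * (T / N) = T / N := by ring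
    rw [forceMean, e, mul_pow]
    have hpos : 0 < T / N * M.dualVol i c.2 := mul_pos hδ hD
    calc _ = (∫ z in A i c, f z.1 z.2 i) ^ 2 / (T / N * M.dualVol i c.2) := by
          simp only [hA]
          generalize T / N = δ at *
          field_simp
      _ ≤ _ := by rw [div_le_iff₀ hpos]; linarith
  calc _ = ∑ i, ∑ c ∈ Finset.range N ×ˢ M.intFaces i, T / N * (M.dualVol i c.2 *
        M.forceMean f (c.1 * (T / N)) ((c.1 + 1) * (T / N)) i c.2 ^ 2) := by
        simp only [Finset.sum_product]
        rw [Finset.sum_comm]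
        refine Finset.sum_congr rfl fun m _ => ?_
        rw [forceNorm, Real.sq_sqrt (hM.l2NormSq_nonneg _), l2NormSq, Finset.mul_sum]
        exact Finset.sum_congr rfl fun i _ => by rw [Finset.mul_sum]
    _ ≤ ∑ i, ∑ c ∈ Finset.range N ×ˢ M.intFaces i, ∫ z in A i c, f z.1 z.2 i ^ 2 :=
        Finset.sum_le_sum fun i _ => Finset.sum_le_sum fun c hc => hterm i c hc
    _ ≤ _ := by
        refine Finset.sum_le_sum fun i _ => ?_
        have hint : IntegrableOn (fun z : ℝ × (Fin d → ℝ) => f z.1 z.2 i ^ 2)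
          (Set.Ioo 0 T ×ˢ boxDomain a b) volume := (hf i).integrable_sq
        rw [← integral_biUnion_finset _ (fun c _ => hAm i c) (hdisj i)
          fun c hc => hint.mono_set (hAsub i c hc)]
        refine setIntegral_mono_set hint (Filter.Eventually.of_forall fun _ => sq_nonneg _) ?_
        exact (Set.iUnion₂_subset fun c hc => hAsub i c hc).eventuallyLE

/-! ### The piecewise constant velocity -/

lemma sq_sum_mul_indicator {α ι : Type*} (s : Finset ι) {D : ι → Set α}
    (hD : (s : Set ι).Pairwise (Function.onFun Disjoint D)) (c : ι → ℝ) (y : α) :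
    (∑ σ ∈ s, c σ * (D σ).indicator (fun _ => (1 : ℝ)) y) ^ 2
      = ∑ σ ∈ s, c σ ^ 2 * (D σ).indicator (fun _ => (1 : ℝ)) y := by
  by_cases h : ∃ σ ∈ s, y ∈ D σ
  · obtain ⟨σ, hσ, hy⟩ := h
    have h0 : ∀ τ ∈ s, τ ≠ σ → (D τ).indicator (fun _ => (1 : ℝ)) y = 0 := fun τ hτ hne =>
      Set.indicator_of_notMem (Set.disjoint_right.1 (hD hτ hσ hne) hy) _
    rw [Finset.sum_eq_single_of_mem σ hσ fun τ hτ hne => by rw [h0 τ hτ hne, mul_zero],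
      Finset.sum_eq_single_of_mem σ hσ fun τ hτ hne => by rw [h0 τ hτ hne, mul_zero],
      Set.indicator_of_mem hy]
    ring
  · push Not at h
    rw [Finset.sum_eq_zero fun σ hσ => by rw [Set.indicator_of_notMem (h σ hσ), mul_zero],
      Finset.sum_eq_zero fun σ hσ => by rw [Set.indicator_of_notMem (h σ hσ), mul_zero]]
    norm_num

lemma mem_Ioc_time_iff {δ : ℝ} (hδ : 0 < δ) {m : ℕ} {t : ℝ} :
    t ∈ Set.Ioc (m * δ) ((m + 1) * δ) ↔ ⌈t / δ⌉₊ = m + 1 := by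
  rw [Nat.ceil_eq_iff (Nat.succ_ne_zero m), Set.mem_Ioc, lt_div_iff₀ hδ, div_le_iff₀ hδ]
  simp

/-- At a time `t` in `(0, T]`, the velocity function is given by the discrete velocity of index
`⌈t N / T⌉`. -/
lemma velFun_eq {T : ℝ} {N : ℕ} (hδ : 0 < T / N) (u : ℕ → Fin d → (Fin d → ℤ) → ℝ)
    (y : Fin d → ℝ) {t : ℝ} (h0 : 1 ≤ ⌈t / (T / N)⌉₊) (h1 : ⌈t / (T / N)⌉₊ ≤ N) (i : Fin d) :
    M.velFun T N u y t i = ∑ σ ∈ M.intFaces i, u ⌈t / (T / N)⌉₊ i σ *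
      (M.dualSet i σ).indicator (fun _ => (1 : ℝ)) y := by
  obtain ⟨m, hm⟩ : ∃ m, ⌈t / (T / N)⌉₊ = m + 1 := ⟨_, (Nat.sub_add_cancel h0).symm⟩
  rw [velFun, Finset.sum_eq_single_of_mem m (Finset.mem_range.2 (by omega))]
  · rw [hm]
    refine Finset.sum_congr rfl fun σ _ => ?_
    rw [Set.indicator_of_mem ((mem_Ioc_time_iff hδ).2 hm), mul_one]
  · intro k _ hk
    refine Finset.sum_eq_zero fun σ _ => ?_
    have hk' : t ∉ Set.Ioc (k * (T / N)) ((k + 1) * (T / N)) := by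
      rw [mem_Ioc_time_iff hδ, hm]
      omega
    rw [Set.indicator_of_notMem hk', mul_zero]

lemma integral_velFun_sub_sq (hM : M.QuasiUniform κ H) {T : ℝ} {N : ℕ} (hδ : 0 < T / N)
    (u : ℕ → Fin d → (Fin d → ℤ) → ℝ) {t t' : ℝ}
    (h0 : 1 ≤ ⌈t / (T / N)⌉₊) (h1 : ⌈t / (T / N)⌉₊ ≤ N)
    (h0' : 1 ≤ ⌈t' / (T / N)⌉₊) (h1' : ⌈t' / (T / N)⌉₊ ≤ N) :
    ∫ y in boxDomain a b, ∑ i, (M.velFun T N u y t' i - M.velFun T N u y t i) ^ 2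
      = M.l2NormSq (u ⌈t' / (T / N)⌉₊ - u ⌈t / (T / N)⌉₊) := by
  set v := u ⌈t' / (T / N)⌉₊ - u ⌈t / (T / N)⌉₊ with hv
  have hpt : ∀ y i, (M.velFun T N u y t' i - M.velFun T N u y t i) ^ 2
      = ∑ σ ∈ M.intFaces i, v i σ ^ 2 * (M.dualSet i σ).indicator (fun _ => (1 : ℝ)) y := by
    intro y i
    rw [velFun_eq hδ u y h0 h1, velFun_eq hδ u y h0' h1', ← Finset.sum_sub_distrib,
      ← sq_sum_mul_indicator _ fun σ hσ σ' hσ' hne => disjoint_dualSet hσ hσ' hne]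
    congr 1
    refine Finset.sum_congr rfl fun σ _ => ?_
    simp only [hv, Pi.sub_apply]
    ring
  simp only [hpt]
  have hint : ∀ i σ, Integrable (fun y => v i σ ^ 2 *
      (M.dualSet i σ).indicator (fun _ => (1 : ℝ)) y) (volume.restrict (boxDomain a b)) :=
    fun i σ => Integrable.const_mul (((integrable_indicator_iff (measurableSet_dualSet i σ)).2
      (integrableOn_const (volume_dualSet_lt_top i σ).ne)).mono_measure Measure.restrict_le_self) _
  rw [integral_finsetSum _ fun i _ => integrable_finsetSum _ fun σ _ => hint i σ]
  refine Finset.sum_congr rfl fun i _ => ?_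
  rw [integral_finsetSum _ fun σ _ => hint i σ]
  refine Finset.sum_congr rfl fun σ hσ => ?_
  have hmeas := measurableSet_dualSet (M := M) i σ
  rw [integral_const_mul, integral_indicator hmeas, Measure.restrict_restrict hmeas,
    Set.inter_eq_left.2 (dualSet_subset hσ), setIntegral_const, volume_dualSet hM hσ, smul_eq_mul]
  ring

/-! ### Time translates -/

lemma integral_indicator_Ioc_le (A : Set ℝ) {p q : ℝ} (hpq : p ≤ q) :
    ∫ t in A, (Set.Ioc p q).indicator (fun _ => (1 : ℝ)) t ≤ q - p := by
  rw [integral_indicator measurableSet_Ioc, Measure.restrict_restrict measurableSet_Ioc,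
    setIntegral_const, smul_eq_mul, mul_one, ← Real.volume_real_Ioc_of_le hpq]
  exact measureReal_mono Set.inter_subset_left (by simp)

lemma integrable_indicator_Ioc (A : Set ℝ) (p q : ℝ) :
    Integrable ((Set.Ioc p q).indicator fun _ => (1 : ℝ)) (volume.restrict A) :=
  ((integrable_indicator_iff measurableSet_Ioc).2 (integrableOn_const (by simp))).mono_measure
    Measure.restrict_le_self

/-- Integration in time of a bound by the sum over the time steps `k` between `t` and `t + τ`,
where `b` is the sequence of norms of the velocities. A step `k` is crossed for `t` in an interval
of length `τ`, and at most `τ / δ + 1` steps are crossed for a given `t`. -/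
lemma integral_le_of_step_bound {T : ℝ} {N : ℕ} (hδ : 0 < T / N) {τ : ℝ} (hτ : 0 < τ)
    {b B : ℕ → ℝ} (hb : ∀ k, 0 ≤ b k) (hB : ∀ k, 0 ≤ B k) {c : ℝ} (hc : 0 ≤ c) {G : ℝ → ℝ}
    (hG0 : ∀ t, 0 ≤ G t)
    (hG : ∀ t, 1 ≤ ⌈t / (T / N)⌉₊ → ⌈t / (T / N)⌉₊ ≤ ⌈(t + τ) / (T / N)⌉₊ →
      ⌈(t + τ) / (T / N)⌉₊ ≤ N → G t ≤ (∑ k ∈ Finset.Ico ⌈t / (T / N)⌉₊ ⌈(t + τ) / (T / N)⌉₊,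
        T / N * (B k + c * b k * b ⌈t / (T / N)⌉₊)) *
        (2 * (b ⌈(t + τ) / (T / N)⌉₊ + b ⌈t / (T / N)⌉₊))) {Λ : ℝ} (hΛ : 0 ≤ Λ)
    (hΛb : Λ ^ 2 = ∑ m ∈ Finset.range N, T / N * b (m + 1) ^ 2) :
    ∫ t in Set.Ioo 0 (T - τ), G t ≤ √(τ + T / N) *
      (4 * (∑ k ∈ Finset.Ico 1 N, T / N * B k) * (Λ + 1) + 8 * c * Λ ^ 3) := by
  set δ := T / N with hδ_def
  set S := ∑ k ∈ Finset.Ico 1 N, δ * B k with hS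
  set ω := √(τ + δ) with hω_def
  have hω : 0 < ω := Real.sqrt_pos.2 (by linarith)
  have hω2 : ω ^ 2 = τ + δ := Real.sq_sqrt (by linarith)
  -- the weight in Young's inequality that balances the two contributions
  set θ := (Λ + 1) / ω with hθ_def
  have hθ : 0 < θ := div_pos (by linarith) hω
  have hS0 : 0 ≤ S := Finset.sum_nonneg fun k _ => mul_nonneg hδ.le (hB k)
  set E := S / θ + 4 * c * ω * Λ with hE
  have hE0 : 0 ≤ E := by positivity
  set χ : ℕ → ℝ → ℝ := fun k => (Set.Ioc (k * δ - τ) (k * δ)).indicator fun _ => (1 : ℝ)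
  set φ : ℕ → ℝ → ℝ := fun m => (Set.Ioc (m * δ) ((m + 1) * δ)).indicator fun _ => (1 : ℝ)
  set ψ : ℕ → ℝ → ℝ := fun m => (Set.Ioc (m * δ - τ) ((m + 1) * δ - τ)).indicator
    fun _ => (1 : ℝ)
  have hχi : ∀ k, Integrable (χ k) (volume.restrict (Set.Ioo 0 (T - τ))) :=
    fun k => integrable_indicator_Ioc _ _ _
  have hφi : ∀ k, Integrable (φ k) (volume.restrict (Set.Ioo 0 (T - τ))) :=
    fun k => integrable_indicator_Ioc _ _ _
  have hψi : ∀ k, Integrable (ψ k) (volume.restrict (Set.Ioo 0 (T - τ))) :=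
    fun k => integrable_indicator_Ioc _ _ _
  have hsq : ∀ {r : ℕ} {g : ℕ → ℝ}, 1 ≤ r → r ≤ N → (∀ m, g m = if r = m + 1 then 1 else 0) →
      ∑ m ∈ Finset.range N, b (m + 1) ^ 2 * g m = b r ^ 2 := by
    intro r g h1 h2 hg
    rw [Finset.sum_eq_single_of_mem (r - 1) (Finset.mem_range.2 (by omega))]
    · rw [hg, Nat.sub_add_cancel h1, if_pos rfl, mul_one]
    · intro m _ hm
      rw [hg, if_neg (by omega), mul_zero]
  have hpt : ∀ t ∈ Set.Ioo 0 (T - τ), G t ≤ 2 * θ * ∑ k ∈ Finset.Ico 1 N, δ * B k * χ k t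
      + E * ∑ m ∈ Finset.range N, b (m + 1) ^ 2 * (φ m t + ψ m t) := by
    intro t ht
    have hN : (0 : ℝ) < N := by
      rcases N.eq_zero_or_pos with h | h
      · rw [hδ_def, h] at hδ; simp at hδ
      · exact_mod_cast h
    have hs1 : 1 ≤ ⌈t / δ⌉₊ := Nat.one_le_ceil_iff.2 (div_pos ht.1 hδ)
    have hsr : ⌈t / δ⌉₊ ≤ ⌈(t + τ) / δ⌉₊ := Nat.ceil_mono (by gcongr; linarith)
    have hrN : ⌈(t + τ) / δ⌉₊ ≤ N := by
      rw [Nat.ceil_le, div_le_iff₀ hδ, hδ_def, mul_div_cancel₀ _ hN.ne']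
      linarith [ht.2]
    have hGt := hG t hs1 hsr hrN
    have hφ : ∑ m ∈ Finset.range N, b (m + 1) ^ 2 * φ m t = b ⌈t / δ⌉₊ ^ 2 :=
      hsq hs1 (hsr.trans hrN) fun m => by
        simp only [φ, Set.indicator_apply, mem_Ioc_time_iff hδ]
    have hψ : ∑ m ∈ Finset.range N, b (m + 1) ^ 2 * ψ m t = b ⌈(t + τ) / δ⌉₊ ^ 2 :=
      hsq (hs1.trans hsr) hrN fun m => by
        simp only [ψ, Set.indicator_apply, ← mem_Ioc_time_iff hδ, Set.mem_Ioc,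
          sub_lt_iff_lt_add, le_sub_iff_add_le]
    have hcross : ∑ k ∈ Finset.Ico 1 N, δ * B k * χ k t
        = ∑ k ∈ Finset.Ico ⌈t / δ⌉₊ ⌈(t + τ) / δ⌉₊, δ * B k := by
      rw [← Finset.sum_subset (Finset.Ico_subset_Ico hs1 hrN) fun k _ hk => ?_]
      · refine Finset.sum_congr rfl fun k hk => ?_
        rw [Finset.mem_Ico, Nat.ceil_le, Nat.lt_ceil, div_le_iff₀ hδ, lt_div_iff₀ hδ] at hk
        simp only [χ]
        have hmem : t ∈ Set.Ioc (k * δ - τ) (k * δ) := ⟨by linarith [hk.2], hk.1⟩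
        rw [Set.indicator_of_mem hmem, mul_one]
      · simp only [χ]
        rw [Set.indicator_of_notMem, mul_zero]
        rintro ⟨h1, h2⟩
        refine hk (Finset.mem_Ico.2 ⟨Nat.ceil_le.2 ((div_le_iff₀ hδ).2 h2), Nat.lt_ceil.2 ?_⟩)
        rw [lt_div_iff₀ hδ]
        linarith
    simp only [mul_add, Finset.sum_add_distrib, hφ, hψ]
    rw [hcross]
    set s := ⌈t / δ⌉₊
    set r := ⌈(t + τ) / δ⌉₊
    have hcount : ((r : ℝ) - s) * δ ≤ ω ^ 2 := by
      have h1 : (r : ℝ) < (t + τ) / δ + 1 := Nat.ceil_lt_add_one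
        (div_nonneg (by linarith [ht.1]) hδ.le)
      have h2 : t / δ ≤ s := Nat.le_ceil _
      rw [hω2]
      have h3 : (r : ℝ) - s ≤ (τ + δ) / δ := by
        have : (t + τ) / δ + 1 - t / δ = (τ + δ) / δ := by field_simp; ring
        linarith
      rwa [le_div_iff₀ hδ] at h3
    set S₁ := ∑ k ∈ Finset.Ico s r, δ * B k with hS₁
    have hS₁S : S₁ ≤ S := Finset.sum_le_sum_of_subset_of_nonneg (Finset.Ico_subset_Ico hs1 hrN)
      fun k _ _ => mul_nonneg hδ.le (hB k)
    have hS₁0 : 0 ≤ S₁ := Finset.sum_nonneg fun k _ => mul_nonneg hδ.le (hB k)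
    have hD : ∑ k ∈ Finset.Ico s r, δ * b k ≤ ω * Λ := by
      refine le_of_sq_le_sq ?_ (by positivity)
      have hcs := Finset.sum_sq_le_sum_mul_sum_of_sq_le_mul (Finset.Ico s r)
        (r := fun k => δ * b k) (f := fun _ => δ) (g := fun k => δ * b k ^ 2)
        (fun _ _ => hδ.le) (fun k _ => by positivity) (fun k _ => le_of_eq (by ring))
      refine hcs.trans ?_
      rw [mul_pow]
      refine mul_le_mul ?_ ?_ (Finset.sum_nonneg fun k _ => by positivity) (sq_nonneg _)
      · rw [Finset.sum_const, Nat.card_Ico, nsmul_eq_mul, Nat.cast_sub hsr]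
        exact hcount
      · have hshift : ∑ m ∈ Finset.range N, δ * b (m + 1) ^ 2
            = ∑ k ∈ Finset.Ico 1 (N + 1), δ * b k ^ 2 := by
          rw [Finset.sum_Ico_eq_sum_range]
          simp [add_comm]
        rw [hΛb, hshift]
        exact Finset.sum_le_sum_of_subset_of_nonneg
          (Finset.Ico_subset_Ico hs1 (hrN.trans (Nat.le_succ N))) fun k _ _ => by positivity
    have e : ∑ k ∈ Finset.Ico s r, δ * (B k + c * b k * b s)
        = S₁ + c * b s * ∑ k ∈ Finset.Ico s r, δ * b k := by
      rw [hS₁, Finset.mul_sum, ← Finset.sum_add_distrib]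
      exact Finset.sum_congr rfl fun k _ => by ring
    rw [e] at hGt
    have hbs := hb s
    have hbr := hb r
    have hyoung : 2 * b r + 2 * b s ≤ 2 * θ + (b s ^ 2 + b r ^ 2) / θ := by
      rw [← sub_nonneg]
      have : 2 * θ + (b s ^ 2 + b r ^ 2) / θ - (2 * b r + 2 * b s)
          = ((b s - θ) ^ 2 + (b r - θ) ^ 2) / θ := by field_simp; ring
      rw [this]; positivity
    have hquad : b s * (b r + b s) ≤ 2 * (b s ^ 2 + b r ^ 2) := by nlinarith [sq_nonneg (b s - b r)]
    calc G t ≤ (S₁ + c * b s * ∑ k ∈ Finset.Ico s r, δ * b k) * (2 * (b r + b s)) := hGt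
      _ ≤ (S₁ + c * b s * (ω * Λ)) * (2 * (b r + b s)) := by gcongr
      _ = S₁ * (2 * b r + 2 * b s) + 2 * c * ω * Λ * (b s * (b r + b s)) := by ring
      _ ≤ S₁ * (2 * θ + (b s ^ 2 + b r ^ 2) / θ)
          + 2 * c * ω * Λ * (2 * (b s ^ 2 + b r ^ 2)) := by gcongr
      _ = 2 * θ * S₁ + S₁ * ((b s ^ 2 + b r ^ 2) / θ) + 4 * c * ω * Λ * (b s ^ 2 + b r ^ 2) := by
          ring
      _ ≤ 2 * θ * S₁ + S * ((b s ^ 2 + b r ^ 2) / θ) + 4 * c * ω * Λ * (b s ^ 2 + b r ^ 2) := by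
          gcongr
      _ = _ := by rw [hE]; ring
  have hχi' : ∀ k, Integrable (fun t => δ * B k * χ k t)
    (volume.restrict (Set.Ioo 0 (T - τ))) := fun k => (hχi k).const_mul _
  have hφψi : ∀ m, Integrable (fun t => b (m + 1) ^ 2 * (φ m t + ψ m t))
    (volume.restrict (Set.Ioo 0 (T - τ))) := fun m => ((hφi m).add (hψi m)).const_mul _
  have hint₁ : Integrable (fun t => 2 * θ * ∑ k ∈ Finset.Ico 1 N, δ * B k * χ k t)
      (volume.restrict (Set.Ioo 0 (T - τ))) :=
    (integrable_finsetSum _ fun k _ => hχi' k).const_mul _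
  have hint₂ : Integrable (fun t => E * ∑ m ∈ Finset.range N, b (m + 1) ^ 2 * (φ m t + ψ m t))
      (volume.restrict (Set.Ioo 0 (T - τ))) :=
    (integrable_finsetSum _ fun m _ => hφψi m).const_mul _
  refine (integral_mono_of_nonneg (Filter.Eventually.of_forall hG0) (hint₁.add hint₂)
    ((ae_restrict_iff' measurableSet_Ioo).2 (Filter.Eventually.of_forall hpt))).trans ?_
  simp only [Pi.add_apply]
  rw [integral_add hint₁ hint₂, integral_const_mul, integral_const_mul,
    integral_finsetSum _ (fun k _ => hχi' k), integral_finsetSum _ (fun m _ => hφψi m)]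
  have h1 : ∑ k ∈ Finset.Ico 1 N, ∫ t in Set.Ioo 0 (T - τ), δ * B k * χ k t ≤ S * τ := by
    rw [hS, Finset.sum_mul]
    refine Finset.sum_le_sum fun k _ => ?_
    rw [integral_const_mul]
    refine mul_le_mul_of_nonneg_left ?_ (mul_nonneg hδ.le (hB k))
    exact (integral_indicator_Ioc_le _ (by linarith)).trans (le_of_eq (by ring))
  have h2 : ∑ m ∈ Finset.range N, ∫ t in Set.Ioo 0 (T - τ), b (m + 1) ^ 2 * (φ m t + ψ m t)
      ≤ 2 * Λ ^ 2 := by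
    rw [hΛb, Finset.mul_sum]
    refine Finset.sum_le_sum fun m _ => ?_
    rw [integral_const_mul, integral_add (hφi m) (hψi m)]
    have e1 : ∫ t in Set.Ioo 0 (T - τ), φ m t ≤ δ :=
      (integral_indicator_Ioc_le _ (by nlinarith)).trans (le_of_eq (by ring))
    have e2 : ∫ t in Set.Ioo 0 (T - τ), ψ m t ≤ δ :=
      (integral_indicator_Ioc_le _ (by nlinarith)).trans (le_of_eq (by ring))
    nlinarith [sq_nonneg (b (m + 1))]
  have h3 : θ * τ ≤ (Λ + 1) * ω := by
    rw [hθ_def, div_mul_eq_mul_div, div_le_iff₀ hω]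
    nlinarith
  have h4 : Λ ^ 2 / θ ≤ (Λ + 1) * ω := by
    rw [hθ_def, div_div_eq_mul_div, div_le_iff₀ (by linarith)]
    nlinarith [mul_nonneg hω.le hΛ]
  calc _ ≤ 2 * θ * (S * τ) + E * (2 * Λ ^ 2) := by gcongr
    _ = 2 * S * (θ * τ) + 2 * S * (Λ ^ 2 / θ) + 8 * c * ω * Λ ^ 3 := by rw [hE]; ring
    _ ≤ 2 * S * ((Λ + 1) * ω) + 2 * S * ((Λ + 1) * ω) + 8 * c * ω * Λ ^ 3 := by gcongr
    _ = _ := by ring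

/-- The `L¹` norm in time is bounded by the `L²` norm. -/
lemma sum_time_step_le {T : ℝ} {N : ℕ} (hδ : 0 < T / N) {g : ℕ → ℝ} (hg : ∀ k, 0 ≤ g k) :
    ∑ k ∈ Finset.Ico 1 N, T / N * g k ≤ √(T * ∑ k ∈ Finset.range N, T / N * g k ^ 2) := by
  have hN : (N : ℝ) ≠ 0 := fun h => by rw [h] at hδ; simp at hδ
  have hsub : Finset.Ico 1 N ⊆ Finset.range N := fun k hk =>
    Finset.mem_range.2 (Finset.mem_Ico.1 hk).2
  refine (Finset.sum_le_sum_of_subset_of_nonneg hsub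
    fun k _ _ => mul_nonneg hδ.le (hg k)).trans (Real.le_sqrt_of_sq_le ?_)
  have hcs := Finset.sum_sq_le_sum_mul_sum_of_sq_le_mul (Finset.range N)
    (r := fun k => T / N * g k) (f := fun _ => T / N) (g := fun k => T / N * g k ^ 2)
    (fun _ _ => hδ.le) (fun k _ => mul_nonneg hδ.le (sq_nonneg _)) (fun k _ => le_of_eq (by ring))
  rwa [Finset.sum_const, Finset.card_range, nsmul_eq_mul, mul_div_cancel₀ _ hN] at hcs

lemma sum_time_step_mul_succ_le {T : ℝ} {N : ℕ} (hδ : 0 < T / N) (g : ℕ → ℝ) :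
    ∑ k ∈ Finset.Ico 1 N, T / N * (g k * g (k + 1))
      ≤ ∑ k ∈ Finset.range N, T / N * g (k + 1) ^ 2 := by
  have h1 : ∑ k ∈ Finset.Ico 1 N, T / N * g k ^ 2
      ≤ ∑ k ∈ Finset.range N, T / N * g (k + 1) ^ 2 := by
    rw [Finset.sum_Ico_eq_sum_range]
    simp only [add_comm 1]
    exact Finset.sum_le_sum_of_subset_of_nonneg (Finset.range_mono (Nat.sub_le N 1))
      fun k _ _ => mul_nonneg hδ.le (sq_nonneg _)
  have h2 : ∑ k ∈ Finset.Ico 1 N, T / N * g (k + 1) ^ 2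
      ≤ ∑ k ∈ Finset.range N, T / N * g (k + 1) ^ 2 :=
    Finset.sum_le_sum_of_subset_of_nonneg
      (fun k hk => Finset.mem_range.2 (Finset.mem_Ico.1 hk).2)
      fun k _ _ => mul_nonneg hδ.le (sq_nonneg _)
  have h3 : ∑ k ∈ Finset.Ico 1 N, T / N * (g k * g (k + 1))
      ≤ ∑ k ∈ Finset.Ico 1 N, (T / N * g k ^ 2 / 2 + T / N * g (k + 1) ^ 2 / 2) :=
    Finset.sum_le_sum fun k _ => by nlinarith [mul_nonneg hδ.le (sq_nonneg (g k - g (k + 1)))]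
  rw [Finset.sum_add_distrib, ← Finset.sum_div, ← Finset.sum_div] at h3
  linarith

end MACGrid

end

theorem lemma3p1 (d : ℕ) (hd : d = 2 ∨ d = 3) (a b : Fin d → ℝ) (hab : ∀ i, a i < b i)
    (T : ℝ) (hT : 0 < T) (f : ℝ → (Fin d → ℝ) → Fin d → ℝ)
    (hf : ∀ i, MemLp (fun z : ℝ × (Fin d → ℝ) => f z.1 z.2 i) 2
      (volume.restrict (Set.Ioo 0 T ×ˢ boxDomain a b)))
    (η : ℝ) :
    ∃ C : ℝ, 0 < C ∧ ∀ M : MACGrid d a b, M.regularity ≤ η →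
      ∀ N : ℕ, 1 ≤ N →
      ∀ (ρmin ρmax : ℝ) (ρ₀ : (Fin d → ℝ) → ℝ), 0 < ρmin →
      AEMeasurable ρ₀ (volume.restrict (boxDomain a b)) →
      (∀ᵐ y ∂(volume.restrict (boxDomain a b)), ρmin < ρ₀ y ∧ ρ₀ y ≤ ρmax) →
      ∀ (u : ℕ → Fin d → (Fin d → ℤ) → ℝ) (ρ p : ℕ → (Fin d → ℤ) → ℝ),
      M.IsSolution T N f ρ₀ u ρ p →
      ∀ τ : ℝ, 0 < τ →
        (∫ t in Set.Ioo 0 (T - τ), ∫ y in boxDomain a b,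
            ∑ i, (M.velFun T N u y (t + τ) i - M.velFun T N u y t i) ^ 2)
          ≤ C * (max ρmax 1 / ρmin) * (M.l2H1Norm T N u ^ 3 + 1) * Real.sqrt (τ + T / N) := by
  set κ : ℝ := max η 1 ^ 2
  have hκ : 0 < κ := by positivity
  set L : ℝ := 2 * κ * ∑ j, (b j - a j)
  have hL : ∀ j, 2 * κ * (b j - a j) ≤ L := fun j => by
    refine mul_le_mul_of_nonneg_left ?_ (by positivity)
    exact Finset.single_le_sum (f := fun j => b j - a j) (fun j _ => (sub_pos.2 (hab j)).le)
      (Finset.mem_univ j)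
  set A := MACGrid.fluxConst d κ L
  have hA : 0 ≤ A := MACGrid.fluxConst_nonneg d hκ L
  set P := MACGrid.poincareConst d κ L
  have hP : 0 ≤ P := Real.sqrt_nonneg _
  set Φ : ℝ := ∑ i, ∫ z in Set.Ioo 0 T ×ˢ boxDomain a b, f z.1 z.2 i ^ 2
  set C₀ := A + √T + P * √(T * Φ) with hC₀
  have hC₀0 : 0 ≤ C₀ := by positivity
  refine ⟨20 * C₀ + 16 * A + 1, by positivity, ?_⟩
  intro M hη N hN ρmin ρmax ρ₀ hρmin hρ₀ hbound u ρ p hs τ hτ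
  have hN0 : (0 : ℝ) < N := by exact_mod_cast hN
  have hδ : 0 < T / N := div_pos hT hN0
  obtain ⟨H, hM⟩ := MACGrid.exists_quasiUniform (by omega : 2 ≤ d) hab hη
  have hρ : ∀ m ≤ N, ∀ K ∈ M.cells, ρmin ≤ ρ m K ∧ ρ m K ≤ ρmax := fun m hm =>
    hs.density_bounds hM hδ hρ₀ hbound hm
  -- the mesh has at least one cell, where both bounds on the density apply
  have hρmax : 0 ≤ ρmax := by
    have h0 : (0 : Fin d → ℤ) ∈ M.cells := MACGrid.mem_cells.2 fun j =>
      ⟨le_rfl, Int.natCast_pos.2 (M.n_pos hab j)⟩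
    have := hρ 0 (Nat.zero_le N) 0 h0
    linarith
  set Λ := M.l2H1Norm T N u with hΛ_def
  have hΛ : 0 ≤ Λ := Real.sqrt_nonneg _
  have hΛb : Λ ^ 2 = ∑ m ∈ Finset.range N, T / N * M.h1Norm (u (m + 1)) ^ 2 := by
    simp only [hM.sq_h1Norm hab]
    exact Real.sq_sqrt (Finset.sum_nonneg fun m _ =>
      mul_nonneg hδ.le (hM.h1NormSq_nonneg hab _))
  have n1 : ∀ k, 0 ≤ M.h1Norm (u k) := fun k => M.h1Norm_nonneg _
  have n2 : ∀ k, 0 ≤ M.forceNorm T N f k := fun k => M.forceNorm_nonneg T N f k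
  set B : ℕ → ℝ := fun k => A * ρmax * M.h1Norm (u k) * M.h1Norm (u (k + 1))
    + M.h1Norm (u (k + 1)) + P * M.forceNorm T N f k with hB_def
  have hB : ∀ k, 0 ≤ B k := fun k => by
    have := n1 k
    have := n1 (k + 1)
    have := n2 k
    simp only [hB_def]
    positivity
  have hmain := MACGrid.integral_le_of_step_bound hδ hτ (b := fun k => M.h1Norm (u k)) (B := B)
    (c := 2 * A * ρmax) n1 hB (by positivity)
    (G := fun t => ρmin * ∫ y in boxDomain a b,
      ∑ i, (M.velFun T N u y (t + τ) i - M.velFun T N u y t i) ^ 2)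
    (fun t => mul_nonneg hρmin.le (integral_nonneg fun y =>
      Finset.sum_nonneg fun i _ => sq_nonneg _))
    (fun t h1 h2 h3 => by
      rw [MACGrid.integral_velFun_sub_sq hM hδ u h1 (h2.trans h3) (h1.trans h2) h3]
      exact hs.l2NormSq_sub_le hM hd hab hL hδ hρmin hρ hρmax h2 h3) hΛ hΛb
  rw [integral_const_mul] at hmain
  set X := max ρmax 1 with hX
  have hX1 : 1 ≤ X := le_max_right _ _
  have hXρ : ρmax ≤ X := le_max_left _ _
  have hS : ∑ k ∈ Finset.Ico 1 N, T / N * B k ≤ X * C₀ * (Λ ^ 2 + Λ + 1) := by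
    have s1 := MACGrid.sum_time_step_mul_succ_le hδ fun k => M.h1Norm (u k)
    have s2 := MACGrid.sum_time_step_le hδ (g := fun k => M.h1Norm (u (k + 1))) fun k => n1 _
    have s3 := (MACGrid.sum_time_step_le hδ n2).trans (Real.sqrt_le_sqrt
      (mul_le_mul_of_nonneg_left (MACGrid.sum_forceNorm_sq_le hM hδ hf) hT.le))
    rw [← hΛb] at s1 s2
    rw [Real.sqrt_mul hT.le, Real.sqrt_sq hΛ] at s2
    have e : ∑ k ∈ Finset.Ico 1 N, T / N * B k
        = A * ρmax * (∑ k ∈ Finset.Ico 1 N, T / N * (M.h1Norm (u k) * M.h1Norm (u (k + 1))))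
          + ∑ k ∈ Finset.Ico 1 N, T / N * M.h1Norm (u (k + 1))
          + P * ∑ k ∈ Finset.Ico 1 N, T / N * M.forceNorm T N f k := by
      rw [Finset.mul_sum, Finset.mul_sum, ← Finset.sum_add_distrib, ← Finset.sum_add_distrib]
      exact Finset.sum_congr rfl fun k _ => by simp only [hB_def]; ring
    calc ∑ k ∈ Finset.Ico 1 N, T / N * B k
        ≤ A * X * Λ ^ 2 + √T * Λ + P * √(T * Φ) := by
          rw [e]
          refine add_le_add (add_le_add ?_ s2) (mul_le_mul_of_nonneg_left s3 hP)
          exact (mul_le_mul_of_nonneg_left s1 (by positivity)).trans (by gcongr)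
      _ ≤ A * X * Λ ^ 2 + X * (√T * Λ) + X * (P * √(T * Φ)) :=
          add_le_add (add_le_add le_rfl (le_mul_of_one_le_left (by positivity) hX1))
            (le_mul_of_one_le_left (by positivity) hX1)
      _ = X * (A * Λ ^ 2 + √T * Λ + P * √(T * Φ) * 1) := by ring
      _ ≤ X * (C₀ * Λ ^ 2 + C₀ * Λ + C₀ * 1) := by
          have : 0 ≤ P * √(T * Φ) := by positivity
          have := Real.sqrt_nonneg T
          gcongr <;> linarith
      _ = _ := by ring
  have hcube : (Λ ^ 2 + Λ + 1) * (Λ + 1) ≤ 5 * (Λ ^ 3 + 1) := by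
    nlinarith only [mul_nonneg hΛ (sq_nonneg (Λ - 1)), sq_nonneg (Λ - 1), pow_nonneg hΛ 3]
  have hω := Real.sqrt_nonneg (τ + T / N)
  have hΛ3 := pow_nonneg hΛ 3
  have hfin : 4 * (∑ k ∈ Finset.Ico 1 N, T / N * B k) * (Λ + 1) + 8 * (2 * A * ρmax) * Λ ^ 3
      ≤ (20 * C₀ + 16 * A + 1) * X * (Λ ^ 3 + 1) := by
    calc _ ≤ 4 * (X * C₀ * (Λ ^ 2 + Λ + 1)) * (Λ + 1) + 8 * (2 * A * X) * Λ ^ 3 := by gcongr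
      _ = 4 * X * C₀ * ((Λ ^ 2 + Λ + 1) * (Λ + 1)) + 16 * A * X * Λ ^ 3 := by ring
      _ ≤ 4 * X * C₀ * (5 * (Λ ^ 3 + 1)) + 16 * A * X * (Λ ^ 3 + 1) := by
          gcongr; linarith
      _ = (20 * C₀ + 16 * A) * (X * (Λ ^ 3 + 1)) := by ring
      _ ≤ (20 * C₀ + 16 * A + 1) * (X * (Λ ^ 3 + 1)) :=
          mul_le_mul_of_nonneg_right (by linarith) (by positivity)
      _ = _ := by ring
  have e : (20 * C₀ + 16 * A + 1) * (X / ρmin) * (Λ ^ 3 + 1) * √(τ + T / N)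
      = √(τ + T / N) * ((20 * C₀ + 16 * A + 1) * X * (Λ ^ 3 + 1)) / ρmin := by ring
  rw [e, le_div_iff₀ hρmin, mul_comm]
  exact hmain.trans (mul_le_mul_of_nonneg_left hfin hω)
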